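/- **Setting.** A labelled configuration is $\vec X=(X_i)_{i\in\mathbb Z}$ with $X_i\in\mathbb Z\cup\{-\infty,\infty\}$; it is *admissible* if $X_i\neq 0$ and, for every $i$, either $X_i<X_{i+1}$ or $X_i=X_{i+1}\in\{-\infty,\infty\}$ (positions of the particles relative to a tagged particle at $0$). Write $\vec X\ge\vec Y$ if $X_i\ge Y_i$ for all $i$. For $z>0$ let $I=\max\{k:X_k<X_i+z\}$ and let $T_{i,z}\vec X$ be the configuration with $(T_{i,z}\vec X)_j=X_j$ for $j<i$ or $j>I$, $=X_{j+1}$ for $i\le j<I$, and $=X_i+z$ for $j=I$. With $R(\vec X)_i=-X_{-i}$, put $T_{i,-z}=R\circ T_{-i,z}\circ R$, and let $T_{i,0}$ be the identity. Let $(\Theta_y\vec X)_j=X_j-y$, $(S_y\vec X)_j=X_{j+y}$, $A_{i,z}=\{X_i+z\notin\vec X\cup\{0\}\}$, $B_y=\{y\notin\vec X\}$. For rates $p(x,y)\ge0$ (taken to be $0$ if $x$ or $y$ is $0$ or $\pm\infty$) and $q(y)\ge0$, $\sum_y q(y)<\infty$, define on bounded functions $F$ of finitely many coordinates $$\tilde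 L F(\vec X)=\sum_{i,z}p(X_i,X_i+z)\mathbf 1_{A_{i,z}}(\vec X)\,[F(T_{i,z}\vec X)-F(\vec X)]+\sum_{y}q(y)\mathbf 1_{B_y}(\vec X)\,[F(\Theta_y\vec X)-F(\vec X)].$$ Let $\tilde L_R$ (resp. $\tilde L_L$) be obtained by replacing $\Theta_y$ by $S_y\circ\Theta_y$ for $y>0$ (resp. for $y<0$). Let $(\vec X_0,G,p,q)$ be the process with generator $G\in\{\tilde L,\tilde L_R,\tilde L_L\}$ and initial configuration $\vec X_0$. We say that $(\vec X_0,G,p,q)\succeq(\vec Y_0,G',p',q')$ for all $\vec X_0\ge\vec Y_0$ if there is one joint jump generator $\Omega$, acting on bounded functions of finitely many coordinates of pairs $(\vec X,\vec Y)$ of admissible configurations, such that (i) $\Omega F(\vec X,\vec Y)=GH(\vec X)$ if $F(\vec X,\vec Y)=H(\vec X)$, and $\Omega F(\vec X,\vec Y)=G'H(\vec Y)$ if $F(\vec X,\vec Y)=H(\vec Y)$; and (ii) from every (deterministic or random) initial pair of admissible configurations $\vec X_0\ge\vec Y_0$ there is a càdlàg Markov process $(\vec W_t,\vec V_t)$ with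 generator $\Omega$ (in the sense of the martingale problem, with transition kernels not depending on the initial pair), which stays in the admissible pairs and satisfies $\vec W_t\ge\vec V_t$ for all $t\ge0$ almost surely. **Theorem.** Let $q:\mathbb Z\setminus\{0\}\to[0,\infty)$ be summable. 1. Let $p:\mathbb Z\to[0,\infty)$ satisfy $p(1)\ge p(2)$, $p(-1)\ge p(-2)$ and $p(k)=0$ for $|k|>2$, and take the rates $p(x,y)=p(y-x)$ for $x,y\ne0$. Then, for all $\vec X_0\ge\vec Y_0$, $$(\vec X_0,\tilde L_R,p,q)\succeq(\vec Y_0,\tilde L,p,0),\qquad(\vec X_0,\tilde L,p,0)\succeq(\vec Y_0,\tilde L_L,p,q).$$ 2. The same holds for all rates $p(x,y)=p_+(x,y)+p_-(y,x)$ where each of $p_+,p_-$ is non-negative, bounded, zero unless $0<y-x\le R$ for some finite $R$, and, for $x<y$ with $x,y\neq0$, nondecreasing in $x$ and nonincreasing in $y$. 3. If $\vec X\ge\vec Y$ are admissible, $z>0$ and $\vec Y\in A_{i,z}$, then there is $z'\ge0$ such that $z'=0$ or $\vec X\in A_{i,z'}$, $\;X_i+z'\le\max\{Y_i+z,X_i\}$,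 and $T_{i,z'}\vec X\ge T_{i,z}\vec Y$. -/

import Mathlib

open MeasureTheory ProbabilityTheory Filter Topology
open scoped NNReal

noncomputable section

namespace TaggedExclusion

/-! ### Labelled configurations -/

/-- Positions relative to the tagged particle: `ℤ ∪ {-∞, ∞}`, with its usual order
(`⊥ = -∞`, `⊤ = ∞`). -/
abbrev Site : Type := WithBot (WithTop ℤ)

/-- The σ-algebra of all subsets of the countable set `Site`. -/
instance instMeasurableSpaceSite : MeasurableSpace Site := ⊤

/-- An integer as a position. -/
def site (x : ℤ) : Site := ((x : WithTop ℤ) : WithBot (WithTop ℤ))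

/-- The reflection `x ↦ -x`, which exchanges `-∞` and `∞`. -/
def negSite (s : Site) : Site :=
  WithBot.recBotCoe (C := fun _ => Site) ⊤
    (fun t => WithTop.recTopCoe (C := fun _ => Site) ⊥ (fun x : ℤ => site (-x)) t) s

/-- Labelled configurations `(X_i)_{i ∈ ℤ}`, ordered coordinatewise, with the product σ-algebra. -/
abbrev Conf : Type := ℤ → Site

/-- `X` labels, in ascending order, the particles of an exclusion configuration on `ℤ ∖ {0}`
(the tagged particle sits at `0`): equal neighbours occur only at `-∞` or `∞`. -/
def Admissible (X : Conf) : Prop :=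
  (∀ i, X i < X (i + 1) ∨ (X i = ⊥ ∧ X (i + 1) = ⊥) ∨ (X i = ⊤ ∧ X (i + 1) = ⊤)) ∧
    ∀ i, X i ≠ site 0

/-- The reflected configuration `R(X)_i = -X_{-i}`. -/
def reflect (X : Conf) : Conf := fun i => negSite (X (-i))

/-- `I_{i,z}(X) = max {k : X_k < X_i + z}`. -/
def lastIndex (X : Conf) (i z : ℤ) : ℤ := sSup {k : ℤ | X k < X i + site z}

/-- `T_{i,z} X` for `z > 0`: the `i`-th particle jumps to `X_i + z` and the particles are relabelled
in ascending order. -/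
def jumpRight (X : Conf) (i z : ℤ) : Conf := fun j =>
  if j < i ∨ lastIndex X i z < j then X j
  else if j < lastIndex X i z then X (j + 1)
  else X i + site z

/-- `T_{i,z} X` for every `z`: negative jumps are the reflections of positive ones, and `T_{i,0}` is
the identity. -/
def jump (X : Conf) (i z : ℤ) : Conf :=
  if 0 < z then jumpRight X i z
  else if z < 0 then reflect (jumpRight (reflect X) (-i) (-z))
  else X

/-- The event `A_{i,z}`: the target `X_i + z` is neither occupied nor the origin. (An infinite `X_i`
never satisfies this.) -/
def JumpAllowed (X : Conf) (i z : ℤ) : Prop :=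
  X i + site z ∉ Set.range X ∧ X i + site z ≠ site 0

/-- `Θ_y X`: the configuration seen from the tagged particle after it has jumped by `y`. -/
def shiftSite (y : ℤ) (X : Conf) : Conf := fun j => X j + site (-y)

/-- `S_y X`: the labels are shifted by `y`. -/
def shiftLabel (y : ℤ) (X : Conf) : Conf := fun j => X (j + y)

/-- The event `B_y`: the site `y` is empty. -/
def TagAllowed (X : Conf) (y : ℤ) : Prop := site y ∉ Set.range X

/-! ### Generators of the labelled processes -/

/-- The rate `p(s, s + z)`, which is zero at `s = ±∞`. -/
def rateFrom (p : ℤ → ℤ → ℝ) (s : Site) (z : ℤ) : ℝ :=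
  WithBot.recBotCoe (C := fun _ => ℝ) 0
    (fun t => WithTop.recTopCoe (C := fun _ => ℝ) 0 (fun x : ℤ => p x (x + z)) t) s

open Classical in
/-- The part of the generator due to the jumps of the red particles. -/
def exchangePart (p : ℤ → ℤ → ℝ) (F : Conf → ℝ) (X : Conf) : ℝ :=
  ∑' iz : ℤ × ℤ, rateFrom p (X iz.1) iz.2 *
    (if JumpAllowed X iz.1 iz.2 then F (jump X iz.1 iz.2) - F X else 0)

open Classical in
/-- The part of the generator due to the jumps of the tagged particle, where after a jump by `y` the
configuration `X` becomes `m y X`. -/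
def tagPart (q : ℤ → ℝ) (m : ℤ → Conf → Conf) (F : Conf → ℝ) (X : Conf) : ℝ :=
  ∑' y : ℤ, q y * (if TagAllowed X y then F (m y X) - F X else 0)

/-- The generator `L̃` with rates `p, q`: no shift of labels. -/
def gen (p : ℤ → ℤ → ℝ) (q : ℤ → ℝ) (F : Conf → ℝ) (X : Conf) : ℝ :=
  exchangePart p F X + tagPart q shiftSite F X

/-- The generator `L̃_R`: the labels are shifted by `y` after a right jump `y > 0` of the tagged
particle. -/
def genR (p : ℤ → ℤ → ℝ) (q : ℤ → ℝ) (F : Conf → ℝ) (X : Conf) : ℝ :=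
  exchangePart p F X +
    tagPart q (fun y X => if 0 < y then shiftLabel y (shiftSite y X) else shiftSite y X) F X

/-- The generator `L̃_L`: the labels are shifted by `y` after a left jump `y < 0` of the tagged
particle. -/
def genL (p : ℤ → ℤ → ℝ) (q : ℤ → ℝ) (F : Conf → ℝ) (X : Conf) : ℝ :=
  exchangePart p F X +
    tagPart q (fun y X => if y < 0 then shiftLabel y (shiftSite y X) else shiftSite y X) F X

/-! ### Jump rates -/

/-- The rates `p(x, y) = p(y - x)` for `x, y ≠ 0`, and `0` otherwise. -/
def homRates (p : ℤ → ℝ) (x y : ℤ) : ℝ := if x = 0 ∨ y = 0 then 0 else p (y - x)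

/-- Attractive translation invariant rates of range two. -/
structure AttractiveRangeTwo (p : ℤ → ℝ) : Prop where
  nonneg : ∀ k, 0 ≤ p k
  right : p 2 ≤ p 1
  left : p (-2) ≤ p (-1)
  range_two : ∀ k : ℤ, 2 < |k| → p k = 0

/-- The class of bounded, attractive, finite range rates for jumps to the right. -/
structure AttractiveRight (p : ℤ → ℤ → ℝ) : Prop where
  nonneg : ∀ x y, 0 ≤ p x y
  eq_zero : ∀ x y, y ≤ x → p x y = 0
  finite_range : ∃ R : ℤ, 0 < R ∧ ∀ x y, R < y - x → p x y = 0
  mono_left : ∀ x x' y, x ≠ 0 → x' ≠ 0 → y ≠ 0 → x ≤ x' → x' < y → p x y ≤ p x' y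
  anti_right : ∀ x y y', x ≠ 0 → y ≠ 0 → y' ≠ 0 → x < y → y ≤ y' → p x y' ≤ p x y
  bounded : ∃ B : ℝ, ∀ x y, p x y ≤ B

/-- The combined rates `p_c(x, y) = p₊(x, y) + p₋(y, x)`. -/
def combined (pr pl : ℤ → ℤ → ℝ) (x y : ℤ) : ℝ := pr x y + pl y x

/-! ### Monotone couplings -/

/-- `H` is bounded and depends on finitely many coordinates. -/
def BddLocal (H : Conf → ℝ) : Prop :=
  (∃ s : Finset ℤ, ∀ X X' : Conf, (∀ j ∈ s, X j = X' j) → H X = H X') ∧ ∃ C : ℝ, ∀ X, |H X| ≤ C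

/-- `F` is bounded and depends on finitely many coordinates of the two configurations. -/
def BddLocalPair (F : Conf × Conf → ℝ) : Prop :=
  (∃ s : Finset ℤ, ∀ z z' : Conf × Conf,
    (∀ j ∈ s, z.1 j = z'.1 j ∧ z.2 j = z'.2 j) → F z = F z') ∧ ∃ C : ℝ, ∀ z, |F z| ≤ C

/-- Both configurations of the pair are admissible. -/
def AdmissiblePair (z : Conf × Conf) : Prop := Admissible z.1 ∧ Admissible z.2

/-- `Ω` is the generator, on bounded local functions, of a jump process of pairs of admissible
configurations: `Ω F(z) = ∑ₖ rₖ(z) (F(mₖ(z)) - F(z))` with countably many kinds of jumps `mₖ` and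
rates `rₖ ≥ 0`. -/
def IsJumpGenerator (Ω : (Conf × Conf → ℝ) → Conf × Conf → ℝ) : Prop :=
  ∃ (r : ℕ → Conf × Conf → ℝ) (m : ℕ → Conf × Conf → Conf × Conf),
    (∀ k, Measurable (r k)) ∧ (∀ k, Measurable (m k)) ∧ (∀ k z, 0 ≤ r k z) ∧
    (∀ k z, AdmissiblePair z → 0 < r k z → AdmissiblePair (m k z)) ∧
    ∀ F, BddLocalPair F →
      (∀ z, AdmissiblePair z → HasSum (fun k => r k z * (F (m k z) - F z)) (Ω F z)) ∧
      ∃ C : ℝ, ∀ z, AdmissiblePair z → |Ω F z| ≤ C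

/-- On functions of one of the two configurations, `Ω` acts as `G`, respectively `G'`. -/
def HasMarginals (Ω : (Conf × Conf → ℝ) → Conf × Conf → ℝ)
    (G G' : (Conf → ℝ) → Conf → ℝ) : Prop :=
  ∀ H, BddLocal H → ∀ z, AdmissiblePair z →
    Ω (fun w => H w.1) z = G H z.1 ∧ Ω (fun w => H w.2) z = G' H z.2

/-- Every coordinate of the path is right-continuous with left limits in the discrete topology. -/
def IsCadlag (f : ℝ≥0 → Conf) : Prop :=
  ∀ (j : ℤ) (t : ℝ≥0), (∀ᶠ s in 𝓝[≥] t, f s j = f t j) ∧ ∃ a : Site, ∀ᶠ s in 𝓝[<] t, f s j = a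

/-- `Z` is a càdlàg Markov process for the filtration `ℱ`, with transition kernels `κ`, initial law
`π` and generator `Ω` (in the sense of the martingale problem on bounded local functions). -/
structure IsProcess {S : Type} {m : MeasurableSpace S} (P : Measure S) (ℱ : Filtration ℝ≥0 m)
    (Z : ℝ≥0 → S → Conf × Conf) (κ : ℝ≥0 → Kernel (Conf × Conf) (Conf × Conf))
    (Ω : (Conf × Conf → ℝ) → Conf × Conf → ℝ) (π : Measure (Conf × Conf)) : Prop where
  adapted : ∀ t, Measurable[ℱ t] (Z t)
  cadlag : ∀ ω, IsCadlag (fun t => (Z t ω).1) ∧ IsCadlag (fun t => (Z t ω).2)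
  initial : P.map (Z 0) = π
  markov : ∀ (s t : ℝ≥0) (A : Set (Conf × Conf)), MeasurableSet A →
    P[(Z (s + t) ⁻¹' A).indicator (fun _ => (1 : ℝ)) | ℱ s]
      =ᵐ[P] fun ω => (κ t (Z s ω)).real A
  martingale : ∀ F, BddLocalPair F →
    Martingale (fun (t : ℝ≥0) ω =>
      F (Z t ω) - F (Z 0 ω) - ∫ s in (0 : ℝ)..t, Ω F (Z s.toNNReal ω)) ℱ P

/-- `(X₀, G) ⪰ (Y₀, G')` for all initial configurations `X₀ ≥ Y₀`: there is one joint generator `Ω`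
with marginals `G` and `G'` such that, from every (possibly random) initial pair `X₀ ≥ Y₀` of
admissible configurations, there is a Markov process `(W, V)` with generator `Ω` which satisfies
`W_t ≥ V_t` for all `t` almost surely. -/
def MonotoneCoupling (G G' : (Conf → ℝ) → Conf → ℝ) : Prop :=
  ∃ (Ω : (Conf × Conf → ℝ) → Conf × Conf → ℝ)
    (κ : ℝ≥0 → Kernel (Conf × Conf) (Conf × Conf)),
    IsJumpGenerator Ω ∧ HasMarginals Ω G G' ∧ (∀ t, IsMarkovKernel (κ t)) ∧
    ∀ π : Measure (Conf × Conf), IsProbabilityMeasure π →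
      (∀ᵐ z ∂π, AdmissiblePair z ∧ z.2 ≤ z.1) →
      ∃ (S : Type) (m : MeasurableSpace S) (P : Measure S) (ℱ : Filtration ℝ≥0 m)
        (Z : ℝ≥0 → S → Conf × Conf),
        IsProbabilityMeasure P ∧ IsProcess P ℱ Z κ Ω π ∧
        ∀ᵐ ω ∂P, ∀ t, AdmissiblePair (Z t ω) ∧ (Z t ω).2 ≤ (Z t ω).1

end TaggedExclusion

end

/-! ### Combinatorics of one jump and of the jump that follows it. -/

namespace TaggedExclusion

/-! ### Arithmetic and order of positions -/

/-! The heart is a combinatorial rule for following a jump. Let `Y ≤ X`, and let the excess `D(u)`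
be the number of particles of `Y` at or left of `u` minus that of `X`, read off from the labels;
where both are finite, order means `D ≥ 0`. A jump of `Y_i` from `y` to `w` lowers `D` by one on
`[y, w)`, and a jump of `X_i` from `x` to `v` raises it by one on `[x, v)`. On `[y, x)` the excess
is at least one anyway. Let `u` be the last site of `[x, w)` with `D(u) ≤ D(w)` and put `v = u + 1`,
or let `X_i` stay if there is no such site. Beyond `u` one has `D > D(w) ≥ 0`, so one unit can be
spared there, and order survives.

As `D` changes by at most one per site, this rule has two further properties. First, `v` is vacant
in `X` and is not the origin, so the jump of `X_i` is allowed; this is `follow_properties`, which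
contains the third claim. Secondly, different jumps of `Y_i` never prescribe the same nonzero jump
of `X_i` (`follow_injective`). Since `y ≤ x` and `v ≤ w`, attractiveness gives `p(y, w) ≤ p(x, v)`.
Hence the following jumps use at most the rate that `X` has, and `X` performs the remainder alone,
which only raises it. This couples the jumps to the right. Reflecting both configurations and
exchanging their roles reduces jumps to the left to jumps to the right.

A jump of the tagged particle by `y` only moves the configuration of the process with rates `q`. For
`y < 0`, passing to `X_j - y` raises it. For `y > 0`, the shift of labels gives `X_{j+y} - y ≥ X_j`,
because distinct finite positions differ by at least one. So `L̃_R` stays above, and `L̃_L` stays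
below by reflection.

The analytic part builds the infinite process. Every kind of coupled jump has an exponential clock
with uniform marks, and a ring is accepted by thinning. Up to a fixed time, blocks of silent clocks
cut the labels into finite pieces, and the tagged particle makes only finitely many attempts because
the bounds on its rates are summable. Each attempt is continuous for coordinatewise convergence, so
evolutions driven by more and more clocks converge locally uniformly in time (`exists_agree_evol`).

The Markov property comes from splicing two independent families of clocks at a time `s`, which
preserves their law because exponential times have no memory (`map_spliceAll`); continuity in the
initial pair carries the resulting flow identity to the limit. The martingale problem follows from
the Markov property and the forward equation. The latter is proved for finitely many clocks by an
expansion for small times that is uniform in the initial pair, and passes to the limit by dominated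
convergence (`forward_path`). -/

lemma site_cases (s : Site) : s = ⊥ ∨ s = ⊤ ∨ ∃ x, s = site x := by
  induction s using WithBot.recBotCoe with
  | bot => exact Or.inl rfl
  | coe t =>
    induction t using WithTop.recTopCoe with
    | top => exact Or.inr (Or.inl rfl)
    | coe x => exact Or.inr (Or.inr ⟨x, rfl⟩)

@[simp] lemma site_le_site {x y : ℤ} : site x ≤ site y ↔ x ≤ y := by
  simp [site]

@[simp] lemma site_lt_site {x y : ℤ} : site x < site y ↔ x < y := by
  simp [site]

@[simp] lemma site_inj {x y : ℤ} : site x = site y ↔ x = y := by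
  simp [site]

@[simp] lemma site_ne_bot (x : ℤ) : site x ≠ ⊥ := by simp [site]

@[simp] lemma bot_ne_site (x : ℤ) : ⊥ ≠ site x := (site_ne_bot x).symm

lemma coe_top_site : ((⊤ : WithTop ℤ) : Site) = ⊤ := rfl

@[simp] lemma site_lt_top (x : ℤ) : site x < ⊤ := by
  rw [← coe_top_site, site, WithBot.coe_lt_coe]; exact WithTop.coe_lt_top x

@[simp] lemma bot_lt_site (x : ℤ) : ⊥ < site x := WithBot.bot_lt_coe _

@[simp] lemma site_ne_top (x : ℤ) : site x ≠ ⊤ := (site_lt_top x).ne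

@[simp] lemma top_ne_site (x : ℤ) : ⊤ ≠ site x := (site_lt_top x).ne'

@[simp] lemma site_add_site (x z : ℤ) : site x + site z = site (x + z) := by
  simp [site]

@[simp] lemma bot_add_site (z : ℤ) : (⊥ : Site) + site z = ⊥ := WithBot.bot_add _

@[simp] lemma top_add_site (z : ℤ) : (⊤ : Site) + site z = ⊤ := by
  rw [← coe_top_site, site, ← WithBot.coe_add]; rfl

@[simp] lemma negSite_site (x : ℤ) : negSite (site x) = site (-x) := rfl

@[simp] lemma negSite_bot : negSite ⊥ = ⊤ := rfl

@[simp] lemma negSite_top : negSite ⊤ = ⊥ := rfl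

@[simp] lemma negSite_negSite (s : Site) : negSite (negSite s) = s := by
  rcases site_cases s with rfl | rfl | ⟨x, rfl⟩ <;> simp

lemma negSite_lt_negSite {s t : Site} : negSite s < negSite t ↔ t < s := by
  rcases site_cases s with rfl | rfl | ⟨x, rfl⟩ <;>
    rcases site_cases t with rfl | rfl | ⟨y, rfl⟩ <;> simp

lemma negSite_le_negSite {s t : Site} : negSite s ≤ negSite t ↔ t ≤ s := by
  rw [← not_lt, ← not_lt, negSite_lt_negSite]

lemma negSite_inj {s t : Site} : negSite s = negSite t ↔ s = t :=
  ⟨fun h => by rw [← negSite_negSite s, h, negSite_negSite], fun h => by rw [h]⟩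

lemma add_site_lt_add_site {s t : Site} (z : ℤ) : s + site z < t + site z ↔ s < t := by
  rcases site_cases s with rfl | rfl | ⟨x, rfl⟩ <;>
    rcases site_cases t with rfl | rfl | ⟨y, rfl⟩ <;> simp

lemma add_site_le_add_site {s t : Site} (z : ℤ) : s + site z ≤ t + site z ↔ s ≤ t := by
  rw [← not_lt, ← not_lt, add_site_lt_add_site]

lemma add_site_eq_site {s : Site} {z w : ℤ} : s + site z = site w ↔ s = site (w - z) := by
  rcases site_cases s with rfl | rfl | ⟨x, rfl⟩ <;> simp
  omega

lemma lt_site_iff {s : Site} {w : ℤ} : s < site w ↔ s ≤ site (w - 1) := by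
  rcases site_cases s with rfl | rfl | ⟨x, rfl⟩ <;> simp

lemma site_lt_iff {s : Site} {w : ℤ} : site w < s ↔ site (w + 1) ≤ s := by
  rcases site_cases s with rfl | rfl | ⟨x, rfl⟩ <;> simp

/-! ### Admissible configurations -/

namespace Admissible

variable {X : Conf} (hX : Admissible X)
include hX

lemma le_succ (i : ℤ) : X i ≤ X (i + 1) := by
  rcases hX.1 i with h | ⟨h, h'⟩ | ⟨h, h'⟩
  · exact h.le
  · rw [h, h']
  · rw [h, h']

lemma monotone : Monotone X := monotone_int_of_le_succ hX.le_succ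

lemma lt_succ_of_site {i x : ℤ} (h : X i = site x) : X i < X (i + 1) := by
  rcases hX.1 i with h' | ⟨h', _⟩ | ⟨h', _⟩
  · exact h'
  · simp [h] at h'
  · simp [h] at h'

lemma lt_succ_of_site' {i x : ℤ} (h : X (i + 1) = site x) : X i < X (i + 1) := by
  rcases hX.1 i with h' | ⟨_, h'⟩ | ⟨_, h'⟩
  · exact h'
  · simp [h] at h'
  · simp [h] at h'

/-- Finite neighbours differ by at least one, and to the right of a finite position nothing sits at
`-∞`. All later bounds on labels in terms of distances come from this. -/
lemma add_nat_le {i x : ℤ} (h : X i = site x) (n : ℕ) : site (x + n) ≤ X (i + n) := by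
  induction n with
  | zero => simp [h]
  | succ n ih =>
    push_cast
    rw [← add_assoc, ← add_assoc, ← site_lt_iff]
    rcases site_cases (X (i + n)) with h' | h' | ⟨y, h'⟩
    · rw [h'] at ih; simp [site] at ih
    · have := hX.le_succ (i + n)
      rw [h', top_le_iff] at this
      rw [this]; simp
    · exact ih.trans_lt (hX.lt_succ_of_site h')

lemma lt_of_lt_of_site {i j x : ℤ} (h : X i = site x) (hij : i < j) : X i < X j :=
  (hX.lt_succ_of_site h).trans_le (hX.monotone (by omega))

lemma lt_of_lt_of_site' {i j x : ℤ} (h : X j = site x) (hij : i < j) : X i < X j := by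
  obtain ⟨k, rfl⟩ : ∃ k, j = k + 1 := ⟨j - 1, by ring⟩
  exact (hX.monotone (by omega)).trans_lt (hX.lt_succ_of_site' h)

/-- Bounds the labels at or left of `u` from above, which makes the integer supremum in `lastLE` a
true maximum. -/
lemma le_of_le_site {i k x u : ℤ} (h : X i = site x) (hk : X k ≤ site u) (hu : x ≤ u) :
    k ≤ i + (u - x) := by
  by_contra! hlt
  have h1 := hX.add_nat_le h (k - i).toNat
  rw [Int.toNat_of_nonneg (by omega)] at h1
  rw [show i + (k - i) = k by ring] at h1
  have := h1.trans hk
  rw [site_le_site] at this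
  omega

lemma ne_zero_of_site {i x : ℤ} (h : X i = site x) : x ≠ 0 := by
  rintro rfl; exact hX.2 i h

end Admissible

/-! ### The last particle to the left of a site -/

/-- The largest label of a particle of `X` at or to the left of `u`. -/
noncomputable def lastLE (X : Conf) (u : ℤ) : ℤ := sSup {k : ℤ | X k ≤ site u}

section lastLE

variable {X : Conf} (hX : Admissible X) {i x u : ℤ}
include hX

lemma lastLE_eq {k : ℤ} (h1 : X k ≤ site u) (h2 : site u < X (k + 1)) : lastLE X u = k := by
  have hb : ∀ l ∈ {k : ℤ | X k ≤ site u}, l ≤ k := by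
    intro l hl
    by_contra! hlt
    exact absurd (h2.trans_le ((hX.monotone (by omega : k + 1 ≤ l)).trans hl)) (lt_irrefl _)
  exact le_antisymm (csSup_le ⟨k, h1⟩ hb) (le_csSup ⟨k, hb⟩ h1)

lemma lastLE_spec (h : X i = site x) (hu : x ≤ u) :
    X (lastLE X u) ≤ site u ∧ site u < X (lastLE X u + 1) ∧ i ≤ lastLE X u ∧
      lastLE X u ≤ i + (u - x) := by
  have hne : ({k : ℤ | X k ≤ site u}).Nonempty := ⟨i, by simp [h, hu]⟩
  have hbd : BddAbove {k : ℤ | X k ≤ site u} :=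
    ⟨i + (u - x), fun k hk => hX.le_of_le_site h hk hu⟩
  have hmem := Int.csSup_mem hne hbd
  refine ⟨hmem, ?_, le_csSup hbd (by simp [h, hu]), hX.le_of_le_site h hmem hu⟩
  by_contra! hle
  have := le_csSup hbd (show lastLE X u + 1 ∈ {k : ℤ | X k ≤ site u} from hle)
  change lastLE X u + 1 ≤ lastLE X u at this
  omega

/-- A site holds at most one particle, so the count grows by at most one per site. This unit step
drives both the vacancy of the following target and the injectivity of the following jump. -/
lemma lastLE_succ (h : X i = site x) (hu : x ≤ u) :
    (lastLE X (u + 1) = lastLE X u ∧ ∀ k, X k ≠ site (u + 1)) ∨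
      (lastLE X (u + 1) = lastLE X u + 1 ∧ X (lastLE X u + 1) = site (u + 1)) := by
  obtain ⟨h1, h2, -, -⟩ := lastLE_spec hX h hu
  rw [site_lt_iff] at h2
  rcases h2.eq_or_lt with h2 | h2
  · refine Or.inr ⟨lastLE_eq hX h2.symm.le ?_, h2.symm⟩
    exact h2 ▸ hX.lt_succ_of_site h2.symm
  · refine Or.inl ⟨lastLE_eq hX (h1.trans (by simp)) h2, fun k hk => ?_⟩
    rcases le_or_gt k (lastLE X u) with hle | hlt
    · have := (hX.monotone hle).trans h1
      rw [hk, site_le_site] at this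
      omega
    · exact absurd (h2.trans_le (hX.monotone (by omega : lastLE X u + 1 ≤ k)))
        (by rw [hk]; exact lt_irrefl _)

end lastLE

lemma lastLE_anti {X Y : Conf} (hX : Admissible X) (hY : Admissible Y) (hle : Y ≤ X)
    {i x y u : ℤ} (hx : X i = site x) (hy : Y i = site y) (hu : x ≤ u) :
    lastLE X u ≤ lastLE Y u := by
  have hyx : y ≤ x := by have := hle i; rwa [hx, hy, site_le_site] at this
  obtain ⟨h1, -, -, -⟩ := lastLE_spec hX hx hu
  obtain ⟨-, h2, -, -⟩ := lastLE_spec hY hy (hyx.trans hu)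
  by_contra! hlt
  exact absurd (h2.trans_le ((hY.monotone (by omega : _ + 1 ≤ lastLE X u)).trans
    ((hle _).trans h1))) (lt_irrefl _)

/-! ### Jumps to the right -/

lemma lastIndex_eq {X : Conf} {i x z : ℤ} (h : X i = site x) :
    lastIndex X i z = lastLE X (x + z - 1) := by
  simp only [lastIndex, lastLE, h, site_add_site]
  congr 1
  ext k
  exact lt_site_iff

lemma JumpAllowed.exists_site {X : Conf} (hX : Admissible X) {i z : ℤ} (h : JumpAllowed X i z) :
    ∃ x, X i = site x ∧ (∀ k, X k ≠ site (x + z)) ∧ x + z ≠ 0 ∧ x ≠ 0 := by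
  rcases site_cases (X i) with h' | h' | ⟨x, h'⟩
  · exact absurd ⟨i, by simp [h']⟩ h.1
  · exact absurd ⟨i, by simp [h']⟩ h.1
  · refine ⟨x, h', fun k hk => h.1 ⟨k, by simp [h', hk]⟩, fun h0 => h.2 ?_, hX.ne_zero_of_site h'⟩
    simp [h', h0]

lemma jumpAllowed_of_site {X : Conf} {i x z : ℤ} (h : X i = site x)
    (h1 : ∀ k, X k ≠ site (x + z)) (h2 : x + z ≠ 0) : JumpAllowed X i z := by
  refine ⟨?_, by simpa [h] using h2⟩
  rintro ⟨k, hk⟩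
  exact h1 k (by simpa [h] using hk)

/-- The description of an allowed jump to the right. -/
lemma exists_jumpRight {X : Conf} (hX : Admissible X) {i x z : ℤ} (hz : 0 < z) (h : X i = site x)
    (h1 : ∀ k, X k ≠ site (x + z)) :
    ∃ I, i ≤ I ∧ I ≤ i + z ∧ lastLE X (x + z) = I ∧ X I < site (x + z) ∧ site (x + z) < X (I + 1) ∧
      (∀ j, j < i → jumpRight X i z j = X j) ∧ (∀ j, I < j → jumpRight X i z j = X j) ∧
      (∀ j, i ≤ j → j < I → jumpRight X i z j = X (j + 1)) ∧
      jumpRight X i z I = site (x + z) := by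
  obtain ⟨h2, h3, h4, h5⟩ := lastLE_spec hX h (show x ≤ x + z - 1 by omega)
  have h6 := lastLE_succ hX h (show x ≤ x + z - 1 by omega)
  rw [sub_add_cancel] at h6
  -- The target is vacant, so counting up to it or strictly below it gives the same label.
  have h7 : lastLE X (x + z) = lastLE X (x + z - 1) := by
    rcases h6 with h6 | h6
    · exact h6.1
    · exact absurd h6.2 (h1 _)
  have hI : lastIndex X i z = lastLE X (x + z - 1) := lastIndex_eq h
  refine ⟨lastLE X (x + z - 1), h4, by omega, h7, lt_site_iff.2 h2, ?_, ?_, ?_, ?_, ?_⟩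
  · rw [site_lt_iff, sub_add_cancel] at h3
    exact lt_of_le_of_ne h3 (h1 _).symm
  · intro j hj; simp [jumpRight, hj]
  · intro j hj; simp [jumpRight, hI, hj]
  · intro j hj hj'
    simp only [jumpRight, hI]
    rw [if_neg (by omega), if_pos hj']
  · simp only [jumpRight, hI]
    rw [if_neg (by omega), if_neg (lt_irrefl _), h, site_add_site]

lemma admissible_jumpRight {X : Conf} (hX : Admissible X) {i z : ℤ} (hz : 0 < z)
    (h : JumpAllowed X i z) : Admissible (jumpRight X i z) := by
  obtain ⟨x, hx, h1, h2, -⟩ := h.exists_site hX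
  obtain ⟨I, hiI, -, -, hI1, hI2, hl, hr, hm, hI⟩ := exists_jumpRight hX hz hx h1
  constructor
  · intro j
    rcases lt_trichotomy (j + 1) i with hj | hj | hj
    · rw [hl j (by omega), hl _ hj]; exact hX.1 j
    · left
      rw [hl j (by omega)]
      have hlt : X j < X i := hX.lt_of_lt_of_site' hx (by omega)
      rcases hiI.eq_or_lt with h' | h'
      · rw [show j + 1 = I by omega, hI]; exact (h' ▸ hlt).trans hI1
      · rw [hj, hm i le_rfl h']; exact hlt.trans_le (hX.monotone (by omega))
    · rcases lt_trichotomy (j + 1) I with hj' | hj' | hj'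
      · rw [hm j (by omega) (by omega), hm _ (by omega) hj']; exact hX.1 _
      · left
        rw [hm j (by omega) (by omega), hj', hI]; exact hI1
      · rcases eq_or_lt_of_le (show I ≤ j by omega) with h' | h'
        · left; rw [← h', hI, hr _ (by omega)]; exact hI2
        · rw [hr j h', hr _ (by omega)]; exact hX.1 _
  · intro j
    rcases lt_or_ge j i with hj | hj
    · rw [hl j hj]; exact hX.2 j
    · rcases lt_trichotomy j I with hj' | hj' | hj'
      · rw [hm j hj hj']; exact hX.2 _
      · rw [hj', hI]; simpa using h2
      · rw [hr j hj']; exact hX.2 _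

/-- After relabelling, a label between `i` and the landing label `I` takes over the position of its
right neighbour, and `I` itself moves to a site beyond `X I`. -/
lemma le_jumpRight {X : Conf} (hX : Admissible X) {i z : ℤ} (hz : 0 < z)
    (h : JumpAllowed X i z) : X ≤ jumpRight X i z := by
  obtain ⟨x, hx, h1, h2, -⟩ := h.exists_site hX
  obtain ⟨I, hiI, -, -, hI1, hI2, hl, hr, hm, hI⟩ := exists_jumpRight hX hz hx h1
  intro j
  rcases lt_or_ge j i with hj | hj
  · rw [hl j hj]
  · rcases lt_trichotomy j I with hj' | hj' | hj'
    · rw [hm j hj hj']; exact hX.le_succ _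
    · rw [hj', hI]; exact hI1.le
    · rw [hr j hj']

/-! ### The jump of the upper configuration which follows a jump of the lower one -/

/-- The difference of the numbers of particles of `Y` and of `X` at or to the left of `u`. -/
noncomputable def excess (X Y : Conf) (u : ℤ) : ℤ := lastLE Y u - lastLE X u

/-- The sites `u` with `X_i ≤ u < Y_i + z` at which the excess is at most that at `Y_i + z`. -/
def followSet (X Y : Conf) (i z : ℤ) : Set ℤ :=
  {u | X i ≤ site u ∧ ∃ w, Y i + site z = site w ∧ u < w ∧ excess X Y u ≤ excess X Y w}

open Classical in
/-- The displacement of the `i`-th particle of `X` when the `i`-th particle of `Y` jumps by `z`. -/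
noncomputable def follow (X Y : Conf) (i z : ℤ) : ℤ :=
  if h : (followSet X Y i z).Nonempty ∧ ∃ x, X i = site x then
    sSup (followSet X Y i z) + 1 - h.2.choose else 0

lemma follow_eq_zero {X Y : Conf} {i z : ℤ} (h : ¬ (followSet X Y i z).Nonempty) :
    follow X Y i z = 0 := by
  rw [follow, dif_neg]; exact fun h' => h h'.1

/-- For finite positions the supremum is attained. Its maximality says that every later site before
the target has an excess strictly larger than the target. -/
lemma follow_spec {X Y : Conf} {i x y z : ℤ} (hx : X i = site x) (hy : Y i = site y)
    (h : (followSet X Y i z).Nonempty) :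
    ∃ u, follow X Y i z = u + 1 - x ∧ x ≤ u ∧ u < y + z ∧ excess X Y u ≤ excess X Y (y + z) ∧
      ∀ u', u < u' → u' < y + z → excess X Y (y + z) < excess X Y u' := by
  have hS : ∀ u, u ∈ followSet X Y i z ↔
      x ≤ u ∧ u < y + z ∧ excess X Y u ≤ excess X Y (y + z) := by
    intro u
    simp only [followSet, hx, hy, site_add_site, site_inj, Set.mem_ofPred_eq, site_le_site,
      exists_eq_left']
  have hbd : BddAbove (followSet X Y i z) := ⟨y + z, fun u hu => ((hS u).1 hu).2.1.le⟩
  have hc : (followSet X Y i z).Nonempty ∧ ∃ x, X i = site x := ⟨h, x, hx⟩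
  have hch : hc.2.choose = x := site_inj.1 (hc.2.choose_spec.symm.trans hx)
  have hmem := (hS _).1 (Int.csSup_mem h hbd)
  refine ⟨sSup (followSet X Y i z), ?_, hmem.1, hmem.2.1, hmem.2.2, fun u' h1 h2 => ?_⟩
  · rw [follow, dif_pos hc, hch]
  · by_contra! hle
    have := le_csSup hbd ((hS u').2 ⟨by omega, h2, hle⟩)
    omega

section follow

variable {X Y : Conf} (hX : Admissible X) (hY : Admissible Y) (hle : Y ≤ X) {i : ℤ}
include hX hY hle

lemma excess_nonneg {x y u : ℤ} (hx : X i = site x) (hy : Y i = site y) (hu : x ≤ u) :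
    0 ≤ excess X Y u := sub_nonneg.2 (lastLE_anti hX hY hle hx hy hu)

/-- Where the particle `j` of `X` is below the particle `j` of the lower configuration after the
jump, the excess vanishes. -/
lemma excess_eq_zero_of_lt {y z j u : ℤ} (hz : 0 < z) (hy : Y i = site y)
    (h1 : ∀ k, Y k ≠ site (y + z)) (hij : i ≤ j) (hj : j ≤ lastLE Y (y + z))
    (hu : X j ≤ site u) (hu' : site u < X (j + 1)) (hlt : site u < jumpRight Y i z j) :
    excess X Y u = 0 ∧ u < y + z := by
  obtain ⟨I, hiI, -, hI0, hI1, hI2, -, -, hm, hI⟩ := exists_jumpRight hY hz hy h1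
  have hYj := (hle j).trans hu
  have hx' : lastLE X u = j := lastLE_eq hX hu hu'
  -- After the jump the lower particle `j` sits at the target if `j = I`, and at `Y (j + 1)`
  -- otherwise. Either way `Y (j + 1)` lies beyond `u`, so `j` is the last label at or left of `u`
  -- in both configurations.
  rcases (hI0 ▸ hj : j ≤ I).eq_or_lt with rfl | hjI
  · rw [hI, site_lt_site] at hlt
    refine ⟨?_, hlt⟩
    rw [excess, hx', lastLE_eq hY hYj ((site_lt_site.2 hlt).trans hI2), sub_self]
  · rw [hm j hij hjI] at hlt
    refine ⟨?_, site_lt_site.1 (hlt.trans ((hY.monotone (by omega)).trans_lt hI1))⟩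
    rw [excess, hx', lastLE_eq hY hYj hlt, sub_self]

omit hX in
-- Outside the labels from `i` to the landing label the lower configuration does not change, so
-- order there is inherited from `Y ≤ X ≤ X'`.
lemma jumpRight_le_of_forall {z : ℤ} {X' : Conf} {y : ℤ} (hz : 0 < z) (hy : Y i = site y)
    (h1 : ∀ k, Y k ≠ site (y + z)) (hXX' : X ≤ X')
    (h : ∀ j, i ≤ j → j ≤ lastLE Y (y + z) → jumpRight Y i z j ≤ X' j) :
    jumpRight Y i z ≤ X' := by
  obtain ⟨I, hiI, -, hI0, hI1, hI2, hl, hr, hm, hI⟩ := exists_jumpRight hY hz hy h1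
  intro j
  rcases lt_or_ge j i with hj | hj
  · rw [hl j hj]; exact (hle j).trans (hXX' j)
  · rcases le_or_gt j I with hj' | hj'
    · exact h j hj (hI0 ▸ hj')
    · rw [hr j hj']; exact (hle j).trans (hXX' j)

/-- Locates a hypothetical violation of the order at an unmoved particle of `X`: it sits at a finite
site before the target where the excess vanishes, and this is what the choice of `follow` excludes.
-/
lemma exists_site_between {y z j : ℤ} (hz : 0 < z) {x : ℤ} (hx : X i = site x)
    (hy : Y i = site y) (h1 : ∀ k, Y k ≠ site (y + z))
    (hij : i ≤ j) (hj : j ≤ lastLE Y (y + z)) (hlt : X j < jumpRight Y i z j) :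
    ∃ u, X j = site u ∧ x ≤ u ∧ u < y + z ∧ excess X Y u = 0 := by
  have hxj : site x ≤ X j := hx ▸ hX.monotone hij
  rcases site_cases (X j) with h' | h' | ⟨u, h'⟩
  · rw [h'] at hxj; simp at hxj
  · rw [h'] at hlt; exact absurd hlt not_top_lt
  · have := excess_eq_zero_of_lt hX hY hle hz hy h1 hij hj h'.le
      (h' ▸ hX.lt_succ_of_site h') (h' ▸ hlt)
    exact ⟨u, h', by rwa [h', site_le_site] at hxj, this.2, this.1⟩

/-- The excess strictly after the chosen site `u` exceeds the nonnegative excess at the target,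
hence is positive. A broken order would require a zero of the excess there, or anywhere in `[X_i,
Y_i + z)` if the particle of `X` stays. -/
theorem follow_properties {z : ℤ} (hz : 0 < z) (h : JumpAllowed Y i z) :
    0 ≤ follow X Y i z ∧ (follow X Y i z ≠ 0 → JumpAllowed X i (follow X Y i z) ∧
      X i + site (follow X Y i z) ≤ Y i + site z) ∧
    jump Y i z ≤ jump X i (follow X Y i z) := by
  obtain ⟨y, hy, h1, h2, -⟩ := h.exists_site hY
  rw [jump, if_pos hz]
  by_cases hne : (followSet X Y i z).Nonempty
  swap
  · rw [follow_eq_zero hne]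
    refine ⟨le_rfl, fun h => absurd rfl h, ?_⟩
    simp only [jump, lt_irrefl, if_false]
    refine jumpRight_le_of_forall hY hle hz hy h1 le_rfl fun j hij hj => ?_
    by_contra! hlt
    rcases site_cases (X i) with hx | hx | ⟨x, hx⟩
    · have := hle i
      rw [hx, hy] at this; simp at this
    · have := hX.monotone hij
      rw [hx, top_le_iff] at this
      rw [this] at hlt; exact not_top_lt hlt
    · obtain ⟨u, -, hu1, hu2, hu3⟩ := exists_site_between hX hY hle hz hx hy h1 hij hj hlt
      -- A zero of the excess is at most the excess at the target, so it would belong to the empty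
      -- `followSet`.
      refine hne ⟨u, by simpa [hx] using hu1, y + z, by simp [hy], hu2, ?_⟩
      rw [hu3]
      exact excess_nonneg hX hY hle hx hy (by omega)
  · obtain ⟨x, hx⟩ : ∃ x, X i = site x := by
      obtain ⟨u, hu, -⟩ := hne
      have h0 := hle i
      rcases site_cases (X i) with hx | hx | hx
      · rw [hx, hy] at h0; simp at h0
      · rw [hx] at hu; simp at hu
      · exact hx
    obtain ⟨u, hu, hxu, huw, hg, hmax⟩ := follow_spec hx hy hne
    have hyx : y ≤ x := by have := hle i; rwa [hx, hy, site_le_site] at this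
    set w := y + z with hw
    have hXu := lastLE_succ hX hx hxu
    have hYu := lastLE_succ hY hy (hyx.trans hxu)
    -- the site `u + 1` is vacant in `X`, and not the origin
    have hvac : (∀ k, X k ≠ site (u + 1)) ∧ u + 1 ≠ 0 := by
      -- If `u + 1 = w`, then `Y` is vacant there and a particle of `X` would make the excess drop,
      -- against `hg`. If `u + 1 < w`, the excess rises between `u` and `u + 1`: so `Y` has a
      -- particle at `u + 1`, which is therefore not the origin, and `X` has none.
      rcases eq_or_lt_of_le (show u + 1 ≤ w by omega) with hv | hv
      · refine ⟨?_, hv ▸ h2⟩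
        rcases hXu with hXu | hXu
        · exact hXu.2
        · exfalso
          rcases hYu with hYu | hYu
          · rw [← hv, excess, excess] at hg; omega
          · exact h1 _ (hv ▸ hYu.2)
      · have hgv := hmax (u + 1) (by omega) hv
        rw [excess] at hgv hg
        rw [excess] at hg
        rw [excess] at hgv
        rcases hYu with hYu | hYu
        · exfalso; rcases hXu with hXu | hXu <;> omega
        · refine ⟨?_, hY.ne_zero_of_site hYu.2⟩
          rcases hXu with hXu | hXu
          · exact hXu.2
          · exfalso; omega
    have hv : x + follow X Y i z = u + 1 := by rw [hu]; ring
    have hpos : 0 < follow X Y i z := by omega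
    have hall : JumpAllowed X i (follow X Y i z) :=
      jumpAllowed_of_site hx (hv ▸ hvac.1) (hv ▸ hvac.2)
    refine ⟨hpos.le, fun _ => ⟨hall, ?_⟩, ?_⟩
    · rw [hx, hy, site_add_site, site_add_site, site_le_site, hv]; omega
    rw [jump, if_pos hpos]
    refine jumpRight_le_of_forall hY hle hz hy h1 (le_jumpRight hX hpos hall) fun j hij hj => ?_
    obtain ⟨K, hiK, -, -, hK1, hK2, -, hXr, hXm, hXK⟩ :=
      exists_jumpRight hX hpos hx (hv ▸ hvac.1)
    rw [hv] at hK1 hK2 hXK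
    obtain ⟨I, hiI, -, hI0, hI1, hI2, hYl, hYr, hYm, hYI⟩ := exists_jumpRight hY hz hy h1
    by_contra! hlt
    -- a site `u' > u` with vanishing excess contradicts the choice of `u`
    have key : ∀ u', u < u' → u' < w → excess X Y u' = 0 → False := by
      intro u' h3 h4 h5
      have h6 := hmax u' h3 h4
      have h7 := excess_nonneg hX hY hle hx hy (show x ≤ w by omega)
      omega
    -- Here `K` is the landing label in `X`. Below `K` the particle `j` has moved to `X (j + 1) ≥ Y
    -- (j + 1)`; at `K` it sits at `u + 1`; above `K` it has not moved and lies beyond `u + 1`. The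
    -- last two cases would produce a zero of the excess after `u`.
    rcases lt_trichotomy j K with hjK | rfl | hjK
    · rw [hXm j hij hjK] at hlt
      rcases (hI0 ▸ hj : j ≤ I).eq_or_lt with rfl | hjI
      · rw [hYI] at hlt
        exact absurd (hlt.trans hI2) (not_lt.2 (hle _))
      · rw [hYm j hij hjI] at hlt
        exact absurd hlt (not_lt.2 (hle _))
    · rw [hXK] at hlt
      have := excess_eq_zero_of_lt hX hY hle hz hy h1 hij hj hK1.le hK2 hlt
      exact key (u + 1) (by omega) this.2 this.1
    · rw [hXr j hjK] at hlt
      obtain ⟨u', h3, -, h4, h5⟩ := exists_site_between hX hY hle hz hx hy h1 hij hj hlt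
      refine key u' ?_ h4 h5
      have := hK2.trans_le (hX.monotone (by omega : K + 1 ≤ j))
      rw [h3, site_lt_site] at this
      omega

/-- Suppose that targets `w₁ < w₂` lead to the same last site `u`. As `w₁` lies in `(u, w₂)`, the
excess satisfies `D(w₁) > D(w₂) ≥ D(u)`. If `u + 1 = w₁`, it rises at a site which is vacant in `Y`.
Otherwise `D(u + 1) > D(w₁)`, so it rises by at least two in one step. Both are impossible. -/
theorem follow_injective {z₁ z₂ : ℤ} (h₁ : JumpAllowed Y i z₁)
    (hlt : z₁ < z₂) (heq : follow X Y i z₁ = follow X Y i z₂) :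
    follow X Y i z₁ = 0 := by
  by_contra hne
  have hne₁ : (followSet X Y i z₁).Nonempty := by
    by_contra h; exact hne (follow_eq_zero h)
  have hne₂ : (followSet X Y i z₂).Nonempty := by
    by_contra h; exact hne (heq.trans (follow_eq_zero h))
  obtain ⟨y, hy, h1, -, -⟩ := h₁.exists_site hY
  obtain ⟨x, hx⟩ : ∃ x, X i = site x := by
    by_contra h; exact hne (by rw [follow, dif_neg]; exact fun h' => h h'.2)
  have hyx : y ≤ x := by have := hle i; rwa [hx, hy, site_le_site] at this
  obtain ⟨u, hu, hxu, huw, hg, hmax⟩ := follow_spec hx hy hne₁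
  obtain ⟨u', hu', -, huw', hg', hmax'⟩ := follow_spec hx hy hne₂
  obtain rfl : u' = u := by omega
  have h3 := hmax' (y + z₁) huw (by omega)
  rcases eq_or_lt_of_le (show u' + 1 ≤ y + z₁ by omega) with hv | hv
  · have hXu := lastLE_succ hX hx hxu
    have hYu := lastLE_succ hY hy (hyx.trans hxu)
    rw [hv] at hXu hYu
    rcases hYu with hYu | hYu
    · rw [excess] at hg' h3
      rw [excess] at h3 hg'
      rcases hXu with hXu | hXu <;> omega
    · exact h1 _ hYu.2
  · have h4 := hmax (u' + 1) (by omega) hv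
    have hXu := lastLE_succ hX hx hxu
    have hYu := lastLE_succ hY hy (hyx.trans hxu)
    have e1 : excess X Y (u' + 1) = lastLE Y (u' + 1) - lastLE X (u' + 1) := rfl
    have e2 : excess X Y u' = lastLE Y u' - lastLE X u' := rfl
    rcases hXu with hXu | hXu <;> rcases hYu with hYu | hYu <;> omega

theorem exists_following_jump {z : ℤ} (hz : 0 < z) (h : JumpAllowed Y i z) :
    ∃ z' : ℤ, 0 ≤ z' ∧ (z' = 0 ∨ JumpAllowed X i z') ∧
      X i + site z' ≤ max (Y i + site z) (X i) ∧ jump Y i z ≤ jump X i z' := by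
  obtain ⟨h0, h1, h2⟩ := follow_properties hX hY hle hz h
  refine ⟨follow X Y i z, h0, ?_, ?_, h2⟩
  · by_cases h3 : follow X Y i z = 0
    · exact Or.inl h3
    · exact Or.inr (h1 h3).1
  · by_cases h3 : follow X Y i z = 0
    · rw [h3]
      refine le_max_of_le_right (le_of_eq ?_)
      rcases site_cases (X i) with h' | h' | ⟨x, h'⟩ <;> simp [h']
    · exact le_max_of_le_left (h1 h3).2

end follow

end TaggedExclusion

/-! ### Deterministic evolutions driven by the rings of clocks, and their limits. -/

namespace TaggedExclusion

/-! ### Composition of maps in the order of finitely many times -/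

section evol

variable {E : Type*} (f : ℝ → E → E)

/-- The maps `f τ`, `τ ∈ S`, are applied in increasing order of `τ`. -/
noncomputable def evol (S : Finset ℝ) (z : E) : E := (S.sort (· ≤ ·)).foldl (fun z τ => f τ z) z

@[simp] lemma evol_empty (z : E) : evol f ∅ z = z := by simp [evol]

lemma sort_insert_max {S : Finset ℝ} {τ : ℝ} (h : ∀ σ ∈ S, σ < τ) :
    (insert τ S).sort (· ≤ ·) = S.sort (· ≤ ·) ++ [τ] := by
  have hτ : τ ∉ S := fun h' => lt_irrefl _ (h τ h')
  apply List.Perm.eq_of_pairwise (le := (· ≤ ·)) (fun a b _ _ h1 h2 => le_antisymm h1 h2)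
    (Finset.pairwise_sort _ _)
  · rw [List.pairwise_append]
    refine ⟨Finset.pairwise_sort _ _, List.pairwise_singleton _ _, fun a ha b hb => ?_⟩
    rw [List.mem_singleton] at hb
    exact hb ▸ (h a ((Finset.mem_sort _).1 ha)).le
  · rw [List.perm_ext_iff_of_nodup (Finset.sort_nodup _ _)]
    · intro a; simp [or_comm]
    · rw [List.nodup_append]
      refine ⟨Finset.sort_nodup _ _, List.nodup_singleton _, fun a ha b hb => ?_⟩
      rw [List.mem_singleton] at hb
      exact hb ▸ (h a ((Finset.mem_sort _).1 ha)).ne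

lemma evol_insert {S : Finset ℝ} {τ : ℝ} (h : ∀ σ ∈ S, σ < τ) (z : E) :
    evol f (insert τ S) z = f τ (evol f S z) := by
  rw [evol, sort_insert_max h, List.foldl_append]; rfl

lemma evol_union {S S' : Finset ℝ} (h : ∀ σ ∈ S, ∀ σ' ∈ S', σ < σ') (z : E) :
    evol f (S ∪ S') z = evol f S' (evol f S z) := by
  induction S' using Finset.induction_on_max with
  | empty => simp
  | insert τ S' hτ ih =>
    rw [Finset.union_insert, evol_insert f, evol_insert f hτ, ih]
    · exact fun σ hσ σ' hσ' => h σ hσ σ' (Finset.mem_insert_of_mem hσ')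
    · intro σ hσ
      rcases Finset.mem_union.1 hσ with hσ | hσ
      · exact h σ hσ τ (Finset.mem_insert_self _ _)
      · exact hτ σ hσ

lemma evol_induction {S : Finset ℝ} {G : Set E} (hf : ∀ τ ∈ S, ∀ z ∈ G, f τ z ∈ G) {z : E}
    (hz : z ∈ G) : evol f S z ∈ G := by
  induction S using Finset.induction_on_max with
  | empty => simpa
  | insert τ S hτ ih =>
    rw [evol_insert f hτ]
    exact hf τ (Finset.mem_insert_self _ _) _
      (ih fun σ hσ => hf σ (Finset.mem_insert_of_mem hσ))

lemma evol_congr {f' : ℝ → E → E} {S : Finset ℝ} (hf : ∀ τ ∈ S, f τ = f' τ) (z : E) :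
    evol f S z = evol f' S z := by
  induction S using Finset.induction_on_max with
  | empty => simp
  | insert τ S hτ ih =>
    rw [evol_insert f hτ, evol_insert f' hτ, hf τ (Finset.mem_insert_self _ _),
      ih fun σ hσ => hf σ (Finset.mem_insert_of_mem hσ)]

lemma evol_image_add (s : ℝ) (S : Finset ℝ) (z : E) :
    evol f (S.image (fun τ => s + τ)) z = evol (fun τ => f (s + τ)) S z := by
  induction S using Finset.induction_on_max with
  | empty => simp
  | insert τ S hτ ih =>
    rw [Finset.image_insert, evol_insert f, evol_insert _ hτ, ih]
    intro σ hσ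
    obtain ⟨σ', h, rfl⟩ := Finset.mem_image.1 hσ
    simpa using hτ σ' h

end evol

/-! ### Pairs of configurations -/

/-- Pairs of configurations. -/
abbrev State : Type := Conf × Conf

/-- The two pairs agree at the label `j`. -/
def AgreeAt (j : ℤ) (z z' : State) : Prop := z.1 j = z'.1 j ∧ z.2 j = z'.2 j

lemma AgreeAt.refl (j : ℤ) (z : State) : AgreeAt j z z := ⟨rfl, rfl⟩

lemma AgreeAt.symm {j : ℤ} {z z' : State} (h : AgreeAt j z z') : AgreeAt j z' z :=
  ⟨h.1.symm, h.2.symm⟩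

lemma AgreeAt.trans {j : ℤ} {z z' z'' : State} (h : AgreeAt j z z') (h' : AgreeAt j z' z'') :
    AgreeAt j z z'' := ⟨h.1.trans h'.1, h.2.trans h'.2⟩

/-- Every coordinate of `x n` is eventually that of `z`. -/
def ConvTo (x : ℕ → State) (z : State) : Prop := ∀ j, ∀ᶠ n in atTop, AgreeAt j (x n) z

/-- Every coordinate of `x n` is eventually constant. -/
lemma exists_convTo {x : ℕ → State} (h : ∀ j, ∃ n₀, ∀ n ≥ n₀, AgreeAt j (x n) (x n₀)) :
    ∃ z, ConvTo x z := by
  choose N hN using h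
  exact ⟨(fun j => (x (N j)).1 j, fun j => (x (N j)).2 j), fun j =>
    eventually_atTop.2 ⟨N j, fun n hn => hN j n hn⟩⟩

lemma ConvTo.unique {x : ℕ → State} {z z' : State} (h : ConvTo x z) (h' : ConvTo x z') :
    z = z' := by
  have : ∀ j, AgreeAt j z z' := fun j => by
    obtain ⟨n, h1, h2⟩ := ((h j).and (h' j)).exists
    exact h1.symm.trans h2
  exact Prod.ext (funext fun j => (this j).1) (funext fun j => (this j).2)

lemma ConvTo.eventually_forall {x : ℕ → State} {z : State} (h : ConvTo x z) {Q : Set ℤ}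
    (hQ : Q.Finite) : ∀ᶠ n in atTop, ∀ j ∈ Q, AgreeAt j (x n) z :=
  (eventually_all_finite hQ).2 fun j _ => h j

lemma ConvTo.const (z : State) : ConvTo (fun _ => z) z := fun j =>
  Eventually.of_forall fun _ => AgreeAt.refl j z

/-- The kinds of events: `(i, a)` is an event of type `a` at the label `i`, and `y` is an attempt of
the tagged particle to jump by `y`. -/
abbrev Kind (A : Type) : Type := (ℤ × A) ⊕ ℤ

variable {A : Type}

/-- The maps `op k u` preserve `G`; those of the events at `i` act locally, on the labels within
distance `w` of `i`, and those of the tagged particle are continuous. -/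
structure IsLocalSystem (G : Set State) (w : ℤ) (op : Kind A → ℝ → State → State) : Prop where
  mapsTo : ∀ k u, ∀ z ∈ G, op k u z ∈ G
  closed : ∀ x z, (∀ n, x n ∈ G) → ConvTo x z → z ∈ G
  outside : ∀ i a u, ∀ z ∈ G, ∀ j, (j < i - w ∨ i + w < j) →
    AgreeAt j (op (Sum.inl (i, a)) u z) z
  inside : ∀ i a u, ∀ z ∈ G, ∀ z' ∈ G, (∀ j, i - w ≤ j → j ≤ i + w → AgreeAt j z z') →
    ∀ j, i - w ≤ j → j ≤ i + w →
      AgreeAt j (op (Sum.inl (i, a)) u z) (op (Sum.inl (i, a)) u z')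
  -- The tagged particle affects all labels at once, so locality is replaced by continuity; this
  -- suffices because its attempts until a given time are finite in number.
  tag : ∀ y u x z, (∀ n, x n ∈ G) → z ∈ G → ConvTo x z →
    ConvTo (fun n => op (Sum.inr y) u (x n)) (op (Sum.inr y) u z)

/-! ### Clocks -/

/-- No clock of a label whose events act across the labels `a`, `a + 1` rings until `T`. -/
def Quiet (w : ℤ) (c : Kind A → Set (ℝ × ℝ)) (T : ℝ) (a : ℤ) : Prop :=
  ∀ i e, a - w < i → i ≤ a + w → ∀ p ∈ c (Sum.inl (i, e)), T < p.1

/-- The properties of the rings `(time, mark)` of the clocks which hold almost surely. -/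
structure GoodClock (w : ℤ) (c : Kind A → Set (ℝ × ℝ)) : Prop where
  pos : ∀ k, ∀ p ∈ c k, 0 < p.1
  inj : ∀ k k', ∀ p ∈ c k, ∀ p' ∈ c k', p.1 = p'.1 → k = k' ∧ p = p'
  finite : ∀ k (T : ℝ), {p ∈ c k | p.1 ≤ T}.Finite
  tags : ∀ T : ℝ, {y : ℤ | ∃ p ∈ c (Sum.inr y), p.1 ≤ T}.Finite
  cut_right : ∀ (T : ℝ) (b : ℤ), ∃ a ≥ b, Quiet w c T a
  cut_left : ∀ (T : ℝ) (b : ℤ), ∃ a ≤ b, Quiet w c T a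

open Classical in
/-- The map which acts at the time `τ`. -/
noncomputable def opAt (op : Kind A → ℝ → State → State) (c : Kind A → Set (ℝ × ℝ)) (τ : ℝ)
    (z : State) : State :=
  if h : ∃ e : Kind A × ℝ, (τ, e.2) ∈ c e.1 then op h.choose.1 h.choose.2 z else z

open Classical in
/-- The times in `D` at which the clocks in `B` ring. -/
noncomputable def ringTimes (c : Kind A → Set (ℝ × ℝ)) (B : Finset (Kind A)) (D : Set ℝ) :
    Finset ℝ :=
  if h : {τ | τ ∈ D ∧ ∃ k ∈ B, ∃ u, (τ, u) ∈ c k}.Finite then h.toFinset else ∅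

section evolution

variable {G : Set State} {w : ℤ} {op : Kind A → ℝ → State → State} {c : Kind A → Set (ℝ × ℝ)}

/-- No two rings of good clocks are simultaneous, so the choice in `opAt` is forced. -/
lemma opAt_eq (hc : GoodClock w c) {k : Kind A} {τ u : ℝ} (h : (τ, u) ∈ c k) (z : State) :
    opAt op c τ z = op k u z := by
  have h' : ∃ e : Kind A × ℝ, (τ, e.2) ∈ c e.1 := ⟨(k, u), h⟩
  obtain ⟨h1, h2⟩ := hc.inj _ _ _ h'.choose_spec _ h rfl
  rw [opAt, dif_pos h', h1, (Prod.ext_iff.1 h2).2]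

lemma opAt_eq_self {τ : ℝ} (h : ∀ k u, (τ, u) ∉ c k) (z : State) : opAt op c τ z = z := by
  rw [opAt, dif_neg]
  rintro ⟨e, he⟩
  exact h _ _ he

lemma opAt_mem (hop : IsLocalSystem G w op) (τ : ℝ) {z : State} (hz : z ∈ G) :
    opAt op c τ z ∈ G := by
  rw [opAt]
  split_ifs
  · exact hop.mapsTo _ _ _ hz
  · exact hz

lemma GoodClock.finite_times (hc : GoodClock w c) (B : Finset (Kind A)) {D : Set ℝ} {T : ℝ}
    (hD : D ⊆ Set.Iic T) : {τ | τ ∈ D ∧ ∃ k ∈ B, ∃ u, (τ, u) ∈ c k}.Finite := by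
  refine ((B.finite_toSet.biUnion fun k _ => (hc.finite k T).image Prod.fst)).subset ?_
  rintro τ ⟨hτ, k, hk, u, hu⟩
  exact Set.mem_biUnion hk ⟨(τ, u), ⟨hu, hD hτ⟩, rfl⟩

lemma mem_ringTimes (hc : GoodClock w c) {B : Finset (Kind A)} {D : Set ℝ} {T τ : ℝ}
    (hD : D ⊆ Set.Iic T) :
    τ ∈ ringTimes c B D ↔ τ ∈ D ∧ ∃ k ∈ B, ∃ u, (τ, u) ∈ c k := by
  rw [ringTimes, dif_pos (hc.finite_times B hD), Set.Finite.mem_toFinset, Set.mem_ofPred_eq]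

lemma evol_mem (hop : IsLocalSystem G w op) (S : Finset ℝ) {z : State} (hz : z ∈ G) :
    evol (opAt op c) S z ∈ G :=
  evol_induction _ (fun τ _ _ h => opAt_mem hop τ h) hz

/-- The time `τ` is a ring of a clock whose event acts only on labels in `(a, b]`. -/
def RingsWithin (w : ℤ) (c : Kind A → Set (ℝ × ℝ)) (a b : ℤ) (τ : ℝ) : Prop :=
  ∃ i e u, (τ, u) ∈ c (Sum.inl (i, e)) ∧ a + 1 ≤ i - w ∧ i + w ≤ b

open Classical in
/-- Between two quiet cuts only the events there matter. -/
lemma agree_evol_filter (hop : IsLocalSystem G w op) (hc : GoodClock w c) {a b : ℤ} {T : ℝ}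
    (ha : Quiet w c T a) (hb : Quiet w c T b) {S : Finset ℝ} (hS : ∀ τ ∈ S, τ ≤ T)
    (htag : ∀ τ ∈ S, ∀ y u, (τ, u) ∉ c (Sum.inr y)) {z z' : State} (hz : z ∈ G) (hz' : z' ∈ G)
    (h : ∀ j, a + 1 ≤ j → j ≤ b → AgreeAt j z z') :
    ∀ j, a + 1 ≤ j → j ≤ b →
      AgreeAt j (evol (opAt op c) S z) (evol (opAt op c) (S.filter (RingsWithin w c a b)) z') := by
  induction S using Finset.induction_on_max with
  | empty => simpa using h
  | insert τ S hτ ih =>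
    replace ih := ih (fun σ hσ => hS σ (Finset.mem_insert_of_mem hσ))
      (fun σ hσ => htag σ (Finset.mem_insert_of_mem hσ))
    have hS' := Finset.mem_insert_self τ S
    rw [evol_insert _ hτ, Finset.filter_insert]
    have hG1 := evol_mem (c := c) hop S hz
    have hG2 := evol_mem (c := c) hop (S.filter (RingsWithin w c a b)) hz'
    by_cases hr : RingsWithin w c a b τ
    · rw [if_pos hr, evol_insert _ (fun σ hσ => hτ σ (Finset.filter_subset _ _ hσ))]
      obtain ⟨i, e, u, hu, h1, h2⟩ := hr
      rw [opAt_eq hc hu, opAt_eq hc hu]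
      intro j hj hj'
      by_cases hji : i - w ≤ j ∧ j ≤ i + w
      · exact hop.inside i e u _ hG1 _ hG2 (fun l hl hl' => ih l (by omega) (by omega)) j
          hji.1 hji.2
      · exact ((hop.outside i e u _ hG1 j (by omega)).trans (ih j hj hj')).trans
          (hop.outside i e u _ hG2 j (by omega)).symm
    · rw [if_neg hr]
      by_cases hk : ∃ k u, (τ, u) ∈ c k
      · obtain ⟨⟨i, e⟩ | y, u, hu⟩ := hk
        · rw [opAt_eq hc hu]
          intro j hj hj'
          refine (hop.outside i e u _ hG1 j ?_).trans (ih j hj hj')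
          -- An event which meets `(a, b]` without being contained in it acts across one of the cuts
          -- `a`, `b`, whose clocks are silent until `T`.
          by_contra hcon
          push Not at hcon
          have h1 : ¬ (a - w < i ∧ i ≤ a + w) := fun h1 =>
            absurd (hS τ hS') (not_le.2 (ha i e h1.1 h1.2 _ hu))
          have h2 : ¬ (b - w < i ∧ i ≤ b + w) := fun h1 =>
            absurd (hS τ hS') (not_le.2 (hb i e h1.1 h1.2 _ hu))
          exact hr ⟨i, e, u, hu, by omega, by omega⟩
        · exact absurd hu (htag τ hS' y u)
      · rw [opAt_eq_self (fun k u hu => hk ⟨k, u, hu⟩)]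
        exact ih

variable [Fintype A] {B : ℕ → Finset (Kind A)} {x : ℕ → State} {z₀ : State}

/-- Convergence of the evolution in a set of times at which the tagged particle does not attempt to
jump. -/
lemma exists_agree_evol_of_no_tag (hop : IsLocalSystem G w op) (hc : GoodClock w c)
    (hB : ∀ k, ∀ᶠ n in atTop, k ∈ B n) (hx : ∀ n, x n ∈ G) (hconv : ConvTo x z₀) (T : ℝ) (j : ℤ) :
    ∀ᶠ n₀ in atTop, ∀ n ≥ n₀, ∀ D ⊆ Set.Iic T, (∀ τ ∈ D, ∀ y u, (τ, u) ∉ c (Sum.inr y)) →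
      AgreeAt j (evol (opAt op c) (ringTimes c (B n) D) (x n))
        (evol (opAt op c) (ringTimes c (B n₀) D) (x n₀)) := by
  classical
  have hz₀ : z₀ ∈ G := hop.closed x z₀ hx hconv
  obtain ⟨b, hbj, hb⟩ := hc.cut_right T j
  obtain ⟨a, haj, ha⟩ := hc.cut_left T (j - 1)
  have h1 := hconv.eventually_forall (Set.finite_Icc (a + 1) b)
  have h2 : ∀ᶠ n in atTop, ∀ p ∈ ((Set.Icc (a + 1 + w) (b - w)) ×ˢ (Set.univ : Set A)),
      Sum.inl p ∈ B n :=
    (eventually_all_finite ((Set.finite_Icc _ _).prod Set.finite_univ)).2 fun p _ => hB _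
  -- The common reference is the evolution from the limit `z₀` under the clocks inside the block
  -- alone. Once `B n'` contains these finitely many clocks, it does not depend on `n'`.
  have key : ∀ᶠ n in atTop, ∀ D ⊆ Set.Iic T, (∀ τ ∈ D, ∀ y u, (τ, u) ∉ c (Sum.inr y)) →
      ∀ n', (∀ p ∈ ((Set.Icc (a + 1 + w) (b - w)) ×ˢ (Set.univ : Set A)), Sum.inl p ∈ B n') →
      AgreeAt j (evol (opAt op c) (ringTimes c (B n) D) (x n))
        (evol (opAt op c) ((ringTimes c (B n') D).filter (RingsWithin w c a b)) z₀) := by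
    filter_upwards [h1, h2] with n hn1 hn2 D hD htag n' hn'
    have := agree_evol_filter hop hc ha hb (S := ringTimes c (B n) D)
      (fun τ hτ => hD ((mem_ringTimes hc hD).1 hτ).1)
      (fun τ hτ => htag τ ((mem_ringTimes hc hD).1 hτ).1) (hx n) hz₀
      (fun j h h' => hn1 j ⟨h, h'⟩) j (by omega) hbj
    have heq : (ringTimes c (B n) D).filter (RingsWithin w c a b) =
        (ringTimes c (B n') D).filter (RingsWithin w c a b) := by
      ext τ
      simp only [Finset.mem_filter, mem_ringTimes hc hD]
      constructor
      · rintro ⟨⟨h3, -⟩, i, e, u, hu, h4, h5⟩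
        exact ⟨⟨h3, _, hn' (i, e) ⟨⟨by simp; omega, by simp; omega⟩, trivial⟩, u, hu⟩, i, e, u, hu,
          h4, h5⟩
      · rintro ⟨⟨h3, -⟩, i, e, u, hu, h4, h5⟩
        exact ⟨⟨h3, _, hn2 (i, e) ⟨⟨by simp; omega, by simp; omega⟩, trivial⟩, u, hu⟩, i, e, u, hu,
          h4, h5⟩
    rwa [heq] at this
  obtain ⟨N, hN⟩ := eventually_atTop.1 (key.and h2)
  refine eventually_atTop.2 ⟨N, fun n₀ hn₀ n hn D hD htag => ?_⟩
  exact ((hN n (hn₀.trans hn)).1 D hD htag n₀ (hN n₀ hn₀).2).trans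
    ((hN n₀ hn₀).1 D hD htag n₀ (hN n₀ hn₀).2).symm

/-- The times at which the tagged particle attempts to jump. -/
def tagTimes (c : Kind A → Set (ℝ × ℝ)) : Set ℝ := {τ | ∃ y u, (τ, u) ∈ c (Sum.inr y)}

omit [Fintype A] in
lemma GoodClock.finite_tagTimes (hc : GoodClock w c) (T : ℝ) :
    (tagTimes c ∩ Set.Iic T).Finite := by
  refine ((hc.tags T).biUnion fun y _ => (hc.finite (Sum.inr y) T).image Prod.fst).subset ?_
  rintro τ ⟨⟨y, u, hu⟩, hτ⟩
  exact Set.mem_biUnion (show y ∈ {y : ℤ | ∃ p ∈ c (Sum.inr y), p.1 ≤ T} from ⟨_, hu, hτ⟩)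
    ⟨(τ, u), ⟨hu, hτ⟩, rfl⟩

/-- The time set is split at its last attempt `τ` of the tagged particle: the pairs just before `τ`
converge by hypothesis, the attempt is continuous, and after it the local argument applies. As `Θ`
is finite, one index serves all `D`, whence uniformity in time. -/
lemma exists_agree_evol_of_convTo (hop : IsLocalSystem G w op) (hc : GoodClock w c)
    (hB : ∀ k, ∀ᶠ n in atTop, k ∈ B n) (hx : ∀ n, x n ∈ G) (hconv : ConvTo x z₀) (T : ℝ)
    {Θ : Set ℝ} (hΘ : Θ ⊆ tagTimes c ∩ Set.Iic T)
    (hΘc : ∀ τ ∈ Θ, ∃ z, ConvTo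
      (fun n => evol (opAt op c) (ringTimes c (B n) (Set.Iio τ)) (x n)) z) (j : ℤ) :
    ∃ n₀, ∀ n ≥ n₀, ∀ D ⊆ Set.Iic T, IsLowerSet D → D ∩ tagTimes c ⊆ Θ →
      AgreeAt j (evol (opAt op c) (ringTimes c (B n) D) (x n))
        (evol (opAt op c) (ringTimes c (B n₀) D) (x n₀)) := by
  classical
  have hΘf : Θ.Finite := (hc.finite_tagTimes T).subset hΘ
  -- convergence right after the jump of the tagged particle
  have h1 : ∀ τ ∈ Θ, ∀ᶠ n₀ in atTop, ∀ n ≥ n₀, ∀ D ⊆ Set.Iic T,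
      (∀ τ ∈ D, ∀ y u, (τ, u) ∉ c (Sum.inr y)) →
      AgreeAt j (evol (opAt op c) (ringTimes c (B n) D)
          (opAt op c τ (evol (opAt op c) (ringTimes c (B n) (Set.Iio τ)) (x n))))
        (evol (opAt op c) (ringTimes c (B n₀) D)
          (opAt op c τ (evol (opAt op c) (ringTimes c (B n₀) (Set.Iio τ)) (x n₀)))) := by
    intro τ hτ
    obtain ⟨z, hz⟩ := hΘc τ hτ
    obtain ⟨y, u, hu⟩ := (hΘ hτ).1
    have hm : ∀ n, evol (opAt op c) (ringTimes c (B n) (Set.Iio τ)) (x n) ∈ G :=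
      fun n => evol_mem hop _ (hx n)
    refine exists_agree_evol_of_no_tag (z₀ := op (Sum.inr y) u z) (x := fun n =>
      opAt op c τ (evol (opAt op c) (ringTimes c (B n) (Set.Iio τ)) (x n))) hop hc hB
      (fun n => opAt_mem hop _ (hm n)) ?_ T j
    simp only [opAt_eq hc hu]
    exact hop.tag y u _ z hm (hop.closed _ z hm hz) hz
  have h2 : ∀ τ ∈ Θ, ∀ᶠ n₀ in atTop, ∀ n ≥ n₀, ∃ y u, (τ, u) ∈ c (Sum.inr y) ∧
      Sum.inr y ∈ B n := by
    intro τ hτ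
    obtain ⟨y, u, hu⟩ := (hΘ hτ).1
    filter_upwards [eventually_forall_ge_atTop.2 (hB (Sum.inr y))] with n₀ h n hn
    exact ⟨y, u, hu, h n hn⟩
  obtain ⟨n₀, hn0, hn1, hn2⟩ := ((exists_agree_evol_of_no_tag hop hc hB hx hconv T j).and
    (((eventually_all_finite hΘf).2 h1).and ((eventually_all_finite hΘf).2 h2))).exists
  refine ⟨n₀, fun n hn D hD hlow hDΘ => ?_⟩
  by_cases hne : (D ∩ tagTimes c).Nonempty
  swap
  · refine hn0 n hn D hD fun τ hτ y u hu => hne ⟨τ, hτ, y, u, hu⟩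
  obtain ⟨τ, hτ, hmax⟩ := (hΘf.subset hDΘ).exists_maximal hne
  have hτΘ := hDΘ hτ
  have hsplit : ∀ m ≥ n₀, ringTimes c (B m) D =
      (insert τ (ringTimes c (B m) (Set.Iio τ))) ∪ ringTimes c (B m) (D ∩ Set.Ioi τ) := by
    intro m hm
    obtain ⟨y, u, hu, hy⟩ := hn2 τ hτΘ m hm
    ext σ
    rw [mem_ringTimes hc hD, Finset.mem_union, Finset.mem_insert,
      mem_ringTimes hc (Set.Iio_subset_Iic_self), mem_ringTimes hc (Set.inter_subset_left.trans hD)]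
    constructor
    · rintro ⟨h3, h4⟩
      rcases lt_trichotomy σ τ with h5 | h5 | h5
      · exact Or.inl (Or.inr ⟨h5, h4⟩)
      · exact Or.inl (Or.inl h5)
      · exact Or.inr ⟨⟨h3, h5⟩, h4⟩
    · rintro ((rfl | ⟨h3, h4⟩) | ⟨h3, h4⟩)
      · exact ⟨hτ.1, _, hy, u, hu⟩
      · exact ⟨hlow (le_of_lt h3) hτ.1, h4⟩
      · exact ⟨h3.1, h4⟩
  have hevol : ∀ m ≥ n₀, evol (opAt op c) (ringTimes c (B m) D) (x m) =
      evol (opAt op c) (ringTimes c (B m) (D ∩ Set.Ioi τ))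
        (opAt op c τ (evol (opAt op c) (ringTimes c (B m) (Set.Iio τ)) (x m))) := by
    intro m hm
    have hlt : ∀ σ ∈ ringTimes c (B m) (Set.Iio τ), σ < τ := fun σ hσ =>
      ((mem_ringTimes hc (Set.Iio_subset_Iic_self)).1 hσ).1
    rw [hsplit m hm, evol_union, evol_insert _ hlt]
    intro σ hσ σ' hσ'
    have h3 : τ < σ' := ((mem_ringTimes hc (Set.inter_subset_left.trans hD)).1 hσ').1.2
    rcases Finset.mem_insert.1 hσ with rfl | hσ
    · exact h3
    · exact (hlt σ hσ).trans h3
  rw [hevol n hn, hevol n₀ le_rfl]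
  refine hn1 τ hτΘ n hn _ (Set.inter_subset_left.trans hD) fun σ hσ y u hu => ?_
  exact absurd (hmax ⟨hσ.1, y, u, hu⟩ (le_of_lt hσ.2)) (not_le.2 hσ.2)

/-- The evolutions driven by more and more clocks, from converging initial pairs, converge, locally
uniformly in time. -/
theorem exists_agree_evol (hop : IsLocalSystem G w op) (hc : GoodClock w c)
    (hB : ∀ k, ∀ᶠ n in atTop, k ∈ B n) (hx : ∀ n, x n ∈ G) (hconv : ConvTo x z₀) (T : ℝ) (j : ℤ) :
    ∃ n₀, ∀ n ≥ n₀, ∀ t ≤ T,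
      AgreeAt j (evol (opAt op c) (ringTimes c (B n) (Set.Iic t)) (x n))
        (evol (opAt op c) (ringTimes c (B n₀) (Set.Iic t)) (x n₀)) := by
  have hfin := hc.finite_tagTimes T
  have key : ∀ τ ∈ tagTimes c ∩ Set.Iic T, ∃ z, ConvTo
      (fun n => evol (opAt op c) (ringTimes c (B n) (Set.Iio τ)) (x n)) z := by
    intro τ hτ
    -- Induction along the finitely many attempts of the tagged particle: convergence just before
    -- all earlier ones gives convergence just before the next.
    refine (hfin.wellFoundedOn (r := (· < ·))).induction (P := fun τ => ∃ z, ConvTo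
      (fun n => evol (opAt op c) (ringTimes c (B n) (Set.Iio τ)) (x n)) z) hτ fun τ hτ ih => ?_
    refine exists_convTo fun j => ?_
    obtain ⟨n₀, h⟩ := exists_agree_evol_of_convTo hop hc hB hx hconv T
      (Θ := tagTimes c ∩ Set.Iio τ)
      (fun σ hσ => ⟨hσ.1, Set.Iio_subset_Iic (Set.mem_Iic.1 hτ.2) hσ.2⟩)
      (fun σ hσ => ih σ ⟨hσ.1, Set.Iio_subset_Iic (Set.mem_Iic.1 hτ.2) hσ.2⟩ hσ.2) j
    exact ⟨n₀, fun n hn => h n hn _ (Set.Iio_subset_Iic (Set.mem_Iic.1 hτ.2)) (isLowerSet_Iio τ)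
      fun σ hσ => ⟨hσ.2, hσ.1⟩⟩
  obtain ⟨n₀, h⟩ := exists_agree_evol_of_convTo hop hc hB hx hconv T subset_rfl key j
  exact ⟨n₀, fun n hn t ht => h n hn _ (Set.Iic_subset_Iic.2 ht) (isLowerSet_Iic t)
    fun σ hσ => ⟨hσ.2, le_trans hσ.1 ht⟩⟩

end evolution

end TaggedExclusion

/-! ### Marked exponential clocks and the invariance of their law under splicing. -/

namespace TaggedExclusion

open scoped ENNReal

/-! ### Exponential clocks -/

/-- A clock: its waiting times together with the marks of its rings. -/
abbrev Clock : Type := ℕ → ℝ × ℝ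

/-- The time of the `n`-th ring. -/
def arrival (ω : Clock) (n : ℕ) : ℝ := ∑ i ∈ Finset.range (n + 1), (ω i).1

/-- The rings `(time, mark)` of a clock. -/
def rings (ω : Clock) : Set (ℝ × ℝ) := Set.range fun n => (arrival ω n, (ω n).2)

/-- The clock after its first ring. -/
def tailClock (ω : Clock) : Clock := fun n => ω (n + 1)

/-- A clock with a given first ring. -/
def consClock (x : ℝ × ℝ) (ω : Clock) : Clock
  | 0 => x
  | n + 1 => ω n

open Classical in
/-- The clock which rings as `ω` until the time `s`, and from then on as `ω'`. -/
noncomputable def splice (s : ℝ) (ω ω' : Clock) : ℕ → ℝ × ℝ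
  | 0 => if s < (ω 0).1 then (s + (ω' 0).1, (ω' 0).2) else ω 0
  | n + 1 => if s < (ω 0).1 then ω' (n + 1) else splice (s - (ω 0).1) (fun n => ω (n + 1)) ω' n

lemma splice_of_lt {s : ℝ} {ω : Clock} (h : s < (ω 0).1) (ω' : Clock) :
    splice s ω ω' = consClock (s + (ω' 0).1, (ω' 0).2) (tailClock ω') := by
  funext n; cases n <;> simp [splice, h, consClock, tailClock]

lemma splice_of_le {s : ℝ} {ω : Clock} (h : (ω 0).1 ≤ s) (ω' : Clock) :
    splice s ω ω' = consClock (ω 0) (splice (s - (ω 0).1) (tailClock ω) ω') := by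
  funext n; cases n <;> simp [splice, not_lt.2 h, consClock]; rfl

lemma arrival_zero (ω : Clock) : arrival ω 0 = (ω 0).1 := by simp [arrival]

lemma arrival_succ (ω : Clock) (n : ℕ) :
    arrival ω (n + 1) = (ω 0).1 + arrival (tailClock ω) n := by
  rw [arrival, Finset.sum_range_succ']; simp [arrival, tailClock, add_comm]

lemma arrival_pos {ω : Clock} (h : ∀ n, 0 < (ω n).1) (n : ℕ) : 0 < arrival ω n :=
  Finset.sum_pos (fun i _ => h i) (by simp)

lemma strictMono_arrival {ω : Clock} (h : ∀ n, 0 < (ω n).1) : StrictMono (arrival ω) :=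
  strictMono_nat_of_lt_succ fun n => by
    rw [arrival, arrival, Finset.sum_range_succ _ (n + 1)]; linarith [h (n + 1)]

lemma mem_rings_iff {ω : Clock} {p : ℝ × ℝ} :
    p ∈ rings ω ↔ p = ω 0 ∨ (p.1 - (ω 0).1, p.2) ∈ rings (tailClock ω) := by
  constructor
  · rintro ⟨n, rfl⟩
    cases n with
    | zero => left; simp [arrival_zero]
    | succ n => right; exact ⟨n, by simp [arrival_succ, tailClock]⟩
  · rintro (rfl | ⟨n, hn⟩)
    · exact ⟨0, by simp [arrival_zero]⟩
    · refine ⟨n + 1, ?_⟩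
      rw [Prod.ext_iff] at hn ⊢
      simp only [arrival_succ] at hn ⊢
      exact ⟨by linarith [hn.1], hn.2⟩

lemma rings_pos {ω : Clock} (h : ∀ n, 0 < (ω n).1) {p : ℝ × ℝ} (hp : p ∈ rings ω) : 0 < p.1 := by
  obtain ⟨n, rfl⟩ := hp; exact arrival_pos h n

lemma first_le_of_mem_rings {ω : Clock} (h : ∀ n, 0 < (ω n).1) {p : ℝ × ℝ} (hp : p ∈ rings ω) :
    (ω 0).1 ≤ p.1 := by
  obtain ⟨n, rfl⟩ := hp
  rw [← arrival_zero]; exact (strictMono_arrival h).monotone (Nat.zero_le n)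

/-- Induction on a number of rings that suffices to pass `s`. If the first ring is later than `s`,
the spliced clock is `ω'` delayed by `s`; otherwise that ring is kept, and the tail is spliced at
the remaining time. -/
lemma mem_rings_splice {ω ω' : Clock} (h : ∀ n, 0 < (ω n).1) (h' : ∀ n, 0 < (ω' n).1)
    {s : ℝ} {N : ℕ} (hN : s < arrival ω N) {p : ℝ × ℝ} :
    p ∈ rings (splice s ω ω') ↔
      (p.1 ≤ s ∧ p ∈ rings ω) ∨ (s < p.1 ∧ (p.1 - s, p.2) ∈ rings ω') := by
  induction N generalizing s ω p with
  | zero =>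
    rw [arrival_zero] at hN
    have h1 : ¬ (p.1 ≤ s ∧ p ∈ rings ω) := fun h1 =>
      absurd (hN.trans_le (first_le_of_mem_rings h h1.2)) (not_lt.2 h1.1)
    have h2 : (p.1 - s, p.2) ∈ rings ω' → s < p.1 := fun h2 => by
      have := rings_pos h' h2; simp only at this; linarith
    rw [splice_of_lt hN, mem_rings_iff]
    simp only [h1, false_or]
    rw [and_iff_right_of_imp h2, mem_rings_iff (ω := ω')]
    refine or_congr ?_ ?_
    · simp only [consClock, Prod.ext_iff]
      exact and_congr_left fun _ => ⟨fun _ => by linarith, fun _ => by linarith⟩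
    · change (p.1 - (s + (ω' 0).1), p.2) ∈ rings (tailClock ω') ↔ _
      rw [sub_add_eq_sub_sub]
  | succ N ih =>
    rcases lt_or_ge s (ω 0).1 with hlt | hle
    · have h1 : ¬ (p.1 ≤ s ∧ p ∈ rings ω) := fun h1 =>
        absurd (hlt.trans_le (first_le_of_mem_rings h h1.2)) (not_lt.2 h1.1)
      have h2 : (p.1 - s, p.2) ∈ rings ω' → s < p.1 := fun h2 => by
        have := rings_pos h' h2; simp only at this; linarith
      rw [splice_of_lt hlt, mem_rings_iff]
      simp only [h1, false_or]
      rw [and_iff_right_of_imp h2, mem_rings_iff (ω := ω')]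
      refine or_congr ?_ ?_
      · simp only [consClock, Prod.ext_iff]
        exact and_congr_left fun _ => ⟨fun _ => by linarith, fun _ => by linarith⟩
      · change (p.1 - (s + (ω' 0).1), p.2) ∈ rings (tailClock ω') ↔ _
        rw [sub_add_eq_sub_sub]
    · rw [arrival_succ] at hN
      rw [splice_of_le hle, mem_rings_iff, mem_rings_iff (ω := ω)]
      change p = ω 0 ∨ (p.1 - (ω 0).1, p.2) ∈ rings (splice (s - (ω 0).1) (tailClock ω) ω') ↔ _
      rw [ih (ω := tailClock ω) (fun n => h (n + 1)) (by linarith)]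
      simp only [sub_le_sub_iff_right, sub_lt_sub_iff_right, sub_sub_sub_cancel_right]
      constructor
      · rintro (rfl | h1 | h1)
        · exact Or.inl ⟨hle, Or.inl rfl⟩
        · exact Or.inl ⟨h1.1, Or.inr h1.2⟩
        · exact Or.inr h1
      · rintro (⟨h1, h2 | h2⟩ | h1)
        · exact Or.inl h2
        · exact Or.inr (Or.inl ⟨h1, h2⟩)
        · exact Or.inr (Or.inr h1)

/-! ### Measurability of splicing -/

lemma measurable_consClock : Measurable fun p : (ℝ × ℝ) × Clock => consClock p.1 p.2 := by
  refine measurable_pi_lambda _ fun n => ?_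
  cases n with
  | zero => exact measurable_fst
  | succ n => exact (measurable_pi_apply n).comp measurable_snd

lemma measurable_splice_aux (n : ℕ) :
    Measurable fun p : ℝ × Clock × Clock => splice p.1 p.2.1 p.2.2 n := by
  classical
  have h1 : MeasurableSet {p : ℝ × Clock × Clock | p.1 < (p.2.1 0).1} :=
    measurableSet_lt (by fun_prop) (by fun_prop)
  induction n with
  | zero =>
    simp only [splice]
    exact Measurable.ite h1 (by fun_prop) (by fun_prop)
  | succ n ih =>
    simp only [splice]
    refine Measurable.ite h1 (by fun_prop) ?_
    exact ih.comp (f := fun p : ℝ × Clock × Clock =>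
      (p.1 - (p.2.1 0).1, (fun n => p.2.1 (n + 1)), p.2.2)) (by fun_prop)

lemma measurable_splice (s : ℝ) : Measurable fun p : Clock × Clock => splice s p.1 p.2 :=
  measurable_pi_lambda _ fun n => (measurable_splice_aux n).comp
    (f := fun p : Clock × Clock => (s, p.1, p.2)) (by fun_prop)

lemma measurable_arrival (n : ℕ) : Measurable fun ω : Clock => arrival ω n := by
  unfold arrival; fun_prop

/-! ### The law of the clocks -/

instance (l : Set.Ioi (0 : ℝ)) : IsProbabilityMeasure (expMeasure (l : ℝ)) :=
  isProbabilityMeasure_expMeasure l.2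

/-- The uniform distribution on `[0, 1]`. -/
noncomputable def markLaw : Measure ℝ := volume.restrict (Set.Icc 0 1)

instance : IsProbabilityMeasure markLaw := ⟨by simp [markLaw]⟩

/-- The law of a waiting time and a mark. -/
noncomputable def ringLaw (l : Set.Ioi (0 : ℝ)) : Measure (ℝ × ℝ) :=
  (expMeasure (l : ℝ)).prod markLaw

instance (l : Set.Ioi (0 : ℝ)) : IsProbabilityMeasure (ringLaw l) := by
  unfold ringLaw; infer_instance

/-- The law of a clock of rate `l`. -/
noncomputable def clockLaw (l : Set.Ioi (0 : ℝ)) : Measure Clock :=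
  Measure.infinitePi fun _ => ringLaw l

instance (l : Set.Ioi (0 : ℝ)) : IsProbabilityMeasure (clockLaw l) := by
  unfold clockLaw; infer_instance

/-- The law of independent clocks. -/
noncomputable def clocksLaw {K : Type} (lam : K → Set.Ioi (0 : ℝ)) : Measure (K → Clock) :=
  Measure.infinitePi fun k => clockLaw (lam k)

instance {K : Type} (lam : K → Set.Ioi (0 : ℝ)) : IsProbabilityMeasure (clocksLaw lam) := by
  unfold clocksLaw; infer_instance

lemma expMeasure_Iic (l : Set.Ioi (0 : ℝ)) {x : ℝ} (hx : 0 ≤ x) :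
    expMeasure (l : ℝ) (Set.Iic x) = ENNReal.ofReal (1 - Real.exp (-(l * x))) := by
  have := cdf_expMeasure_eq l.2 x
  rw [if_pos hx, cdf_eq_real, measureReal_def] at this
  rw [← this, ENNReal.ofReal_toReal (measure_ne_top _ _)]

lemma expMeasure_Iic_of_neg (l : Set.Ioi (0 : ℝ)) {x : ℝ} (hx : x ≤ 0) :
    expMeasure (l : ℝ) (Set.Iic x) = 0 := by
  refine measure_mono_null (Set.Iic_subset_Iic.2 hx) ?_
  rw [expMeasure_Iic l le_rfl]; simp

lemma expMeasure_Ioi (l : Set.Ioi (0 : ℝ)) {x : ℝ} (hx : 0 ≤ x) :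
    expMeasure (l : ℝ) (Set.Ioi x) = ENNReal.ofReal (Real.exp (-(l * x))) := by
  have h : (Set.Ioi x : Set ℝ) = (Set.Iic x)ᶜ := Set.compl_Iic.symm
  have h2 : Real.exp (-(l * x)) ≤ 1 := by
    rw [Real.exp_le_one_iff, neg_nonpos]; exact mul_nonneg (le_of_lt l.2) hx
  simp only [h]
  rw [prob_compl_eq_one_sub measurableSet_Iic, expMeasure_Iic l hx,
    ← ENNReal.ofReal_one, ← ENNReal.ofReal_sub _ (by linarith), sub_sub_cancel]

/-- An exponential waiting time has no memory. -/
lemma expMeasure_memoryless (l : Set.Ioi (0 : ℝ)) {s : ℝ} (hs : 0 ≤ s) :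
    (expMeasure (l : ℝ)).restrict (Set.Ioi s) =
      expMeasure (l : ℝ) (Set.Ioi s) • (expMeasure (l : ℝ)).map (fun x => s + x) := by
  refine Measure.ext_of_Iic _ _ fun a => ?_
  have hpre : (fun x => s + x) ⁻¹' Set.Iic a = Set.Iic (a - s) := by
    ext x; simp [le_sub_iff_add_le']
  rw [Measure.restrict_apply measurableSet_Iic, Measure.smul_apply, smul_eq_mul,
    Measure.map_apply (by fun_prop) measurableSet_Iic, hpre]
  rcases le_total a s with h | h
  · rw [expMeasure_Iic_of_neg l (by linarith), mul_zero]
    have : Set.Iic a ∩ Set.Ioi s = ∅ := by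
      ext x; simp only [Set.mem_inter_iff, Set.mem_Iic, Set.mem_Ioi, Set.mem_empty_iff_false,
        iff_false, not_and, not_lt]; intro hx; exact hx.trans h
    rw [this, measure_empty]
  · have : Set.Iic a ∩ Set.Ioi s = Set.Iic a \ Set.Iic s := by
      ext x; simp [and_comm]
    rw [this, measure_sdiff (Set.Iic_subset_Iic.2 h) nullMeasurableSet_Iic (measure_ne_top _ _),
      expMeasure_Iic l (hs.trans h), expMeasure_Iic l hs, expMeasure_Ioi l hs,
      expMeasure_Iic l (by linarith), ← ENNReal.ofReal_mul (Real.exp_pos _).le,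
      ← ENNReal.ofReal_sub]
    · congr 1
      rw [mul_sub, ← Real.exp_add]; ring_nf
    · rw [sub_nonneg, Real.exp_le_one_iff, neg_nonpos]; exact mul_nonneg (le_of_lt l.2) hs

instance (l : Set.Ioi (0 : ℝ)) : NullSingletonClass (expMeasure (l : ℝ)) := by
  have h : expMeasure (l : ℝ) ≪ volume := withDensity_absolutelyContinuous _ _
  exact ⟨fun x => h (measure_singleton x)⟩

/-- The mark is independent of the waiting time, so it does not disturb the lack of memory. -/
lemma ringLaw_memoryless (l : Set.Ioi (0 : ℝ)) {s : ℝ} (hs : 0 ≤ s) {B : Set (ℝ × ℝ)}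
    (hB : MeasurableSet B) :
    ringLaw l ({p | s < p.1} ∩ B) =
      ringLaw l {p | s < p.1} * ringLaw l ((fun p => (s + p.1, p.2)) ⁻¹' B) := by
  have h1 : MeasurableSet {p : ℝ × ℝ | s < p.1} := measurableSet_lt (by fun_prop) (by fun_prop)
  have h2 : {p : ℝ × ℝ | s < p.1} = Set.Ioi s ×ˢ Set.univ := by ext p; simp
  have h3 : (ringLaw l).restrict {p | s < p.1} =
      expMeasure (l : ℝ) (Set.Ioi s) • (ringLaw l).map (fun p => (s + p.1, p.2)) := by
    have h4 := Measure.map_prod_map (expMeasure (l : ℝ)) markLaw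
      (f := fun x => s + x) (g := id) (by fun_prop) measurable_id
    rw [Measure.map_id] at h4
    have h5 : Prod.map (fun x => s + x) id = fun p : ℝ × ℝ => (s + p.1, p.2) := rfl
    rw [h5] at h4
    rw [ringLaw, ← h4, ← Measure.prod_smul_left, ← expMeasure_memoryless l hs, h2,
      ← Measure.prod_restrict, Measure.restrict_univ]
  have h6 : ringLaw l {p | s < p.1} = expMeasure (l : ℝ) (Set.Ioi s) := by
    rw [h2, ringLaw, Measure.prod_prod, measure_univ, mul_one]
  rw [Set.inter_comm, ← Measure.restrict_apply hB, h3, h6, Measure.smul_apply, smul_eq_mul,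
    Measure.map_apply (by fun_prop) hB]

/-- A measure on sequences is a product measure if it is one on initial boxes. -/
lemma eq_infinitePi_of_range {X : Type*} [MeasurableSpace X] {ρ : Measure X}
    [IsProbabilityMeasure ρ] {ν : Measure (ℕ → X)}
    (h : ∀ (N : ℕ) (t : ℕ → Set X), (∀ i, MeasurableSet (t i)) →
      ν {ω | ∀ i < N, ω i ∈ t i} = ∏ i ∈ Finset.range N, ρ (t i)) :
    ν = Measure.infinitePi fun _ => ρ := by
  classical
  refine Measure.eq_infinitePi _ fun s t ht => ?_
  obtain ⟨N, hN⟩ := s.exists_nat_subset_range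
  have h1 := h N (fun i => if i ∈ s then t i else Set.univ)
    (fun i => by split_ifs; exacts [ht i, MeasurableSet.univ])
  have h2 : {ω : ℕ → X | ∀ i < N, ω i ∈ (if i ∈ s then t i else Set.univ)} =
      Set.pi (s : Set ℕ) t := by
    ext ω
    simp only [Set.mem_ofPred_eq, Set.mem_pi, Finset.mem_coe]
    constructor
    · intro h i hi; have := h i (Finset.mem_range.1 (hN hi)); rwa [if_pos hi] at this
    · intro h i _; split_ifs with hi; exacts [h i hi, trivial]
  rw [h2] at h1
  rw [h1]
  have h3 : ∀ i, ρ (if i ∈ s then t i else Set.univ) = if i ∈ s then ρ (t i) else 1 := fun i => by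
    split_ifs <;> simp
  simp only [h3]
  rw [Finset.prod_ite, Finset.prod_const_one, mul_one]
  congr 1
  ext i; simp only [Finset.mem_filter, and_iff_right_iff_imp]; exact fun hi => hN hi

lemma infinitePi_range {X : Type*} [MeasurableSpace X] {ρ : Measure X}
    [IsProbabilityMeasure ρ] (N : ℕ) {t : ℕ → Set X} (ht : ∀ i, MeasurableSet (t i)) :
    (Measure.infinitePi fun _ : ℕ => ρ) {ω | ∀ i < N, ω i ∈ t i} =
      ∏ i ∈ Finset.range N, ρ (t i) := by
  rw [← Measure.infinitePi_pi (fun _ : ℕ => ρ) (fun i _ => ht i)]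
  congr 1
  ext ω; simp

lemma measurableSet_initial_box {X : Type*} [MeasurableSpace X] (N : ℕ) {t : ℕ → Set X}
    (ht : ∀ i, MeasurableSet (t i)) : MeasurableSet {ω : ℕ → X | ∀ i < N, ω i ∈ t i} := by
  have : {ω : ℕ → X | ∀ i < N, ω i ∈ t i} = ⋂ i, ⋂ (_ : i < N), (fun ω => ω i) ⁻¹' t i := by
    ext; simp
  rw [this]
  exact MeasurableSet.iInter fun i => MeasurableSet.iInter fun _ => measurable_pi_apply i (ht i)

/-- The first ring is independent of the clock after it. -/
lemma map_consClock (l : Set.Ioi (0 : ℝ)) :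
    ((ringLaw l).prod (clockLaw l)).map (fun p => consClock p.1 p.2) = clockLaw l := by
  refine eq_infinitePi_of_range fun N t ht => ?_
  rw [Measure.map_apply measurable_consClock (measurableSet_initial_box N ht)]
  cases N with
  | zero => simp
  | succ N =>
    have : (fun p : (ℝ × ℝ) × Clock => consClock p.1 p.2) ⁻¹' {ω | ∀ i < N + 1, ω i ∈ t i} =
        t 0 ×ˢ {ω | ∀ i < N, ω i ∈ t (i + 1)} := by
      ext p
      simp only [Set.mem_preimage, Set.mem_ofPred_eq, Set.mem_prod]
      constructor
      · exact fun h => ⟨h 0 (Nat.succ_pos _), fun i hi => h (i + 1) (Nat.succ_lt_succ hi)⟩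
      · rintro ⟨h0, h1⟩ (_ | i) hi
        exacts [h0, h1 i (Nat.lt_of_succ_lt_succ hi)]
    rw [this, Measure.prod_prod, clockLaw, infinitePi_range N (fun i => ht (i + 1)),
      Finset.prod_range_succ', mul_comm]

lemma lintegral_clockLaw (l : Set.Ioi (0 : ℝ)) {f : Clock → ℝ≥0∞} (hf : Measurable f) :
    ∫⁻ ω, f ω ∂(clockLaw l) = ∫⁻ x, ∫⁻ ω, f (consClock x ω) ∂(clockLaw l) ∂(ringLaw l) := by
  conv_lhs => rw [← map_consClock, lintegral_map hf measurable_consClock]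
  exact lintegral_prod _ (hf.comp measurable_consClock).aemeasurable

/-- Conditioning on the first ring of the first clock: after `s`, the box is one for the second
clock with its first waiting time delayed by `s`; before `s`, the ring is kept and the induction
hypothesis applies at the smaller time. For this reason `s` and `t` vary in the induction. -/
lemma splice_box (l : Set.Ioi (0 : ℝ)) (N : ℕ) {s : ℝ} (hs : 0 ≤ s) {t : ℕ → Set (ℝ × ℝ)}
    (ht : ∀ i, MeasurableSet (t i)) :
    ((clockLaw l).prod (clockLaw l)) {p | ∀ i < N, splice s p.1 p.2 i ∈ t i} =
      ∏ i ∈ Finset.range N, ringLaw l (t i) := by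
  induction N generalizing s t with
  | zero => simp
  | succ N ih =>
    have hmS : MeasurableSet {p : Clock × Clock | ∀ i < N + 1, splice s p.1 p.2 i ∈ t i} :=
      measurable_splice s (measurableSet_initial_box (N + 1) ht)
    rw [Measure.prod_apply hmS, lintegral_clockLaw l (measurable_measure_prodMk_left hmS)]
    have key : ∀ x : ℝ × ℝ, (∫⁻ ω, clockLaw l (Prod.mk (consClock x ω) ⁻¹'
        {p : Clock × Clock | ∀ i < N + 1, splice s p.1 p.2 i ∈ t i}) ∂(clockLaw l)) =
        ({p : ℝ × ℝ | s < p.1}.indicator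
          (fun _ => ringLaw l ((fun p => (s + p.1, p.2)) ⁻¹' t 0)) x +
          ({p : ℝ × ℝ | p.1 ≤ s} ∩ t 0).indicator 1 x) *
          ∏ i ∈ Finset.range N, ringLaw l (t (i + 1)) := by
      intro x
      rcases lt_or_ge s x.1 with h | h
      · have h1 : ∀ ω, Prod.mk (consClock x ω) ⁻¹'
            {p : Clock × Clock | ∀ i < N + 1, splice s p.1 p.2 i ∈ t i} =
            {ω' | ∀ i < N + 1, ω' i ∈
              (fun i => Nat.casesOn i ((fun p : ℝ × ℝ => (s + p.1, p.2)) ⁻¹' t 0)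
                (fun i => t (i + 1)) : ℕ → Set (ℝ × ℝ)) i} := by
          intro ω
          ext ω'
          simp only [Set.mem_preimage, Set.mem_ofPred_eq]
          rw [splice_of_lt (ω := consClock x ω) h]
          refine forall_congr' fun i => forall_congr' fun _ => ?_
          cases i <;> rfl
        simp only [h1, lintegral_const, measure_univ, mul_one]
        rw [clockLaw, infinitePi_range, Finset.prod_range_succ', mul_comm]
        · have h2 : x ∉ {p : ℝ × ℝ | p.1 ≤ s} ∩ t 0 := fun h' => absurd h'.1 (not_le.2 h)
          rw [Set.indicator_of_mem (s := {p : ℝ × ℝ | s < p.1}) h,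
            Set.indicator_of_notMem h2, add_zero]
          rfl
        · intro i
          cases i with
          | zero => exact (by fun_prop : Measurable fun p : ℝ × ℝ => (s + p.1, p.2)) (ht 0)
          | succ i => exact ht (i + 1)
      · have h2 : x ∉ {p : ℝ × ℝ | s < p.1} := not_lt.2 h
        have hm' : MeasurableSet
            {p : Clock × Clock | ∀ i < N, splice (s - x.1) p.1 p.2 i ∈ t (i + 1)} :=
          measurable_splice (s - x.1) (measurableSet_initial_box N fun i => ht (i + 1))
        have h1 : ∀ ω, Prod.mk (consClock x ω) ⁻¹'
            {p : Clock × Clock | ∀ i < N + 1, splice s p.1 p.2 i ∈ t i} =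
            {_ω' | x ∈ t 0} ∩ Prod.mk ω ⁻¹'
              {p : Clock × Clock | ∀ i < N, splice (s - x.1) p.1 p.2 i ∈ t (i + 1)} := by
          intro ω
          ext ω'
          simp only [Set.mem_preimage, Set.mem_ofPred_eq, Set.mem_inter_iff]
          rw [splice_of_le (ω := consClock x ω) h]
          constructor
          · exact fun h => ⟨h 0 (Nat.succ_pos _), fun i hi => h (i + 1) (Nat.succ_lt_succ hi)⟩
          · rintro ⟨h0, h1⟩ (_ | i) hi
            exacts [h0, h1 i (Nat.lt_of_succ_lt_succ hi)]
        simp only [h1]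
        rw [Set.indicator_of_notMem h2, zero_add]
        by_cases hx : x ∈ t 0
        · have h3 : x ∈ {p : ℝ × ℝ | p.1 ≤ s} ∩ t 0 := ⟨h, hx⟩
          rw [Set.indicator_of_mem h3, Pi.one_apply, one_mul]
          have h4 : {_ω' : Clock | x ∈ t 0} = Set.univ := Set.eq_univ_of_forall fun _ => hx
          simp only [h4, Set.univ_inter]
          rw [← Measure.prod_apply hm', ih (sub_nonneg.2 h) (fun i => ht (i + 1))]
        · have h3 : x ∉ {p : ℝ × ℝ | p.1 ≤ s} ∩ t 0 := fun h' => hx h'.2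
          rw [Set.indicator_of_notMem h3, zero_mul]
          simp [hx]
    simp only [key]
    have hms : MeasurableSet {p : ℝ × ℝ | s < p.1} := measurableSet_lt (by fun_prop) (by fun_prop)
    have hms' : MeasurableSet {p : ℝ × ℝ | p.1 ≤ s} := measurableSet_le (by fun_prop) (by fun_prop)
    -- Lack of memory turns the late contribution into the mass of the part of `t 0` after `s`,
    -- which complements the early contribution to the full mass of `t 0`.
    rw [lintegral_mul_const _ (by
        exact (measurable_const.indicator hms).add (measurable_one.indicator (hms'.inter (ht 0)))),
      lintegral_add_left (measurable_const.indicator hms), lintegral_indicator_const hms,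
      lintegral_indicator_one (hms'.inter (ht 0)), mul_comm (ringLaw l _) (ringLaw l {p | s < p.1}),
      ← ringLaw_memoryless l hs (ht 0), Finset.prod_range_succ', mul_comm]
    congr 1
    rw [← measure_union _ (hms'.inter (ht 0))]
    · congr 1
      ext p
      simp only [Set.mem_union, Set.mem_inter_iff, Set.mem_ofPred_eq, ← or_and_right]
      simp [lt_or_ge s p.1]
    · refine Set.disjoint_left.2 fun p hp hp' => absurd (show s < p.1 from hp.1) (not_lt.2 hp'.1)

/-- Splicing two independent clocks produces a clock with the same law. -/
theorem map_splice (l : Set.Ioi (0 : ℝ)) {s : ℝ} (hs : 0 ≤ s) :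
    ((clockLaw l).prod (clockLaw l)).map (fun p => splice s p.1 p.2) = clockLaw l := by
  refine eq_infinitePi_of_range fun N t ht => ?_
  rw [Measure.map_apply (measurable_splice s) (measurableSet_initial_box N ht)]
  exact splice_box l N hs ht

section clocks

variable {K : Type} (lam : K → Set.Ioi (0 : ℝ))

/-- Splicing of all clocks. -/
noncomputable def spliceAll (s : ℝ) (ω ω' : K → Clock) : K → Clock :=
  fun k => splice s (ω k) (ω' k)

lemma measurable_spliceAll (s : ℝ) :
    Measurable fun p : (K → Clock) × (K → Clock) => spliceAll s p.1 p.2 :=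
  measurable_pi_lambda _ fun k => (measurable_splice s).comp
    (f := fun p : (K → Clock) × (K → Clock) => (p.1 k, p.2 k)) (by fun_prop)

/-- On a box that constrains finitely many clocks, the pair of families can be rearranged into a
family of independent pairs, to each of which `map_splice` applies. -/
theorem map_spliceAll {s : ℝ} (hs : 0 ≤ s) :
    ((clocksLaw lam).prod (clocksLaw lam)).map (fun p => spliceAll s p.1 p.2) = clocksLaw lam := by
  classical
  refine Measure.eq_infinitePi _ fun I t ht => ?_
  have hbox : MeasurableSet (Set.pi (I : Set K) t) :=
    MeasurableSet.pi I.countable_toSet fun i _ => ht i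
  rw [Measure.map_apply (measurable_spliceAll s) hbox]
  set Q : Set ((I → Clock) × (I → Clock)) :=
    {p | ∀ k : I, splice s (p.1 k) (p.2 k) ∈ t k} with hQ
  have hQm : MeasurableSet Q := by
    have : Q = ⋂ k : I, (fun p : (I → Clock) × (I → Clock) => splice s (p.1 k) (p.2 k)) ⁻¹' t k := by
      ext; simp [hQ]
    rw [this]
    exact MeasurableSet.iInter fun k => ((measurable_splice s).comp
      (f := fun p : (I → Clock) × (I → Clock) => (p.1 k, p.2 k)) (by fun_prop)) (ht k)
  have h1 : (fun p : (K → Clock) × (K → Clock) => spliceAll s p.1 p.2) ⁻¹' Set.pi (I : Set K) t =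
      Prod.map I.restrict I.restrict ⁻¹' Q := by
    ext p
    simp [hQ, spliceAll]
  rw [h1, ← Measure.map_apply (by fun_prop) hQm,
    ← Measure.map_prod_map _ _ (Finset.measurable_restrict _) (Finset.measurable_restrict _),
    clocksLaw, Measure.infinitePi_map_restrict]
  rw [← (measurePreserving_arrowProdEquivProdArrow Clock Clock I
    (fun k => clockLaw (lam k)) (fun k => clockLaw (lam k))).map_eq,
    Measure.map_apply (MeasurableEquiv.measurable _) hQm]
  have h2 : (MeasurableEquiv.arrowProdEquivProdArrow Clock Clock I) ⁻¹' Q =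
      Set.pi Set.univ fun k : I => (fun p : Clock × Clock => splice s p.1 p.2) ⁻¹' t k := by
    ext p
    simp [hQ, MeasurableEquiv.arrowProdEquivProdArrow, Equiv.arrowProdEquivProdArrow]
  rw [h2, Measure.pi_pi]
  simp only [← Measure.map_apply (measurable_splice s) (ht _), map_splice _ hs]
  exact Finset.prod_coe_sort I fun k => clockLaw (lam k) (t k)

end clocks

end TaggedExclusion

/-! ### Almost every family of clocks is good. -/

namespace TaggedExclusion

open scoped ENNReal

/-! ### Almost sure properties of the clocks -/

/-- Disjoint boxes of probability bounded below occur infinitely often. -/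
lemma ae_frequently_box {ι : Type*} {X : ι → Type*} [∀ i, MeasurableSpace (X i)]
    (P : ∀ i, Measure (X i)) [∀ i, IsProbabilityMeasure (P i)] (b : ℕ → Finset ι)
    (hb : Pairwise fun m n => Disjoint (b m) (b n)) {t : ∀ i, Set (X i)}
    (ht : ∀ i, MeasurableSet (t i)) {δ : ℝ≥0∞} (hδ : δ ≠ 0)
    (hle : ∀ m, δ ≤ ∏ i ∈ b m, P i (t i)) :
    ∀ᵐ ω ∂(Measure.infinitePi P), ∃ᶠ m in atTop, ∀ i ∈ b m, ω i ∈ t i := by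
  classical
  set s : ℕ → Set (∀ i, X i) := fun m => Set.pi (b m : Set ι) t with hs
  have hsm : ∀ m, MeasurableSet (s m) := fun m =>
    MeasurableSet.pi (b m).countable_toSet fun i _ => ht i
  have hPs : ∀ m, Measure.infinitePi P (s m) = ∏ i ∈ b m, P i (t i) := fun m =>
    Measure.infinitePi_pi P fun i _ => ht i
  have hind : iIndepSet s (Measure.infinitePi P) := by
    rw [iIndepSet_iff_meas_biInter hsm]
    intro S
    have h1 : ⋂ m ∈ S, s m = Set.pi ((S.biUnion b : Finset ι) : Set ι) t := by
      ext ω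
      simp only [hs, Set.mem_iInter, Set.mem_pi, Finset.mem_coe, Finset.mem_biUnion]
      exact ⟨fun h i ⟨m, hm, hi⟩ => h m hm i hi, fun h m hm i hi => h i ⟨m, hm, hi⟩⟩
    rw [h1, Measure.infinitePi_pi P fun i _ => ht i,
      Finset.prod_biUnion fun m _ n _ hmn => hb hmn]
    exact Finset.prod_congr rfl fun m _ => (hPs m).symm
  have hsum : ∑' m, Measure.infinitePi P (s m) = ∞ := by
    rw [← top_le_iff, ← ENNReal.tsum_const_eq_top_of_ne_zero (α := ℕ) hδ]
    exact ENNReal.tsum_le_tsum fun m => (hPs m) ▸ hle m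
  -- The second Borel–Cantelli lemma: the boxes are independent because they involve disjoint sets
  -- of coordinates.
  have h1 := measure_limsup_eq_one hsm hind hsum
  rw [← mem_ae_iff_prob_eq_one (MeasurableSet.measurableSet_limsup hsm)] at h1
  filter_upwards [h1] with ω hω
  rw [mem_limsup_iff_frequently_mem] at hω
  exact hω

lemma arrival_unbounded {ω : Clock} (h : ∀ n, 0 < (ω n).1) (h' : ∃ᶠ n in atTop, 1 < (ω n).1)
    (T : ℝ) : ∃ N, T < arrival ω N := by
  by_contra! hT
  have h1 : Summable fun n => (ω n).1 := by
    refine summable_of_sum_range_le (c := T) (fun n => (h n).le) fun n => ?_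
    cases n with
    | zero => simpa using (h 0).le.trans (arrival_zero ω ▸ hT 0)
    | succ n => exact hT n
  have h2 := h1.tendsto_atTop_zero.eventually (gt_mem_nhds (zero_lt_one' ℝ))
  obtain ⟨n, hn, hn'⟩ := (h'.and_eventually h2).exists
  exact lt_asymm hn hn'

lemma ringLaw_fst_eq (l : Set.Ioi (0 : ℝ)) (x : ℝ) : ringLaw l {p | p.1 = x} = 0 := by
  have : {p : ℝ × ℝ | p.1 = x} = {x} ×ˢ Set.univ := by ext p; simp
  rw [this, ringLaw, Measure.prod_prod, measure_singleton, zero_mul]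

lemma ringLaw_fst (l : Set.Ioi (0 : ℝ)) {S : Set ℝ} :
    ringLaw l {p | p.1 ∈ S} = expMeasure (l : ℝ) S := by
  have : {p : ℝ × ℝ | p.1 ∈ S} = S ×ˢ Set.univ := by ext p; simp
  rw [this, ringLaw, Measure.prod_prod, measure_univ, mul_one]

/-- Given all other waiting times, a single value of the first one is compatible with the prescribed
arrival, and the exponential law has no atoms. -/
lemma clockLaw_arrival_eq (l : Set.Ioi (0 : ℝ)) (n : ℕ) (x : ℝ) :
    clockLaw l {ω | arrival ω n = x} = 0 := by
  have hm : MeasurableSet {ω : Clock | arrival ω n = x} :=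
    measurable_arrival n (measurableSet_singleton x)
  rw [← map_consClock, Measure.map_apply measurable_consClock hm,
    Measure.prod_apply_symm (measurable_consClock hm)]
  refine (lintegral_congr fun ω => ?_).trans lintegral_zero
  cases n with
  | zero =>
    convert ringLaw_fst_eq l x using 2
    ext p
    simp [arrival_zero, consClock]
  | succ n =>
    convert ringLaw_fst_eq l (x - arrival ω n) using 2
    ext p
    simp only [Set.mem_preimage, Set.mem_ofPred_eq, arrival_succ]
    change p.1 + arrival ω n = x ↔ _
    exact eq_sub_iff_add_eq.symm

section

variable {K : Type} (lam : K → Set.Ioi (0 : ℝ))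

lemma measurePreserving_clock (k : K) :
    MeasurePreserving (fun ω : K → Clock => ω k) (clocksLaw lam) (clockLaw (lam k)) :=
  measurePreserving_eval_infinitePi _ k

lemma measurePreserving_ring (k : K) (n : ℕ) :
    MeasurePreserving (fun ω : K → Clock => ω k n) (clocksLaw lam) (ringLaw (lam k)) :=
  (measurePreserving_eval_infinitePi (fun _ : ℕ => ringLaw (lam k)) n).comp
    (measurePreserving_clock lam k)

lemma ae_pos [Countable K] : ∀ᵐ ω ∂(clocksLaw lam), ∀ k n, 0 < (ω k n).1 := by
  refine ae_all_iff.2 fun k => ae_all_iff.2 fun n => ?_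
  refine (measurePreserving_ring lam k n).quasiMeasurePreserving.ae (p := fun x => 0 < x.1) ?_
  rw [ae_iff]
  have : {a : ℝ × ℝ | ¬ 0 < a.1} = {p | p.1 ∈ Set.Iic 0} := by ext; simp
  rw [this, ringLaw_fst, expMeasure_Iic_of_neg _ le_rfl]

lemma ae_unbounded [Countable K] :
    ∀ᵐ ω ∂(clocksLaw lam), ∀ k (T : ℝ), ∃ N, T < arrival (ω k) N := by
  have h1 : ∀ᵐ ω ∂(clocksLaw lam), ∀ k, ∃ᶠ n in atTop, 1 < (ω k n).1 := by
    refine ae_all_iff.2 fun k => ?_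
    refine (measurePreserving_clock lam k).quasiMeasurePreserving.ae
      (p := fun ω => ∃ᶠ n in atTop, 1 < (ω n).1) ?_
    have := ae_frequently_box (fun _ : ℕ => ringLaw (lam k)) (fun n => {n})
      (fun m n h => Finset.disjoint_singleton.2 h) (t := fun _ => {p | p.1 ∈ Set.Ioi 1})
      (fun _ => measurable_fst measurableSet_Ioi)
      (δ := ENNReal.ofReal (Real.exp (-(lam k * 1)))) (by simp [Real.exp_pos]) (fun m => by
        rw [Finset.prod_singleton, ringLaw_fst, expMeasure_Ioi _ zero_le_one])
    filter_upwards [this] with ω hω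
    simpa using hω
  filter_upwards [h1, ae_pos lam] with ω h h' k T
  exact arrival_unbounded (h' k) (h k) T

lemma ae_arrival_ne [Countable K] :
    ∀ᵐ ω ∂(clocksLaw lam), ∀ k k', k ≠ k' → ∀ n n', arrival (ω k) n ≠ arrival (ω k') n' := by
  refine ae_all_iff.2 fun k => ae_all_iff.2 fun k' => ?_
  by_cases hk : k = k'
  · exact Eventually.of_forall fun ω h => absurd hk h
  have hmp : MeasurePreserving (fun ω : K → Clock => (ω k, ω k')) (clocksLaw lam)
      ((clockLaw (lam k)).prod (clockLaw (lam k'))) :=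
    ⟨by fun_prop, Measure.infinitePi_map_eval_prod hk⟩
  have : ∀ᵐ p ∂((clockLaw (lam k)).prod (clockLaw (lam k'))), ∀ n n',
      arrival p.1 n ≠ arrival p.2 n' := by
    refine ae_all_iff.2 fun n => ae_all_iff.2 fun n' => ?_
    rw [ae_iff]
    simp only [ne_eq, not_not]
    have hm : MeasurableSet {p : Clock × Clock | arrival p.1 n = arrival p.2 n'} :=
      measurableSet_eq_fun ((measurable_arrival n).comp measurable_fst)
        ((measurable_arrival n').comp measurable_snd)
    rw [Measure.prod_apply_symm hm]
    exact (lintegral_congr fun ω => clockLaw_arrival_eq (lam k) n (arrival ω n')).trans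
      lintegral_zero
  filter_upwards [hmp.quasiMeasurePreserving.ae this] with ω hω _
  exact hω

end

variable {A : Type}

/-- The first Borel–Cantelli lemma: the clock of `y` rings before `T` with probability at most `lam
y * T`, which is summable. -/
lemma ae_finite_tags (lam : Kind A → Set.Ioi (0 : ℝ))
    (hs : Summable fun y : ℤ => (lam (Sum.inr y) : ℝ)) :
    ∀ᵐ ω ∂(clocksLaw lam), ∀ T : ℕ, {y : ℤ | (ω (Sum.inr y) 0).1 ≤ (T : ℝ)}.Finite := by
  refine ae_all_iff.2 fun T => ?_
  refine ae_finite_setOfPred_mem (s := fun y : ℤ => {ω : Kind A → Clock | (ω (Sum.inr y) 0).1 ≤ T}) ?_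
  refine ne_top_of_le_ne_top (hs.mul_right (T : ℝ)).tsum_ofReal_ne_top
    (ENNReal.tsum_le_tsum fun y => ?_)
  have h1 : {ω : Kind A → Clock | (ω (Sum.inr y) 0).1 ≤ T} =
      (fun ω : Kind A → Clock => ω (Sum.inr y) 0) ⁻¹' {p | p.1 ∈ Set.Iic (T : ℝ)} := rfl
  rw [h1, (measurePreserving_ring lam (Sum.inr y) 0).measure_preimage
    (s := {p | p.1 ∈ Set.Iic (T : ℝ)}) (measurable_fst measurableSet_Iic).nullMeasurableSet, ringLaw_fst,
    expMeasure_Iic _ (Nat.cast_nonneg T)]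
  refine ENNReal.ofReal_le_ofReal ?_
  linarith [Real.add_one_le_exp (-((lam (Sum.inr y) : ℝ) * T))]

/-- The windows of `2 * w` labels around the multiples of `2 * w` are disjoint, and each is silent
until `T` with the same positive probability, a power of `exp (-(Λ * T))`. The values `ε = 1` and `ε
= -1` yield cuts arbitrarily far to the right and to the left. -/
lemma ae_quiet [Fintype A] (lam : Kind A → Set.Ioi (0 : ℝ)) {Λ : ℝ}
    (hΛ : ∀ p, (lam (Sum.inl p) : ℝ) = Λ) {w : ℤ} (hw : 0 < w) (ε : ℤ) (hε : ε ≠ 0) (T : ℕ) :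
    ∀ᵐ ω ∂(clocksLaw lam), ∃ᶠ m : ℕ in atTop, ∀ i e,
      ε * (2 * w * m) - w < i → i ≤ ε * (2 * w * m) + w → (T : ℝ) < (ω (Sum.inl (i, e)) 0).1 := by
  classical
  set b : ℕ → Finset (Kind A) := fun m =>
    ((Finset.Ioc (ε * (2 * w * m) - w) (ε * (2 * w * m) + w)) ×ˢ Finset.univ).map
      Function.Embedding.inl with hb
  have hmem : ∀ m i e, Sum.inl (i, e) ∈ b m ↔
      ε * (2 * w * m) - w < i ∧ i ≤ ε * (2 * w * m) + w := by
    intro m i e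
    simp [hb]
  have hdisj : Pairwise fun m n => Disjoint (b m) (b n) := by
    intro m n hmn
    rw [Finset.disjoint_left]
    rintro (⟨i, e⟩ | y) h1 h2
    · rw [hmem] at h1 h2
      have h3 : |ε * (2 * w * m) - ε * (2 * w * n)| < 2 * w := by rw [abs_lt]; omega
      rw [show ε * (2 * w * m) - ε * (2 * w * n) = ε * ((m : ℤ) - n) * (2 * w) by ring, abs_mul,
        abs_of_pos (show 0 < 2 * w by omega)] at h3
      have h4 : 1 ≤ |ε * ((m : ℤ) - n)| :=
        Int.one_le_abs (mul_ne_zero hε (sub_ne_zero.2 (by exact_mod_cast hmn)))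
      nlinarith
    · simp [hb] at h1
  have := ae_frequently_box (fun k => clockLaw (lam k)) b hdisj
    (t := fun _ => {ω | (ω 0).1 ∈ Set.Ioi (T : ℝ)})
    (fun _ => (measurable_fst.comp (measurable_pi_apply 0)) measurableSet_Ioi)
    (δ := ENNReal.ofReal (Real.exp (-(Λ * T))) ^ ((2 * w).toNat * Fintype.card A))
    (pow_ne_zero _ (by simp [Real.exp_pos])) (fun m => by
      refine le_of_eq ?_
      have h1 : ∀ k ∈ b m, clockLaw (lam k) {ω | (ω 0).1 ∈ Set.Ioi (T : ℝ)} =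
          ENNReal.ofReal (Real.exp (-(Λ * T))) := by
        rintro (p | y) hk
        · have h2 := (measurePreserving_eval_infinitePi
            (fun _ : ℕ => ringLaw (lam (Sum.inl p))) 0).measure_preimage
            (s := {p | p.1 ∈ Set.Ioi (T : ℝ)}) (measurable_fst measurableSet_Ioi).nullMeasurableSet
          rw [ringLaw_fst, expMeasure_Ioi _ (Nat.cast_nonneg T), hΛ p] at h2
          exact h2
        · simp [hb] at hk
      rw [Finset.prod_congr rfl h1, Finset.prod_const]
      congr 1
      simp only [hb, Finset.card_map, Finset.card_product, Int.card_Ioc, Finset.card_univ]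
      congr 2
      ring)
  filter_upwards [this] with ω hω
  exact hω.mono fun m hm i e h1 h2 => hm _ ((hmem m i e).2 ⟨h1, h2⟩)

/-- Almost surely the clocks are good, and their waiting times are positive and not summable. -/
theorem ae_goodClock [Fintype A] (lam : Kind A → Set.Ioi (0 : ℝ)) {Λ : ℝ}
    (hΛ : ∀ p, (lam (Sum.inl p) : ℝ) = Λ) (hs : Summable fun y : ℤ => (lam (Sum.inr y) : ℝ))
    {w : ℤ} (hw : 0 < w) :
    ∀ᵐ ω ∂(clocksLaw lam), GoodClock w (fun k => rings (ω k)) ∧ (∀ k n, 0 < (ω k n).1) ∧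
      ∀ k (T : ℝ), ∃ N, T < arrival (ω k) N := by
  filter_upwards [ae_pos lam, ae_unbounded lam, ae_arrival_ne lam, ae_finite_tags lam hs,
    ae_all_iff.2 (ae_quiet lam hΛ hw 1 one_ne_zero),
    ae_all_iff.2 (ae_quiet lam hΛ hw (-1) (by norm_num))] with ω h1 h2 h3 h4 h5 h6
  have hq : ∀ (T : ℝ) (ε : ℤ) (N : ℕ), (∀ T : ℕ, ∃ᶠ m : ℕ in atTop, ∀ i e,
      ε * (2 * w * m) - w < i → i ≤ ε * (2 * w * m) + w → (T : ℝ) < (ω (Sum.inl (i, e)) 0).1) →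
      ∃ m ≥ N, Quiet w (fun k => rings (ω k)) T (ε * (2 * w * m)) := by
    intro T ε N h
    obtain ⟨T', hT'⟩ := exists_nat_ge T
    obtain ⟨m, hm, hm'⟩ := frequently_atTop.1 (h T') N
    exact ⟨m, hm, fun i e h h' p hp =>
      hT'.trans_lt ((hm' i e h h').trans_le (first_le_of_mem_rings (h1 _) hp))⟩
  refine ⟨⟨?_, ?_, ?_, ?_, ?_, ?_⟩, h1, h2⟩
  · exact fun k p hp => rings_pos (h1 k) hp
  · rintro k k' _ ⟨n, rfl⟩ _ ⟨n', rfl⟩ h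
    have hk : k = k' := by by_contra hk; exact h3 k k' hk n n' h
    subst hk
    rw [(strictMono_arrival (h1 k)).injective h]
    exact ⟨rfl, rfl⟩
  · intro k T
    obtain ⟨N, hN⟩ := h2 k T
    refine ((Set.finite_Iio N).image fun n => (arrival (ω k) n, (ω k n).2)).subset ?_
    rintro _ ⟨⟨n, rfl⟩, hn⟩
    exact ⟨n, (strictMono_arrival (h1 k)).lt_iff_lt.1 (lt_of_le_of_lt hn hN), rfl⟩
  · intro T
    obtain ⟨T', hT'⟩ := exists_nat_ge T
    refine (h4 T').subset ?_
    rintro y ⟨p, hp, hpT⟩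
    exact (first_le_of_mem_rings (h1 _) hp).trans (hpT.trans hT')
  · intro T b
    obtain ⟨m, hm, hm'⟩ := hq T 1 b.toNat h5
    refine ⟨_, ?_, hm'⟩
    have : b ≤ m := by omega
    nlinarith
  · intro T b
    obtain ⟨m, hm, hm'⟩ := hq T (-1) (-b).toNat h6
    refine ⟨_, ?_, hm'⟩
    have : -b ≤ m := by omega
    nlinarith

end TaggedExclusion

/-! ### Graphical construction of the evolution driven by all clocks. -/

namespace TaggedExclusion

/-! ### The graphical construction -/

lemma measurable_of_cover {α β ι : Type*} [MeasurableSpace α] [MeasurableSpace β] [Countable ι]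
    {f : α → β} (C : ι → Set α) (hC : ∀ i, MeasurableSet (C i)) (hcov : ∀ x, ∃ i, x ∈ C i)
    (g : ι → α → β) (hg : ∀ i, Measurable (g i)) (h : ∀ i, ∀ x ∈ C i, f x = g i x) :
    Measurable f := by
  intro s hs
  have : f ⁻¹' s = ⋃ i, C i ∩ g i ⁻¹' s := by
    ext x
    simp only [Set.mem_preimage, Set.mem_iUnion, Set.mem_inter_iff]
    constructor
    · intro hx
      obtain ⟨i, hi⟩ := hcov x
      exact ⟨i, hi, h i x hi ▸ hx⟩
    · rintro ⟨i, hi, hx⟩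
      rwa [h i x hi]
  rw [this]
  exact MeasurableSet.iUnion fun i => (hC i).inter (hg i hs)

lemma measurable_of_eventually_eq {α β : Type*} [MeasurableSpace α] [MeasurableSpace β]
    {f : α → β} {g : ℕ → α → β} (hg : ∀ n, Measurable (g n))
    (h : ∀ x, ∀ᶠ n in atTop, g n x = f x) : Measurable f := by
  intro s hs
  have : f ⁻¹' s = ⋃ N, ⋂ n, ⋂ (_ : N ≤ n), g n ⁻¹' s := by
    ext x
    simp only [Set.mem_preimage, Set.mem_iUnion, Set.mem_iInter]
    obtain ⟨N, hN⟩ := eventually_atTop.1 (h x)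
    constructor
    · intro hx
      exact ⟨N, fun n hn => by rwa [hN n hn]⟩
    · rintro ⟨N', hN'⟩
      rw [← hN (max N N') (le_max_left _ _)]
      exact hN' _ (le_max_right _ _)
  rw [this]
  exact MeasurableSet.iUnion fun N => MeasurableSet.iInter fun n =>
    MeasurableSet.iInter fun _ => hg n hs

/-- Kinds of jumps of a pair of configurations, their rates, and the rates of the clocks. -/
structure Dynamics (A : Type) where
  /-- the rates of the jumps -/
  rate : Kind A → State → ℝ
  /-- the jumps -/
  move : Kind A → State → State
  /-- the rates of the clocks -/
  bound : Kind A → Set.Ioi (0 : ℝ)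
  /-- the initial pairs -/
  dom : Set State
  /-- the range of the jumps at a label -/
  width : ℤ

namespace Dynamics

variable {A : Type} (M : Dynamics A)

open Classical in
/-- At a ring with mark `u`, the jump takes place if `|u|` is small. -/
noncomputable def op (k : Kind A) (u : ℝ) (z : State) : State :=
  if |u| * M.bound k < M.rate k z then M.move k z else z

/-- The requirements of the graphical construction. -/
structure IsRegular [Fintype A] : Prop where
  measurable_rate : ∀ k, Measurable (M.rate k)
  measurable_move : ∀ k, Measurable (M.move k)
  measurableSet_dom : MeasurableSet M.dom
  isLocal : IsLocalSystem M.dom M.width M.op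
  width_pos : 0 < M.width
  outside : ∀ i a u z j, (j < i - M.width ∨ i + M.width < j) →
    AgreeAt j (M.op (Sum.inl (i, a)) u z) z
  bound_inl : ∃ Λ : ℝ, ∀ p, (M.bound (Sum.inl p) : ℝ) = Λ
  summable : Summable fun y : ℤ => (M.bound (Sum.inr y) : ℝ)
  rate_nonneg : ∀ k z, 0 ≤ M.rate k z
  rate_le : ∀ k z, M.rate k z ≤ M.bound k

/-- The rings of the clocks. -/
def ringsAll (ω : Kind A → Clock) (k : Kind A) : Set (ℝ × ℝ) := rings (ω k)

/-- The clocks which are good. -/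
def IsGoodClocks (w : ℤ) (ω : Kind A → Clock) : Prop :=
  GoodClock w (ringsAll ω) ∧ (∀ k n, 0 < (ω k n).1) ∧ ∀ k (T : ℝ), ∃ N, T < arrival (ω k) N

/-- The law of the clocks. -/
noncomputable abbrev law : Measure (Kind A → Clock) := clocksLaw M.bound

/-- A measurable set of good clocks of full measure. -/
noncomputable def goodSet : Set (Kind A → Clock) :=
  (toMeasurable M.law {ω | ¬ IsGoodClocks M.width ω})ᶜ

lemma measurableSet_goodSet : MeasurableSet M.goodSet := (measurableSet_toMeasurable _ _).compl

variable {M}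

lemma isGood_of_mem {ω : Kind A → Clock} (h : ω ∈ M.goodSet) : IsGoodClocks M.width ω := by
  by_contra hcon
  exact h (subset_toMeasurable _ _ hcon)

lemma IsRegular.ae_mem_goodSet [Fintype A] (hM : M.IsRegular) :
    ∀ᵐ ω ∂M.law, ω ∈ M.goodSet := by
  obtain ⟨Λ, hΛ⟩ := hM.bound_inl
  have := ae_goodClock M.bound hΛ hM.summable hM.width_pos
  rw [ae_iff] at this ⊢
  simp only [goodSet, Set.mem_compl_iff, not_not]
  exact (measure_toMeasurable _).trans this

lemma IsRegular.measurable_op [Fintype A] (hM : M.IsRegular) (k : Kind A) :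
    Measurable fun p : ℝ × State => M.op k p.1 p.2 := by
  classical
  unfold op
  refine Measurable.ite (measurableSet_lt ?_ ((hM.measurable_rate k).comp measurable_snd))
    ((hM.measurable_move k).comp measurable_snd) measurable_snd
  exact (measurable_fst.abs).mul_const _

variable (M)

open Classical in
/-- The evolution from the pair `z` driven by the clocks in `B`. -/
noncomputable def finPath (B : Finset (Kind A)) (t : ℝ) (z : State) (ω : Kind A → Clock) : State :=
  if ω ∈ M.goodSet then
    evol (opAt M.op (ringsAll ω)) (ringTimes (ringsAll ω) B (Set.Iic t)) z
  else z

variable {M}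

lemma finPath_of_mem {ω : Kind A → Clock} (hω : ω ∈ M.goodSet) (B : Finset (Kind A)) (t : ℝ)
    (z : State) : M.finPath B t z ω =
      evol (opAt M.op (ringsAll ω)) (ringTimes (ringsAll ω) B (Set.Iic t)) z := if_pos hω

lemma finPath_of_notMem {ω : Kind A → Clock} (hω : ω ∉ M.goodSet) (B : Finset (Kind A)) (t : ℝ)
    (z : State) : M.finPath B t z ω = z := if_neg hω

/-! #### Measurability -/

open Classical in
/-- The evolution driven by finitely many rings. -/
noncomputable def evolRings (M : Dynamics A) (R : Finset (Kind A × ℕ)) (t : ℝ) (z : State)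
    (ω : Kind A → Clock) : State :=
  if ω ∈ M.goodSet then
    evol (opAt M.op (ringsAll ω)) ((R.image fun e => arrival (ω e.1) e.2).filter (· ≤ t)) z
  else z

lemma arrival_injective {ω : Kind A → Clock} (hω : IsGoodClocks M.width ω) {e e' : Kind A × ℕ}
    (h : arrival (ω e.1) e.2 = arrival (ω e'.1) e'.2) : e = e' := by
  obtain ⟨h1, -⟩ := hω.1.inj e.1 e'.1 _ ⟨e.2, rfl⟩ _ ⟨e'.2, rfl⟩ h
  obtain ⟨k, n⟩ := e
  obtain ⟨k', n'⟩ := e'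
  obtain rfl : k = k' := h1
  have h2 : n = n' := (strictMono_arrival (hω.2.1 k)).injective h
  rw [h2]

/-- The sample space is covered according to which ring of `R` is the last one before `t`, if any.
On such a piece the evolution is that ring's operation applied to the evolution driven by the
remaining rings. -/
lemma IsRegular.measurable_evolRings [Fintype A] (hM : M.IsRegular) (R : Finset (Kind A × ℕ))
    (t : ℝ) : Measurable fun p : State × (Kind A → Clock) => M.evolRings R t p.1 p.2 := by
  classical
  induction R using Finset.strongInduction with
  | H R ih =>
  have harr : ∀ e : Kind A × ℕ,
      Measurable fun p : State × (Kind A → Clock) => arrival (p.2 e.1) e.2 := fun e =>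
    (measurable_arrival e.2).comp ((measurable_pi_apply e.1).comp measurable_snd)
  have hgood : MeasurableSet {p : State × (Kind A → Clock) | p.2 ∈ M.goodSet} :=
    measurable_snd M.measurableSet_goodSet
  let C : Option R → Set (State × (Kind A → Clock)) := fun o => o.elim
    ({p | p.2 ∈ M.goodSet}ᶜ ∪ ⋂ e ∈ R, {p | t < arrival (p.2 e.1) e.2})
    (fun e => {p | p.2 ∈ M.goodSet} ∩ {p | arrival (p.2 e.1.1) e.1.2 ≤ t} ∩ ⋂ e' ∈ R.erase e.1,
      ({p | arrival (p.2 e'.1) e'.2 < arrival (p.2 e.1.1) e.1.2} ∪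
        {p | t < arrival (p.2 e'.1) e'.2}))
  let g : Option R → State × (Kind A → Clock) → State := fun o => o.elim Prod.fst
    (fun e p => M.op e.1.1 (p.2 e.1.1 e.1.2).2 (M.evolRings (R.erase e.1) t p.1 p.2))
  refine measurable_of_cover C ?_ ?_ g ?_ ?_
  · rintro (_ | e)
    · exact hgood.compl.union (Finset.measurableSet_biInter _ fun e _ =>
        measurableSet_lt measurable_const (harr e))
    · exact (hgood.inter (measurableSet_le (harr _) measurable_const)).inter
        (Finset.measurableSet_biInter _ fun e' _ =>
          (measurableSet_lt (harr e') (harr _)).union (measurableSet_lt measurable_const (harr e')))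
  · rintro ⟨z, ω⟩
    by_cases hω : ω ∈ M.goodSet
    swap
    · exact ⟨none, Or.inl hω⟩
    by_cases hne : (R.filter fun e => arrival (ω e.1) e.2 ≤ t).Nonempty
    · obtain ⟨e, he, hmax⟩ := Finset.exists_max_image _ (fun e => arrival (ω e.1) e.2) hne
      rw [Finset.mem_filter] at he
      refine ⟨some ⟨e, he.1⟩, ⟨hω, he.2⟩, ?_⟩
      simp only [Set.mem_iInter]
      intro e' he'
      rw [Finset.mem_erase] at he'
      by_cases h1 : arrival (ω e'.1) e'.2 ≤ t
      · refine Or.inl (lt_of_le_of_ne (hmax e' (Finset.mem_filter.2 ⟨he'.2, h1⟩)) fun h2 => ?_)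
        exact he'.1 (arrival_injective (isGood_of_mem hω) h2)
      · exact Or.inr (not_le.1 h1)
    · refine ⟨none, Or.inr ?_⟩
      simp only [Set.mem_iInter]
      intro e he
      by_contra hcon
      exact hne ⟨e, Finset.mem_filter.2 ⟨he, not_lt.1 hcon⟩⟩
  · rintro (_ | e)
    · exact measurable_fst
    · refine (hM.measurable_op e.1.1).comp (Measurable.prodMk ?_
        (ih _ (Finset.erase_ssubset e.2)))
      exact measurable_snd.comp ((measurable_pi_apply e.1.2).comp
        ((measurable_pi_apply e.1.1).comp measurable_snd))
  · rintro (_ | e) ⟨z, ω⟩ hp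
    · change M.evolRings R t z ω = z
      rw [evolRings]
      rcases hp with hp | hp
      · exact if_neg (show ω ∉ M.goodSet from hp)
      · split_ifs
        · rw [Finset.filter_eq_empty_iff.2, evol_empty]
          intro τ hτ
          obtain ⟨e, he, rfl⟩ := Finset.mem_image.1 hτ
          simp only [Set.mem_iInter] at hp
          exact not_le.2 (hp e he)
        · rfl
    · obtain ⟨⟨hω, het⟩, hlast⟩ := hp
      simp only [Set.mem_iInter] at hlast
      change ω ∈ M.goodSet at hω
      change arrival (ω e.1.1) e.1.2 ≤ t at het
      change M.evolRings R t z ω = M.op e.1.1 (ω e.1.1 e.1.2).2 (M.evolRings (R.erase e.1) t z ω)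
      have hset : (R.image fun e => arrival (ω e.1) e.2).filter (· ≤ t) =
          insert (arrival (ω e.1.1) e.1.2)
            (((R.erase e.1).image fun e => arrival (ω e.1) e.2).filter (· ≤ t)) := by
        conv_lhs => rw [← Finset.insert_erase e.2, Finset.image_insert, Finset.filter_insert,
          if_pos het]
      rw [evolRings, if_pos hω, evolRings, if_pos hω, hset, evol_insert]
      · exact opAt_eq (isGood_of_mem hω).1 (k := e.1.1) ⟨e.1.2, rfl⟩ _
      · intro σ hσ
        rw [Finset.mem_filter] at hσ
        obtain ⟨e', he', rfl⟩ := Finset.mem_image.1 hσ.1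
        rcases hlast e' he' with h1 | h1
        · exact h1
        · exact absurd h1 (not_lt.2 hσ.2)

/-- For good clocks, only finitely many rings of each clock in `B` occur before `t`, so the
evolutions driven by the first `N` rings of each are eventually constant in `N`. -/
lemma IsRegular.measurable_finPath [Fintype A] (hM : M.IsRegular) (B : Finset (Kind A)) (t : ℝ) :
    Measurable fun p : State × (Kind A → Clock) => M.finPath B t p.1 p.2 := by
  classical
  refine measurable_of_eventually_eq
    (fun N => hM.measurable_evolRings (B ×ˢ Finset.range N) t) fun p => ?_
  by_cases hω : p.2 ∈ M.goodSet
  swap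
  · refine Eventually.of_forall fun N => ?_
    rw [evolRings, if_neg hω, finPath_of_notMem hω]
  have hgood := isGood_of_mem hω
  choose N hN using fun k => hgood.2.2 k t
  filter_upwards [eventually_ge_atTop (B.sup N)] with n hn
  rw [evolRings, if_pos hω, finPath_of_mem hω]
  congr 1
  ext τ
  rw [mem_ringTimes hgood.1 subset_rfl, Finset.mem_filter, Finset.mem_image]
  constructor
  · rintro ⟨⟨e, he, rfl⟩, hτ⟩
    exact ⟨hτ, e.1, (Finset.mem_product.1 he).1, _, e.2, rfl⟩
  · rintro ⟨hτ, k, hk, u, m, hm⟩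
    obtain ⟨rfl, -⟩ := Prod.ext_iff.1 hm
    refine ⟨⟨(k, m), Finset.mem_product.2 ⟨hk, Finset.mem_range.2 ?_⟩, rfl⟩, hτ⟩
    have h1 : arrival (ω := p.2 k) m < arrival (p.2 k) (N k) := lt_of_le_of_lt hτ (hN k)
    exact ((strictMono_arrival (hgood.2.1 k)).lt_iff_lt.1 h1).trans_le
      ((Finset.le_sup hk).trans hn)

/-! #### Flow property -/

lemma spliceAll_rings {ω ω' : Kind A → Clock} (hω : IsGoodClocks M.width ω)
    (hω' : IsGoodClocks M.width ω') {s τ u : ℝ} {k : Kind A} :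
    (τ, u) ∈ ringsAll (spliceAll s ω ω') k ↔
      (τ ≤ s ∧ (τ, u) ∈ ringsAll ω k) ∨ (s < τ ∧ (τ - s, u) ∈ ringsAll ω' k) := by
  obtain ⟨N, hN⟩ := hω.2.2 k s
  exact mem_rings_splice (hω.2.1 k) (hω'.2.1 k) hN

lemma opAt_spliceAll_of_le {ω ω' : Kind A → Clock} (hω : IsGoodClocks M.width ω)
    (hω' : IsGoodClocks M.width ω') {s τ : ℝ}
    (hs : IsGoodClocks M.width (spliceAll s ω ω')) (hτ : τ ≤ s) :
    opAt M.op (ringsAll (spliceAll s ω ω')) τ = opAt M.op (ringsAll ω) τ := by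
  funext z
  by_cases h : ∃ k u, (τ, u) ∈ ringsAll ω k
  · obtain ⟨k, u, hu⟩ := h
    rw [opAt_eq hω.1 hu, opAt_eq hs.1 ((spliceAll_rings hω hω').2 (Or.inl ⟨hτ, hu⟩))]
  · rw [opAt_eq_self fun k u hu => h ⟨k, u, hu⟩, opAt_eq_self fun k u hu => ?_]
    rcases (spliceAll_rings hω hω').1 hu with h1 | h1
    · exact h ⟨k, u, h1.2⟩
    · exact absurd h1.1 (not_lt.2 hτ)

lemma opAt_spliceAll_add {ω ω' : Kind A → Clock} (hω : IsGoodClocks M.width ω)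
    (hω' : IsGoodClocks M.width ω') {s τ : ℝ}
    (hs : IsGoodClocks M.width (spliceAll s ω ω')) (hτ : 0 < τ) :
    opAt M.op (ringsAll (spliceAll s ω ω')) (s + τ) = opAt M.op (ringsAll ω') τ := by
  funext z
  have h0 : s < s + τ := by linarith
  by_cases h : ∃ k u, (τ, u) ∈ ringsAll ω' k
  · obtain ⟨k, u, hu⟩ := h
    rw [opAt_eq hω'.1 hu, opAt_eq hs.1 (k := k) (u := u)
      ((spliceAll_rings hω hω').2 (Or.inr ⟨h0, by rwa [add_sub_cancel_left]⟩))]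
  · rw [opAt_eq_self (c := ringsAll ω') fun k u hu => h ⟨k, u, hu⟩, opAt_eq_self fun k u hu => ?_]
    rcases (spliceAll_rings hω hω').1 hu with h1 | h1
    · exact absurd h1.1 (not_le.2 h0)
    · rw [add_sub_cancel_left] at h1
      exact h ⟨k, u, h1.2⟩

lemma finPath_spliceAll_of_le {ω ω' : Kind A → Clock} {s u : ℝ} (hω : ω ∈ M.goodSet)
    (hω' : ω' ∈ M.goodSet) (hs : spliceAll s ω ω' ∈ M.goodSet) (hu : u ≤ s)
    (B : Finset (Kind A)) (z : State) :
    M.finPath B u z (spliceAll s ω ω') = M.finPath B u z ω := by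
  have h1 := isGood_of_mem hω
  have h2 := isGood_of_mem hω'
  have h3 := isGood_of_mem hs
  rw [finPath_of_mem hω, finPath_of_mem hs]
  have h4 : ringTimes (ringsAll (spliceAll s ω ω')) B (Set.Iic u) =
      ringTimes (ringsAll ω) B (Set.Iic u) := by
    ext τ
    rw [mem_ringTimes h3.1 subset_rfl, mem_ringTimes h1.1 subset_rfl]
    refine and_congr_right fun hτ => exists_congr fun k => and_congr_right fun _ =>
      exists_congr fun v => ?_
    have hτs : τ ≤ s := le_trans hτ hu
    rw [spliceAll_rings h1 h2]
    simp [hτs, not_lt.2 hτs]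
  rw [h4]
  refine evol_congr _ (fun τ hτ => opAt_spliceAll_of_le h1 h2 h3 ?_) z
  exact le_trans ((mem_ringTimes h1.1 subset_rfl).1 hτ).1 hu

/-- Up to `s + t` the spliced clocks ring at the times of `ω` up to `s` and at the times of `ω'` up
to `t`, delayed by `s`. All of the former precede all of the latter, so the composition splits. -/
lemma finPath_spliceAll_add {ω ω' : Kind A → Clock} {s t : ℝ} (hω : ω ∈ M.goodSet)
    (hω' : ω' ∈ M.goodSet) (hs : spliceAll s ω ω' ∈ M.goodSet) (ht : 0 ≤ t)
    (B : Finset (Kind A)) (z : State) :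
    M.finPath B (s + t) z (spliceAll s ω ω') = M.finPath B t (M.finPath B s z ω) ω' := by
  classical
  have h1 := isGood_of_mem hω
  have h2 := isGood_of_mem hω'
  have h3 := isGood_of_mem hs
  rw [finPath_of_mem hω, finPath_of_mem hs, finPath_of_mem hω']
  have h4 : ringTimes (ringsAll (spliceAll s ω ω')) B (Set.Iic (s + t)) =
      ringTimes (ringsAll ω) B (Set.Iic s) ∪
        (ringTimes (ringsAll ω') B (Set.Iic t)).image (fun τ => s + τ) := by
    ext τ
    rw [Finset.mem_union, mem_ringTimes h3.1 subset_rfl, mem_ringTimes h1.1 subset_rfl,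
      Finset.mem_image]
    constructor
    · rintro ⟨hτ, k, hk, u, hu⟩
      rcases (spliceAll_rings h1 h2).1 hu with h5 | h5
      · exact Or.inl ⟨h5.1, k, hk, u, h5.2⟩
      · refine Or.inr ⟨τ - s, (mem_ringTimes h2.1 subset_rfl).2 ⟨?_, k, hk, u, h5.2⟩, by ring⟩
        have : τ ≤ s + t := hτ
        simp only [Set.mem_Iic]; linarith
    · rintro (⟨hτ, k, hk, u, hu⟩ | ⟨σ, hσ, rfl⟩)
      · have hτ' : τ ≤ s := hτ
        exact ⟨by simp only [Set.mem_Iic]; linarith, k, hk, u,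
          (spliceAll_rings h1 h2).2 (Or.inl ⟨hτ, hu⟩)⟩
      · obtain ⟨hσ, k, hk, u, hu⟩ := (mem_ringTimes h2.1 subset_rfl).1 hσ
        have hσ' : σ ≤ t := hσ
        have hpos : 0 < σ := h2.1.pos k _ hu
        exact ⟨by simp only [Set.mem_Iic]; linarith, k, hk, u,
          (spliceAll_rings h1 h2).2 (Or.inr ⟨by linarith, by rwa [add_sub_cancel_left]⟩)⟩
  have hpos : ∀ σ ∈ ringTimes (ringsAll ω') B (Set.Iic t), 0 < σ := by
    intro σ hσ
    obtain ⟨-, k, -, u, hu⟩ := (mem_ringTimes h2.1 subset_rfl).1 hσ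
    exact h2.1.pos k _ hu
  rw [h4, evol_union, evol_image_add]
  · rw [evol_congr _ (f' := opAt M.op (ringsAll ω')) fun τ hτ =>
        opAt_spliceAll_add h1 h2 h3 (hpos τ hτ)]
    rw [evol_congr _ (f' := opAt M.op (ringsAll ω)) fun τ hτ =>
      opAt_spliceAll_of_le h1 h2 h3 ((mem_ringTimes h1.1 subset_rfl).1 hτ).1]
  · intro σ hσ σ' hσ'
    obtain ⟨τ, hτ, rfl⟩ := Finset.mem_image.1 hσ'
    have h5 : σ ≤ s := ((mem_ringTimes h1.1 subset_rfl).1 hσ).1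
    linarith [hpos τ hτ]

lemma finPath_of_nonpos {t : ℝ} (ht : t ≤ 0) (B : Finset (Kind A)) (z : State)
    (ω : Kind A → Clock) : M.finPath B t z ω = z := by
  by_cases hω : ω ∈ M.goodSet
  · have h1 := isGood_of_mem hω
    rw [finPath_of_mem hω]
    have : ringTimes (ringsAll ω) B (Set.Iic t) = ∅ := by
      ext τ
      simp only [Finset.notMem_empty, iff_false, mem_ringTimes h1.1 subset_rfl]
      rintro ⟨hτ, k, -, u, hu⟩
      exact absurd (h1.1.pos k _ hu) (not_lt.2 (le_trans hτ ht))
    rw [this, evol_empty]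
  · exact finPath_of_notMem hω _ _ _

/-! #### Regularity of paths -/

lemma ringTimes_eq_filter {ω : Kind A → Clock} (hω : IsGoodClocks M.width ω)
    (B : Finset (Kind A)) {t T : ℝ} (ht : t ≤ T) :
    ringTimes (ringsAll ω) B (Set.Iic t) =
      (ringTimes (ringsAll ω) B (Set.Iic T)).filter (· ≤ t) := by
  ext τ
  rw [Finset.mem_filter, mem_ringTimes hω.1 subset_rfl, mem_ringTimes hω.1 subset_rfl]
  exact ⟨fun h => ⟨⟨le_trans h.1 ht, h.2⟩, h.1⟩, fun h => ⟨h.2, h.1.2⟩⟩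

lemma finPath_right (B : Finset (Kind A)) (t : ℝ) (z : State) (ω : Kind A → Clock) :
    ∀ᶠ s in 𝓝[≥] t, M.finPath B s z ω = M.finPath B t z ω := by
  by_cases hω : ω ∈ M.goodSet
  swap
  · simp [finPath_of_notMem hω]
  have h1 := isGood_of_mem hω
  simp only [finPath_of_mem hω]
  have h2 : ∀ᶠ s in 𝓝[≥] t, ∀ τ ∈ ringTimes (ringsAll ω) B (Set.Iic (t + 1)),
      τ ≤ s ↔ τ ≤ t := by
    refine (Filter.eventually_all_finset _).2 fun τ _ => ?_
    rcases le_or_gt τ t with h | h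
    · filter_upwards [self_mem_nhdsWithin] with s hs
      exact ⟨fun _ => h, fun _ => h.trans hs⟩
    · filter_upwards [mem_nhdsWithin_of_mem_nhds (gt_mem_nhds h)] with s hs
      exact ⟨fun h' => absurd hs (not_lt.2 h'), fun h' => absurd h (not_lt.2 h')⟩
  filter_upwards [h2, mem_nhdsWithin_of_mem_nhds (gt_mem_nhds (lt_add_one t))] with s hs hs'
  rw [ringTimes_eq_filter h1 B (le_of_lt hs'), ringTimes_eq_filter h1 B (lt_add_one t).le,
    Finset.filter_congr hs]

lemma finPath_left (B : Finset (Kind A)) (t : ℝ) (z : State) (ω : Kind A → Clock) :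
    ∃ y, ∀ᶠ s in 𝓝[<] t, M.finPath B s z ω = y := by
  by_cases hω : ω ∈ M.goodSet
  swap
  · exact ⟨z, by simp [finPath_of_notMem hω]⟩
  have h1 := isGood_of_mem hω
  simp only [finPath_of_mem hω]
  have h2 : ∀ᶠ s in 𝓝[<] t, ∀ τ ∈ ringTimes (ringsAll ω) B (Set.Iic t), τ ≤ s ↔ τ < t := by
    refine (Filter.eventually_all_finset _).2 fun τ _ => ?_
    rcases lt_or_ge τ t with h | h
    · filter_upwards [mem_nhdsWithin_of_mem_nhds (lt_mem_nhds h)] with s hs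
      exact ⟨fun _ => h, fun _ => le_of_lt hs⟩
    · filter_upwards [self_mem_nhdsWithin] with s hs
      exact ⟨fun h' => absurd (lt_of_le_of_lt h' hs) (not_lt.2 h),
        fun h' => absurd h' (not_lt.2 h)⟩
  refine ⟨evol (opAt M.op (ringsAll ω))
    ((ringTimes (ringsAll ω) B (Set.Iic t)).filter (· < t)) z, ?_⟩
  filter_upwards [h2, self_mem_nhdsWithin] with s hs hs'
  rw [ringTimes_eq_filter h1 B (le_of_lt hs'), Finset.filter_congr hs]

/-! #### The evolution driven by all clocks -/

/-- Finite sets which exhaust the kinds. -/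
noncomputable def kinds (A : Type) [Fintype A] (n : ℕ) : Finset (Kind A) := by
  classical
  exact (Finset.range n).image (exists_surjective_nat (Kind A)).choose

lemma eventually_mem_kinds [Fintype A] (k : Kind A) : ∀ᶠ n in atTop, k ∈ kinds A n := by
  classical
  obtain ⟨m, rfl⟩ := (exists_surjective_nat (Kind A)).choose_spec k
  filter_upwards [eventually_gt_atTop m] with n hn
  exact Finset.mem_image_of_mem _ (Finset.mem_range.2 hn)

variable (M) in
open Classical in
/-- The evolution from the pair `z` driven by all clocks. -/
noncomputable def path [Fintype A] (t : ℝ) (z : State) (ω : Kind A → Clock) : State :=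
  if h : (ω ∈ M.goodSet ∧ z ∈ M.dom) ∧ ∃ y, ConvTo (fun n => M.finPath (kinds A n) t z ω) y then
    h.2.choose else z

section path

variable [Fintype A]

lemma path_of_not {t : ℝ} {z : State} {ω : Kind A → Clock} (h : ¬ (ω ∈ M.goodSet ∧ z ∈ M.dom)) :
    M.path t z ω = z := by
  rw [path, dif_neg]; exact fun h' => h h'.1

lemma IsRegular.finPath_mem (hM : M.IsRegular) (B : Finset (Kind A)) (t : ℝ) {z : State}
    (hz : z ∈ M.dom) (ω : Kind A → Clock) : M.finPath B t z ω ∈ M.dom := by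
  by_cases hω : ω ∈ M.goodSet
  · rw [finPath_of_mem hω]; exact evol_mem hM.isLocal _ hz
  · rwa [finPath_of_notMem hω]

lemma IsRegular.exists_agree_finPath (hM : M.IsRegular) {ω : Kind A → Clock}
    (hω : ω ∈ M.goodSet) {B : ℕ → Finset (Kind A)} (hB : ∀ k, ∀ᶠ n in atTop, k ∈ B n)
    {x : ℕ → State} {z : State} (hx : ∀ n, x n ∈ M.dom)
    (hconv : ConvTo x z) (T : ℝ) (j : ℤ) :
    ∃ n₀, ∀ n ≥ n₀, ∀ t ≤ T,
      AgreeAt j (M.finPath (B n) t (x n) ω) (M.finPath (B n₀) t (x n₀) ω) := by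
  simp only [finPath_of_mem hω]
  exact exists_agree_evol hM.isLocal (isGood_of_mem hω).1 hB hx hconv T j

lemma IsRegular.convTo_path (hM : M.IsRegular) {ω : Kind A → Clock} (hω : ω ∈ M.goodSet)
    {z : State} (hz : z ∈ M.dom) (t : ℝ) :
    ConvTo (fun n => M.finPath (kinds A n) t z ω) (M.path t z ω) := by
  have h : (ω ∈ M.goodSet ∧ z ∈ M.dom) ∧ ∃ y, ConvTo (fun n => M.finPath (kinds A n) t z ω) y := by
    refine ⟨⟨hω, hz⟩, exists_convTo fun j => ?_⟩
    obtain ⟨n₀, h⟩ := hM.exists_agree_finPath hω eventually_mem_kinds (fun _ => hz)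
      (ConvTo.const z) t j
    exact ⟨n₀, fun n hn => h n hn t le_rfl⟩
  rw [path, dif_pos h]
  exact h.2.choose_spec

/-- The evolutions from converging initial pairs converge to the evolution from their limit. -/
lemma IsRegular.convTo_path_of_convTo (hM : M.IsRegular) {ω : Kind A → Clock} (hω : ω ∈ M.goodSet)
    {x : ℕ → State} {z : State} (hx : ∀ n, x n ∈ M.dom) (hconv : ConvTo x z) (t : ℝ) :
    ConvTo (fun n => M.finPath (kinds A n) t (x n) ω) (M.path t z ω) := by
  have hz : z ∈ M.dom := hM.isLocal.closed x z hx hconv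
  have hdiv : Tendsto (fun n : ℕ => n / 2) atTop atTop := Nat.tendsto_div_const_atTop two_ne_zero
  -- interlace the two sequences of initial pairs
  let x' : ℕ → State := fun n => if Even n then x (n / 2) else z
  have hx' : ∀ n, x' n ∈ M.dom := fun n => by
    simp only [x']; split_ifs
    exacts [hx _, hz]
  have hconv' : ConvTo x' z := fun j => by
    filter_upwards [hdiv.eventually (hconv j)] with n hn
    simp only [x']; split_ifs
    exacts [hn, AgreeAt.refl _ _]
  have h1 := fun j => hM.exists_agree_finPath hω (B := fun n => kinds A (n / 2))
    (fun k => hdiv.eventually (eventually_mem_kinds k)) hx' hconv' t j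
  intro j
  obtain ⟨n₀, hn₀⟩ := h1 j
  filter_upwards [eventually_ge_atTop n₀, hM.convTo_path hω hz t j] with n hn hn'
  -- The indices `2 * n` and `2 * n + 1` use the same clocks `kinds A n` but the initial pairs `x n`
  -- and `z`; both are compared with the index `n₀`.
  have h2 := hn₀ (2 * n) (by omega) t le_rfl
  have h3 := hn₀ (2 * n + 1) (by omega) t le_rfl
  have e1 : x' (2 * n) = x n := by simp [x']
  have e2 : x' (2 * n + 1) = z := by simp [x']
  have e3 : (2 * n + 1) / 2 = n := by omega
  have e4 : 2 * n / 2 = n := by omega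
  rw [e1, e4] at h2
  rw [e2, e3] at h3
  exact (h2.trans h3.symm).trans hn'

lemma IsRegular.path_mem (hM : M.IsRegular) (t : ℝ) {z : State} (hz : z ∈ M.dom)
    (ω : Kind A → Clock) : M.path t z ω ∈ M.dom := by
  by_cases hω : ω ∈ M.goodSet
  · exact hM.isLocal.closed _ _ (fun n => hM.finPath_mem _ t hz ω) (hM.convTo_path hω hz t)
  · rwa [path_of_not fun h => hω h.1]

lemma IsRegular.path_of_nonpos (hM : M.IsRegular) {t : ℝ} (ht : t ≤ 0) (z : State)
    (ω : Kind A → Clock) : M.path t z ω = z := by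
  by_cases h : ω ∈ M.goodSet ∧ z ∈ M.dom
  · refine (hM.convTo_path h.1 h.2 t).unique ?_
    simp only [finPath_of_nonpos ht]
    exact ConvTo.const z
  · exact path_of_not h

lemma IsRegular.measurable_path (hM : M.IsRegular) (t : ℝ) :
    Measurable fun p : State × (Kind A → Clock) => M.path t p.1 p.2 := by
  classical
  have hset : MeasurableSet {p : State × (Kind A → Clock) | p.2 ∈ M.goodSet ∧ p.1 ∈ M.dom} :=
    (measurable_snd M.measurableSet_goodSet).inter (measurable_fst hM.measurableSet_dom)
  have hg : ∀ n, Measurable fun p : State × (Kind A → Clock) =>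
      if p.2 ∈ M.goodSet ∧ p.1 ∈ M.dom then M.finPath (kinds A n) t p.1 p.2 else p.1 := fun n =>
    Measurable.ite hset (hM.measurable_finPath _ t) measurable_fst
  have hconv : ∀ j, ∀ p : State × (Kind A → Clock), ∀ᶠ n in atTop,
      AgreeAt j (if p.2 ∈ M.goodSet ∧ p.1 ∈ M.dom then M.finPath (kinds A n) t p.1 p.2 else p.1)
        (M.path t p.1 p.2) := by
    intro j p
    by_cases h : p.2 ∈ M.goodSet ∧ p.1 ∈ M.dom
    · simp only [if_pos h]
      exact hM.convTo_path h.1 h.2 t j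
    · simp only [if_neg h, path_of_not h]
      exact Eventually.of_forall fun _ => AgreeAt.refl _ _
  refine Measurable.prodMk (measurable_pi_lambda _ fun j => ?_)
    (measurable_pi_lambda _ fun j => ?_)
  · exact measurable_of_eventually_eq (fun n => (measurable_pi_apply j).comp (hg n).fst)
      fun p => (hconv j p).mono fun n hn => hn.1
  · exact measurable_of_eventually_eq (fun n => (measurable_pi_apply j).comp (hg n).snd)
      fun p => (hconv j p).mono fun n hn => hn.2

lemma IsRegular.path_spliceAll_of_le (hM : M.IsRegular) {ω ω' : Kind A → Clock} {s u : ℝ}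
    (hω : ω ∈ M.goodSet) (hω' : ω' ∈ M.goodSet) (hs : spliceAll s ω ω' ∈ M.goodSet) (hu : u ≤ s)
    (z : State) : M.path u z (spliceAll s ω ω') = M.path u z ω := by
  by_cases hz : z ∈ M.dom
  · refine (hM.convTo_path hs hz u).unique ?_
    simp only [finPath_spliceAll_of_le hω hω' hs hu]
    exact hM.convTo_path hω hz u
  · rw [path_of_not fun h => hz h.2, path_of_not fun h => hz h.2]

/-- In the approximation the second stage starts from a pair that depends on `n`. Its limit
therefore needs continuity in the initial pair, not merely convergence from a fixed one. -/
lemma IsRegular.path_spliceAll_add (hM : M.IsRegular) {ω ω' : Kind A → Clock} {s t : ℝ}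
    (hω : ω ∈ M.goodSet) (hω' : ω' ∈ M.goodSet) (hs : spliceAll s ω ω' ∈ M.goodSet) (ht : 0 ≤ t)
    (z : State) : M.path (s + t) z (spliceAll s ω ω') = M.path t (M.path s z ω) ω' := by
  by_cases hz : z ∈ M.dom
  · refine (hM.convTo_path hs hz (s + t)).unique ?_
    simp only [finPath_spliceAll_add hω hω' hs ht]
    exact hM.convTo_path_of_convTo hω' (fun n => hM.finPath_mem _ s hz ω)
      (hM.convTo_path hω hz s) t
  · rw [path_of_not fun h => hz h.2, path_of_not (t := s) fun h => hz h.2,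
      path_of_not fun h => hz h.2]

/-- Until `T`, one coordinate of the limit coincides with that of an evolution driven by finitely
many clocks, so its path is a step function of the same regularity. -/
lemma IsRegular.exists_agree_path (hM : M.IsRegular) {ω : Kind A → Clock} (hω : ω ∈ M.goodSet)
    {z : State} (hz : z ∈ M.dom) (T : ℝ) (j : ℤ) :
    ∃ B, ∀ t ≤ T, AgreeAt j (M.path t z ω) (M.finPath B t z ω) := by
  obtain ⟨n₀, h⟩ := hM.exists_agree_finPath hω eventually_mem_kinds (fun _ => hz)
    (ConvTo.const z) T j
  refine ⟨kinds A n₀, fun t ht => ?_⟩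
  obtain ⟨n, hn, hn'⟩ := ((eventually_ge_atTop n₀).and (hM.convTo_path hω hz t j)).exists
  exact hn'.symm.trans (h n hn t ht)

lemma IsRegular.path_right (hM : M.IsRegular) (t : ℝ) (z : State) (ω : Kind A → Clock) (j : ℤ) :
    ∀ᶠ s in 𝓝[≥] t, AgreeAt j (M.path s z ω) (M.path t z ω) := by
  by_cases h : ω ∈ M.goodSet ∧ z ∈ M.dom
  · obtain ⟨B, hB⟩ := hM.exists_agree_path h.1 h.2 (t + 1) j
    filter_upwards [M.finPath_right B t z ω,
      mem_nhdsWithin_of_mem_nhds (gt_mem_nhds (lt_add_one t))] with s hs hs'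
    have h1 := hB s (le_of_lt hs')
    rw [hs] at h1
    exact h1.trans (hB t (lt_add_one t).le).symm
  · simp only [path_of_not h]
    exact Eventually.of_forall fun _ => AgreeAt.refl _ _

lemma IsRegular.path_left (hM : M.IsRegular) (t : ℝ) (z : State) (ω : Kind A → Clock) (j : ℤ) :
    ∃ y, ∀ᶠ s in 𝓝[<] t, AgreeAt j (M.path s z ω) y := by
  by_cases h : ω ∈ M.goodSet ∧ z ∈ M.dom
  · obtain ⟨B, hB⟩ := hM.exists_agree_path h.1 h.2 t j
    obtain ⟨y, hy⟩ := M.finPath_left B t z ω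
    refine ⟨y, ?_⟩
    filter_upwards [hy, self_mem_nhdsWithin] with s hs hs'
    exact hs ▸ hB s (le_of_lt hs')
  · simp only [path_of_not h]
    exact ⟨z, Eventually.of_forall fun _ => AgreeAt.refl _ _⟩

end path

end Dynamics

end TaggedExclusion

/-! ### Markov property and martingale problem for random flows. -/

namespace TaggedExclusion

/-! ### Stochastic flows and their Markov property -/

section flow

variable {E Ω : Type} [MeasurableSpace E] [MeasurableSpace Ω]

/-- A random flow with stationary independent increments: the noise until the time `s` and an
independent noise after it can be spliced. -/
structure IsFlow (μ : Measure Ω) (φ : ℝ → E → Ω → E) : Prop where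
  measurable : ∀ t, Measurable fun p : E × Ω => φ t p.1 p.2
  zero : ∀ z ω, φ 0 z ω = z
  splice : ∀ s, 0 ≤ s → ∃ Φ : Ω × Ω → Ω, MeasurePreserving Φ (μ.prod μ) μ ∧
    ∀ᵐ p ∂(μ.prod μ), (∀ u ≤ s, ∀ z, φ u z (Φ p) = φ u z p.1) ∧
      ∀ t, 0 ≤ t → ∀ z, φ (s + t) z (Φ p) = φ t (φ s z p.1) p.2

variable {μ : Measure Ω} {φ : ℝ → E → Ω → E}

lemma integral_comp_of_measurePreserving {α β : Type*} [MeasurableSpace α] [MeasurableSpace β]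
    {ρ : Measure α} {ν : Measure β} {f : α → β} (hf : MeasurePreserving f ρ ν) {g : β → ℝ}
    (hg : Measurable g) : ∫ x, g (f x) ∂ρ = ∫ y, g y ∂ν := by
  rw [← hf.map_eq, integral_map hf.measurable.aemeasurable hg.aestronglyMeasurable]

lemma integrable_of_abs_le {α : Type*} [MeasurableSpace α] {ρ : Measure α} [IsFiniteMeasure ρ]
    {f : α → ℝ} (hf : Measurable f) {C : ℝ} (hC : ∀ x, |f x| ≤ C) : Integrable f ρ :=
  Integrable.of_bound hf.aestronglyMeasurable C (Eventually.of_forall hC)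

lemma abs_integral_le_of_abs_le {α : Type*} [MeasurableSpace α] {ρ : Measure α}
    [IsProbabilityMeasure ρ] {f : α → ℝ} {C : ℝ} (hC : ∀ x, |f x| ≤ C) : |∫ x, f x ∂ρ| ≤ C := by
  have := norm_integral_le_of_norm_le_const (μ := ρ) (f := f) (Eventually.of_forall hC)
  simpa using this

namespace IsFlow

/-- The filtration generated by the flow. -/
def filtration (h : IsFlow μ φ) : Filtration ℝ≥0 (inferInstance : MeasurableSpace (E × Ω)) where
  seq s := ⨆ u ∈ Set.Iic s,
    MeasurableSpace.comap (fun x : E × Ω => φ (u : ℝ) x.1 x.2) inferInstance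
  mono' _ _ hst := biSup_mono fun _ hu => le_trans hu hst
  le' _ := iSup₂_le fun u _ => (h.measurable u).comap_le

lemma measurable_filtration (h : IsFlow μ φ) (t : ℝ≥0) :
    Measurable[h.filtration t] fun x : E × Ω => φ (t : ℝ) x.1 x.2 := by
  rw [measurable_iff_comap_le]
  exact le_iSup₂_of_le (f := fun u (_ : u ∈ Set.Iic t) =>
    MeasurableSpace.comap (fun x : E × Ω => φ (u : ℝ) x.1 x.2) inferInstance) t Set.self_mem_Iic le_rfl

variable [IsProbabilityMeasure μ] (h : IsFlow μ φ)

include h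

lemma exists_splice (π : Measure E) [IsProbabilityMeasure π] {s : ℝ} (hs : 0 ≤ s) :
    ∃ Ψ : (E × Ω) × Ω → E × Ω, MeasurePreserving Ψ ((π.prod μ).prod μ) (π.prod μ) ∧
      ∀ᵐ q ∂((π.prod μ).prod μ),
        (∀ u ≤ s, φ u (Ψ q).1 (Ψ q).2 = φ u q.1.1 q.1.2) ∧
        ∀ t, 0 ≤ t → φ (s + t) (Ψ q).1 (Ψ q).2 = φ t (φ s q.1.1 q.1.2) q.2 := by
  obtain ⟨Φ, hΦ, hae⟩ := h.splice s hs
  have h1 := measurePreserving_prodAssoc π μ μ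
  refine ⟨_, ((MeasurePreserving.id π).prod hΦ).comp h1, ?_⟩
  have h2 : MeasurePreserving (fun q : (E × Ω) × Ω => (q.1.2, q.2)) ((π.prod μ).prod μ)
      (μ.prod μ) := (measurePreserving_snd (μ := π) (ν := μ.prod μ)).comp h1
  filter_upwards [h2.quasiMeasurePreserving.ae hae] with q hq
  exact ⟨fun u hu => hq.1 u hu _, fun t ht => hq.2 t ht _⟩

/-- The Chapman–Kolmogorov equation: replacing the noise by a spliced one does not change its law,
and makes the two stages depend on independent noises. -/
lemma integral_semigroup {F : E → ℝ} (hF : Measurable F) {C : ℝ} (hC : ∀ x, |F x| ≤ C) {s t : ℝ}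
    (hs : 0 ≤ s) (ht : 0 ≤ t) (z : E) :
    ∫ ω, F (φ (s + t) z ω) ∂μ = ∫ ω, ∫ ω', F (φ t (φ s z ω) ω') ∂μ ∂μ := by
  obtain ⟨Φ, hΦ, hae⟩ := h.splice s hs
  have hm : ∀ t z, Measurable fun ω => F (φ t z ω) := fun t z =>
    hF.comp ((h.measurable t).comp measurable_prodMk_left)
  rw [← integral_comp_of_measurePreserving hΦ (hm (s + t) z)]
  have h1 : ∫ p, F (φ (s + t) z (Φ p)) ∂(μ.prod μ) =
      ∫ p : Ω × Ω, F (φ t (φ s z p.1) p.2) ∂(μ.prod μ) := by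
    refine integral_congr_ae ?_
    filter_upwards [hae] with p hp
    rw [hp.2 t ht z]
  rw [h1, integral_prod]
  refine integrable_of_abs_le ?_ fun p => hC _
  exact hF.comp ((h.measurable t).comp (((h.measurable s).comp
    (measurable_const.prodMk measurable_fst)).prodMk measurable_snd))

lemma measurable_integral {F : E → ℝ} (hF : Measurable F) (t : ℝ) :
    Measurable fun z => ∫ ω, F (φ t z ω) ∂μ :=
  ((hF.comp (h.measurable t)).stronglyMeasurable.integral_prod_right').measurable

/-- The Markov property. -/
lemma setIntegral_add (π : Measure E) [IsProbabilityMeasure π] {F : E → ℝ} (hF : Measurable F)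
    {C : ℝ} (hC : ∀ x, |F x| ≤ C) (s : ℝ≥0) {t : ℝ} (ht : 0 ≤ t) {D : Set (E × Ω)}
    (hD : MeasurableSet[h.filtration s] D) :
    ∫ x in D, F (φ (s + t) x.1 x.2) ∂(π.prod μ) =
      ∫ x in D, ∫ ω, F (φ t (φ s x.1 x.2) ω) ∂μ ∂(π.prod μ) := by
  obtain ⟨Ψ, hΨ, hae⟩ := h.exists_splice π s.coe_nonneg
  have hm : Measurable fun x : E × Ω => F (φ (s + t) x.1 x.2) := hF.comp (h.measurable _)
  have hm' : Measurable fun q : (E × Ω) × Ω => F (φ t (φ s q.1.1 q.1.2) q.2) :=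
    hF.comp ((h.measurable t).comp (((h.measurable s).comp measurable_fst).prodMk measurable_snd))
  -- events until the time `s` are not changed by the splicing
  obtain ⟨hDm, hDae⟩ : MeasurableSet D ∧ ∀ᵐ q ∂((π.prod μ).prod μ), Ψ q ∈ D ↔ q.1 ∈ D := by
    -- The measurable events which splicing leaves unchanged almost surely form a σ-algebra. It
    -- contains the generators of the filtration at `s`, hence all of its events.
    let 𝒢 : MeasurableSpace (E × Ω) :=
      { MeasurableSet' := fun D => MeasurableSet D ∧
          ∀ᵐ q ∂((π.prod μ).prod μ), Ψ q ∈ D ↔ q.1 ∈ D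
        measurableSet_empty := ⟨MeasurableSet.empty, by simp⟩
        measurableSet_compl := fun D hD => ⟨hD.1.compl, by
          filter_upwards [hD.2] with q hq
          simp [hq]⟩
        measurableSet_iUnion := fun D hD => ⟨MeasurableSet.iUnion fun i => (hD i).1, by
          filter_upwards [ae_all_iff.2 fun i => (hD i).2] with q hq
          simp [hq]⟩ }
    have hle : h.filtration s ≤ 𝒢 := by
      refine iSup₂_le fun u hu => ?_
      rintro _ ⟨B, hB, rfl⟩
      refine ⟨h.measurable u hB, ?_⟩
      filter_upwards [hae] with q hq
      simp only [Set.mem_preimage]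
      rw [hq.1 u (NNReal.coe_le_coe.2 hu)]
    exact hle D hD
  rw [← integral_indicator hDm, ← integral_indicator hDm,
    ← integral_comp_of_measurePreserving hΨ (hm.indicator hDm)]
  have h1 : ∫ q, D.indicator (fun x : E × Ω => F (φ (s + t) x.1 x.2)) (Ψ q) ∂((π.prod μ).prod μ) =
      ∫ q, (D ×ˢ Set.univ).indicator (fun q : (E × Ω) × Ω => F (φ t (φ s q.1.1 q.1.2) q.2)) q
        ∂((π.prod μ).prod μ) := by
    refine integral_congr_ae ?_
    filter_upwards [hae, hDae] with q hq hq'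
    by_cases hqD : q.1 ∈ D
    · rw [Set.indicator_of_mem (hq'.2 hqD), Set.indicator_of_mem (Set.mem_prod.2 ⟨hqD, Set.mem_univ _⟩),
        hq.2 t ht]
    · rw [Set.indicator_of_notMem (fun h => hqD (hq'.1 h)),
        Set.indicator_of_notMem fun h => hqD (Set.mem_prod.1 h).1]
  rw [h1, integral_prod]
  · refine integral_congr_ae (Eventually.of_forall fun x => ?_)
    by_cases hx : x ∈ D
    · simp [Set.indicator, hx]
    · simp [Set.indicator, hx]
  · refine integrable_of_abs_le (C := C) (hm'.indicator (hDm.prod MeasurableSet.univ)) fun q => ?_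
    by_cases hq : q ∈ D ×ˢ (Set.univ : Set Ω)
    · rw [Set.indicator_of_mem hq]; exact hC _
    · rw [Set.indicator_of_notMem hq, abs_zero]; exact (abs_nonneg _).trans (hC q.1.1)

lemma condExp_preimage (π : Measure E) [IsProbabilityMeasure π] (s t : ℝ≥0) {B : Set E}
    (hB : MeasurableSet B) :
    (π.prod μ)[((fun x : E × Ω => φ ((s + t : ℝ≥0) : ℝ) x.1 x.2) ⁻¹' B).indicator
        (fun _ => (1 : ℝ)) | h.filtration s] =ᵐ[π.prod μ]
      fun x => (μ.map (φ t (φ s x.1 x.2))).real B := by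
  classical
  set F : E → ℝ := B.indicator 1 with hFdef
  have hF : Measurable F := measurable_one.indicator hB
  have hC : ∀ x, |F x| ≤ 1 := fun x => by
    rw [hFdef, Set.indicator_apply]; split_ifs <;> simp
  have hreal : ∀ z, (μ.map (φ t z)).real B = ∫ ω, F (φ t z ω) ∂μ := fun z => by
    have hm : Measurable (φ (t : ℝ) z) := (h.measurable t).comp measurable_prodMk_left
    rw [← integral_map hm.aemeasurable hF.aestronglyMeasurable, hFdef, integral_indicator_one hB]
  simp only [hreal]
  have hind : ((fun x : E × Ω => φ ((s + t : ℝ≥0) : ℝ) x.1 x.2) ⁻¹' B).indicator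
      (fun _ => (1 : ℝ)) = fun x => F (φ ((s : ℝ) + t) x.1 x.2) := by
    funext x; simp [hFdef, Set.indicator, NNReal.coe_add]
  rw [hind]
  have hm1 : Measurable fun x : E × Ω => F (φ ((s : ℝ) + t) x.1 x.2) := hF.comp (h.measurable _)
  have hm2 : Measurable[h.filtration s] fun x : E × Ω => ∫ ω, F (φ t (φ s x.1 x.2) ω) ∂μ :=
    (h.measurable_integral hF t).comp (h.measurable_filtration s)
  refine (ae_eq_condExp_of_forall_setIntegral_eq (h.filtration.le s)
    (integrable_of_abs_le hm1 fun x => hC _) (fun D _ _ => ?_) (fun D hD _ => ?_) ?_).symm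
  · exact (integrable_of_abs_le (hm2.mono (h.filtration.le s) le_rfl)
      fun x => abs_integral_le_of_abs_le fun ω => hC _).integrableOn
  · exact (h.setIntegral_add π hF hC s t.2 hD).symm
  · exact hm2.stronglyMeasurable.aestronglyMeasurable

/-- The martingale problem follows from the forward equation. -/
lemma martingale (π : Measure E) [IsProbabilityMeasure π] {dom : Set E}
    (hπ : ∀ᵐ z ∂π, z ∈ dom) (hdom : ∀ t, 0 ≤ t → ∀ z ∈ dom, ∀ ω, φ t z ω ∈ dom)
    {F H : E → ℝ} (hF : Measurable F) {C : ℝ} (hC : ∀ x, |F x| ≤ C) (hH : Measurable H)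
    {C' : ℝ} (hC' : ∀ x, |H x| ≤ C')
    (hjoint : Measurable fun p : ℝ × (E × Ω) => H (φ p.1 p.2.1 p.2.2))
    (hadapt : ∀ t : ℝ≥0, Measurable[h.filtration t] fun x : E × Ω =>
      ∫ u in (0 : ℝ)..t, H (φ u x.1 x.2))
    (hfwd : ∀ z ∈ dom, ∀ t, 0 ≤ t →
      ∫ ω, F (φ t z ω) ∂μ - F z = ∫ u in (0 : ℝ)..t, ∫ ω, H (φ u z ω) ∂μ) :
    Martingale (fun (t : ℝ≥0) (x : E × Ω) =>
      F (φ t x.1 x.2) - F (φ 0 x.1 x.2) - ∫ u in (0 : ℝ)..t, H (φ u x.1 x.2))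
      h.filtration (π.prod μ) := by
  have hFm : ∀ t : ℝ, Measurable fun x : E × Ω => F (φ t x.1 x.2) := fun t =>
    hF.comp (h.measurable t)
  have hFint : ∀ t : ℝ, Integrable (fun x : E × Ω => F (φ t x.1 x.2)) (π.prod μ) := fun t =>
    integrable_of_abs_le (hFm t) fun x => hC _
  have hHu : ∀ x : E × Ω, ∀ a b, IntervalIntegrable (fun u => H (φ u x.1 x.2)) volume a b := by
    intro x a b
    refine (intervalIntegrable_const (c := C')).mono_fun
      (hjoint.comp (measurable_id.prodMk measurable_const)).aestronglyMeasurable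
      (Eventually.of_forall fun u => ?_)
    exact (hC' _).trans (le_abs_self C')
  have hI : ∀ t : ℝ≥0, Integrable (fun x : E × Ω => ∫ u in (0 : ℝ)..t, H (φ u x.1 x.2))
      (π.prod μ) := by
    intro t
    refine integrable_of_abs_le (C := C' * |(t : ℝ) - 0|)
      ((hadapt t).mono (h.filtration.le t) le_rfl) fun x => ?_
    exact intervalIntegral.norm_integral_le_of_norm_le_const (f := fun u => H (φ u x.1 x.2))
      fun u _ => hC' _
  refine ⟨fun t => ?_, fun s t hst => ?_⟩
  · refine ((Measurable.sub (Measurable.sub ?_ ?_) (hadapt t))).stronglyMeasurable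
    · exact hF.comp (h.measurable_filtration t)
    · exact hF.comp ((h.measurable_filtration 0).mono (h.filtration.mono (zero_le : 0 ≤ t)) le_rfl)
  · have hMint : ∀ t : ℝ≥0, Integrable (fun x : E × Ω =>
        F (φ t x.1 x.2) - F (φ 0 x.1 x.2) - ∫ u in (0 : ℝ)..t, H (φ u x.1 x.2)) (π.prod μ) :=
      fun t => ((hFint t).sub (hFint 0)).sub (hI t)
    refine (ae_eq_condExp_of_forall_setIntegral_eq (h.filtration.le s) (hMint t)
      (fun D _ _ => (hMint s).integrableOn) (fun D hD _ => ?_) ?_).symm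
    swap
    · refine ((Measurable.sub (Measurable.sub ?_ ?_) (hadapt s))).stronglyMeasurable.aestronglyMeasurable
      · exact hF.comp (h.measurable_filtration s)
      · exact hF.comp ((h.measurable_filtration 0).mono (h.filtration.mono (zero_le : 0 ≤ s)) le_rfl)
    obtain ⟨r, rfl⟩ := exists_add_of_le hst
    have hr : (0 : ℝ) ≤ r := r.coe_nonneg
    have hadd : ∀ x : E × Ω, ∫ u in (0 : ℝ)..(s + r : ℝ≥0), H (φ u x.1 x.2) =
        (∫ u in (0 : ℝ)..s, H (φ u x.1 x.2)) + ∫ u in (0 : ℝ)..r, H (φ (s + u) x.1 x.2) := by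
      intro x
      rw [intervalIntegral.integral_comp_add_left (fun u => H (φ u x.1 x.2)) (s : ℝ), add_zero,
        intervalIntegral.integral_add_adjacent_intervals (hHu x _ _) (hHu x _ _), NNReal.coe_add]
    have hae : ∀ᵐ x ∂((π.prod μ).restrict D), φ s x.1 x.2 ∈ dom := by
      refine ae_restrict_of_ae ?_
      filter_upwards [(measurePreserving_fst (μ := π) (ν := μ)).quasiMeasurePreserving.ae hπ]
        with x hx
      exact hdom s s.2 _ hx _
    have hjs : Measurable fun p : (E × Ω) × ℝ => H (φ (s + p.2) p.1.1 p.1.2) :=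
      hjoint.comp ((measurable_const.add measurable_snd).prodMk measurable_fst)
    have hswap : ∫ x in D, (∫ u in (0 : ℝ)..r, H (φ (s + u) x.1 x.2)) ∂(π.prod μ) =
        ∫ u in (0 : ℝ)..r, ∫ x in D, H (φ (s + u) x.1 x.2) ∂(π.prod μ) := by
      simp only [intervalIntegral.integral_of_le hr]
      exact integral_integral_swap (integrable_of_abs_le hjs fun p => hC' _)
    have hjm : Measurable fun p : ((E × Ω) × ℝ) × Ω => H (φ p.1.2 (φ s p.1.1.1 p.1.1.2) p.2) :=
      hjoint.comp ((measurable_snd.comp measurable_fst).prodMk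
        (((h.measurable s).comp (measurable_fst.comp measurable_fst)).prodMk measurable_snd))
    have hswap' : ∫ x in D, (∫ u in (0 : ℝ)..r, ∫ ω, H (φ u (φ s x.1 x.2) ω) ∂μ) ∂(π.prod μ) =
        ∫ u in (0 : ℝ)..r, ∫ x in D, ∫ ω, H (φ u (φ s x.1 x.2) ω) ∂μ ∂(π.prod μ) := by
      simp only [intervalIntegral.integral_of_le hr]
      exact integral_integral_swap (integrable_of_abs_le
        (hjm.stronglyMeasurable.integral_prod_right').measurable
        fun p => abs_integral_le_of_abs_le fun ω => hC' _)
    -- By the Markov property both sides become integrals over `D` of functions of the pair at time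
    -- `s`, and there the forward equation identifies them.
    have hkey : ∫ x in D, (F (φ (s + r) x.1 x.2) - F (φ s x.1 x.2)) ∂(π.prod μ) =
        ∫ x in D, (∫ u in (0 : ℝ)..r, H (φ (s + u) x.1 x.2)) ∂(π.prod μ) := by
      have e1 : ∫ x in D, (F (φ (s + r) x.1 x.2) - F (φ s x.1 x.2)) ∂(π.prod μ) =
          ∫ x in D, ((∫ ω, F (φ r (φ s x.1 x.2) ω) ∂μ) - F (φ s x.1 x.2)) ∂(π.prod μ) := by
        rw [integral_sub (hFint _).integrableOn (hFint _).integrableOn,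
          show ∫ x in D, F (φ (s + r) x.1 x.2) ∂(π.prod μ) = _ from h.setIntegral_add π hF hC s hr hD,
            integral_sub (Integrable.integrableOn ?_) (hFint _).integrableOn]
        exact integrable_of_abs_le ((h.measurable_integral hF r).comp (h.measurable s))
          fun x => abs_integral_le_of_abs_le fun ω => hC _
      rw [e1, hswap]
      have e2 : ∫ x in D, ((∫ ω, F (φ r (φ s x.1 x.2) ω) ∂μ) - F (φ s x.1 x.2)) ∂(π.prod μ) =
          ∫ x in D, (∫ u in (0 : ℝ)..r, ∫ ω, H (φ u (φ s x.1 x.2) ω) ∂μ) ∂(π.prod μ) :=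
        integral_congr_ae (hae.mono fun x hx => hfwd _ hx r r.2)
      rw [e2, hswap']
      refine intervalIntegral.integral_congr fun u hu => ?_
      rw [Set.uIcc_of_le hr] at hu
      exact (h.setIntegral_add π hH hC' s hu.1 hD).symm
    have hIr : Integrable (fun x : E × Ω => ∫ u in (0 : ℝ)..r, H (φ (s + u) x.1 x.2))
        (π.prod μ) := by
      have := (hI (s + r)).sub (hI s)
      refine this.congr (Eventually.of_forall fun x => ?_)
      simp only [Pi.sub_apply, hadd, add_sub_cancel_left]
    have hsplit : ∀ x : E × Ω,
        F (φ ((s + r : ℝ≥0) : ℝ) x.1 x.2) - F (φ 0 x.1 x.2) -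
            ∫ u in (0 : ℝ)..(s + r : ℝ≥0), H (φ u x.1 x.2) =
          (F (φ s x.1 x.2) - F (φ 0 x.1 x.2) - ∫ u in (0 : ℝ)..s, H (φ u x.1 x.2)) +
            ((F (φ (s + r) x.1 x.2) - F (φ s x.1 x.2)) -
              ∫ u in (0 : ℝ)..r, H (φ (s + u) x.1 x.2)) := by
      intro x
      rw [hadd x, NNReal.coe_add]; ring
    simp only [hsplit]
    have hFr : Integrable (fun x : E × Ω => F (φ (s + r) x.1 x.2) - F (φ s x.1 x.2)) (π.prod μ) :=
      (hFint _).sub (hFint _)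
    have hG : Integrable (fun x : E × Ω => F (φ (s + r) x.1 x.2) - F (φ s x.1 x.2) -
        ∫ u in (0 : ℝ)..r, H (φ (s + u) x.1 x.2)) (π.prod μ) := hFr.sub hIr
    rw [integral_add (hMint s).integrableOn hG.integrableOn,
      integral_sub hFr.integrableOn hIr.integrableOn, hkey, sub_self, add_zero]

end IsFlow

end flow

end TaggedExclusion

/-! ### Forward equation from the expansion for small times. -/

namespace TaggedExclusion

/-! ### The forward equation of a flow -/

section forward

variable {E Ω : Type} [MeasurableSpace E] [MeasurableSpace Ω] {μ : Measure Ω}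
  [IsProbabilityMeasure μ] {φ : ℝ → E → Ω → E}

lemma continuousOn_of_abs_sub_le {g : ℝ → ℝ} {K : ℝ}
    (hg : ∀ t, 0 ≤ t → ∀ h, 0 ≤ h → h ≤ 1 → |g (t + h) - g t| ≤ K * h) :
    ContinuousOn g (Set.Ici 0) := by
  have hK : 0 ≤ K := by
    have := (abs_nonneg _).trans (hg 0 le_rfl 1 zero_le_one le_rfl)
    linarith
  have key : ∀ s t, 0 ≤ s → s ≤ t → t - s < 1 → |g t - g s| ≤ K * (t - s) := by
    intro s t hs hst h
    have := hg s hs (t - s) (by linarith) h.le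
    rwa [add_sub_cancel] at this
  refine Metric.continuousOn_iff.2 fun t ht ε hε => ⟨min 1 (ε / (K + 1)), by positivity, ?_⟩
  intro s hs hst
  rw [Real.dist_eq] at hst ⊢
  have h1 := hst.trans_le (min_le_left _ _)
  have h2 := (lt_div_iff₀ (by linarith)).1 (hst.trans_le (min_le_right _ _))
  have h3 := abs_nonneg (s - t)
  have h4 : |g s - g t| ≤ K * |s - t| := by
    rcases le_total s t with h | h
    · rw [abs_sub_comm (g s), abs_sub_comm s, abs_of_nonneg (sub_nonneg.2 h)]
      rw [abs_sub_comm] at h1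
      exact key s t hs h ((le_abs_self _).trans_lt h1)
    · rw [abs_of_nonneg (sub_nonneg.2 h)]
      exact key t s ht h ((le_abs_self _).trans_lt h1)
  nlinarith

/-- The forward equation follows from a uniform estimate for small times. -/
lemma IsFlow.forward (hφ : IsFlow μ φ) {F H : E → ℝ} (hF : Measurable F) (hH : Measurable H)
    {C C' : ℝ} (hC : ∀ z, |F z| ≤ C) (hC' : ∀ z, |H z| ≤ C') {K K' : ℝ}
    (hK : ∀ h, 0 ≤ h → ∀ z, |(∫ ω, F (φ h z ω) ∂μ) - F z - h * H z| ≤ K * h ^ 2)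
    (hK' : ∀ h, 0 ≤ h → ∀ z, |(∫ ω, H (φ h z ω) ∂μ) - H z| ≤ K' * h) {t : ℝ} (ht : 0 ≤ t) (z : E) :
    ContinuousOn (fun u => ∫ ω, H (φ u z ω) ∂μ) (Set.Ici 0) ∧
      (∫ ω, F (φ t z ω) ∂μ) - F z = ∫ u in (0 : ℝ)..t, ∫ ω, H (φ u z ω) ∂μ := by
  set f : ℝ → ℝ := fun t => ∫ ω, F (φ t z ω) ∂μ with hf
  set g : ℝ → ℝ := fun t => ∫ ω, H (φ t z ω) ∂μ with hg
  have hm : ∀ t, Measurable fun ω => φ t z ω := fun t =>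
    (hφ.measurable t).comp measurable_prodMk_left
  have hFm : ∀ t, Integrable (fun ω => F (φ t z ω)) μ := fun t =>
    integrable_of_abs_le (hF.comp (hm t)) fun _ => hC _
  have hHm : ∀ t, Integrable (fun ω => H (φ t z ω)) μ := fun t =>
    integrable_of_abs_le (hH.comp (hm t)) fun _ => hC' _
  have hFi : ∀ t h, Integrable (fun ω => ∫ ω', F (φ h (φ t z ω) ω') ∂μ) μ := fun t h =>
    integrable_of_abs_le ((hφ.measurable_integral hF h).comp (hm t))
      fun _ => abs_integral_le_of_abs_le fun _ => hC _
  have hHi : ∀ t h, Integrable (fun ω => ∫ ω', H (φ h (φ t z ω) ω') ∂μ) μ := fun t h =>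
    integrable_of_abs_le ((hφ.measurable_integral hH h).comp (hm t))
      fun _ => abs_integral_le_of_abs_le fun _ => hC' _
  -- The estimate at time zero is uniform in the initial point, so averaging it over the point
  -- reached at time `t` gives the same estimate at `t`.
  have hfstep : ∀ t, 0 ≤ t → ∀ h, 0 ≤ h → |f (t + h) - f t - h * g t| ≤ K * h ^ 2 := by
    intro t ht h hh
    have : f (t + h) - f t - h * g t =
        ∫ ω, ((∫ ω', F (φ h (φ t z ω) ω') ∂μ) - F (φ t z ω) - h * H (φ t z ω)) ∂μ := by
      have hd : Integrable (fun ω => (∫ ω', F (φ h (φ t z ω) ω') ∂μ) - F (φ t z ω)) μ :=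
        (hFi t h).sub (hFm t)
      rw [integral_sub hd ((hHm t).const_mul h),
        integral_sub (hFi t h) (hFm t), integral_const_mul, ← hφ.integral_semigroup hF hC ht hh]
    rw [this]
    exact abs_integral_le_of_abs_le fun ω => hK h hh _
  have hgstep : ∀ t, 0 ≤ t → ∀ h, 0 ≤ h → h ≤ 1 → |g (t + h) - g t| ≤ K' * h := by
    intro t ht h hh _
    have : g (t + h) - g t = ∫ ω, ((∫ ω', H (φ h (φ t z ω) ω') ∂μ) - H (φ t z ω)) ∂μ := by
      rw [integral_sub (hHi t h) (hHm t), ← hφ.integral_semigroup hH hC' ht hh]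
    rw [this]
    exact abs_integral_le_of_abs_le fun ω => hK' h hh _
  have hKnn : 0 ≤ K := by
    have := (abs_nonneg _).trans (hfstep 0 le_rfl 1 zero_le_one)
    linarith
  have hgb : ∀ t, |g t| ≤ C' := fun t => abs_integral_le_of_abs_le fun ω => hC' _
  have hgc := continuousOn_of_abs_sub_le hgstep
  have hfc : ContinuousOn f (Set.Ici 0) := by
    refine continuousOn_of_abs_sub_le (K := K + C') fun t ht h hh h1 => ?_
    have e1 := hfstep t ht h hh
    have e2 : |h * g t| ≤ h * C' := by
      rw [abs_mul, abs_of_nonneg hh]; exact mul_le_mul_of_nonneg_left (hgb t) hh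
    have e3 : K * h ^ 2 ≤ K * h := mul_le_mul_of_nonneg_left (by nlinarith) hKnn
    rw [abs_le] at e1 e2 ⊢
    constructor <;> linarith [e1.1, e1.2, e2.1, e2.2]
  have hsub : Set.uIcc 0 t ⊆ Set.Ici 0 := by
    rw [Set.uIcc_of_le ht]; exact Set.Icc_subset_Ici_self
  have hf0 : f 0 = F z := by simp [hf, hφ.zero]
  rw [← hf0]
  -- The quadratic error makes `g` the right derivative of `f`. Both are continuous, so `f` is the
  -- integral of `g`.
  refine ⟨hgc, (intervalIntegral.integral_eq_sub_of_hasDeriv_right (hfc.mono hsub) (fun s hs => ?_)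
    (hgc.mono hsub).intervalIntegrable).symm⟩
  rw [min_eq_left ht, max_eq_right ht] at hs
  rw [hasDerivWithinAt_iff_isLittleO, Asymptotics.isLittleO_iff]
  intro c hc
  have hnear : ∀ᶠ x in 𝓝[>] s, x < s + c / (K + 1) :=
    mem_nhdsWithin_of_mem_nhds (gt_mem_nhds (lt_add_of_pos_right _ (by positivity)))
  filter_upwards [hnear, self_mem_nhdsWithin] with x hx hx'
  have hx0 : 0 < x - s := sub_pos.2 hx'
  have e1 := hfstep s hs.1.le (x - s) hx0.le
  rw [add_sub_cancel] at e1
  rw [smul_eq_mul, Real.norm_eq_abs, Real.norm_eq_abs, abs_of_pos hx0]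
  refine e1.trans ?_
  have e2 : (x - s) * (K + 1) < c := (lt_div_iff₀ (by linarith)).1 (by linarith)
  nlinarith

end forward

/-! ### The generator of the evolution driven by finitely many clocks -/

section soon

/-- The first ring is before the time `h`. -/
noncomputable def soon (h : ℝ) : ℝ × ℝ → ℝ := {p | p.1 ≤ h}.indicator 1

lemma soon_nonneg (h : ℝ) (p : ℝ × ℝ) : 0 ≤ soon h p := Set.indicator_nonneg (by simp) _

lemma soon_le_one (h : ℝ) (p : ℝ × ℝ) : soon h p ≤ 1 :=
  Set.indicator_le_self' (f := (1 : ℝ × ℝ → ℝ)) (by simp) p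

lemma soon_of_le {h : ℝ} {p : ℝ × ℝ} (hp : p.1 ≤ h) : soon h p = 1 := by
  rw [soon, Set.indicator_of_mem (show p ∈ {p : ℝ × ℝ | p.1 ≤ h} from hp)]; rfl

lemma soon_of_lt {h : ℝ} {p : ℝ × ℝ} (hp : h < p.1) : soon h p = 0 :=
  Set.indicator_of_notMem (show p ∉ {p : ℝ × ℝ | p.1 ≤ h} from not_le.2 hp) _

lemma measurable_soon (h : ℝ) : Measurable (soon h) :=
  measurable_one.indicator (measurableSet_le measurable_fst measurable_const)

lemma integral_soon_mul (l : Set.Ioi (0 : ℝ)) {h : ℝ} (hh : 0 ≤ h) (f : ℝ → ℝ) :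
    ∫ p, soon h p * f p.2 ∂(ringLaw l) = (1 - Real.exp (-(l * h))) * ∫ u, f u ∂markLaw := by
  have h1 : ∀ p : ℝ × ℝ, soon h p = (Set.Iic h).indicator 1 p.1 := fun p => rfl
  simp only [h1]
  rw [ringLaw, integral_prod_mul, integral_indicator_one measurableSet_Iic, measureReal_def,
    expMeasure_Iic l hh, ENNReal.toReal_ofReal]
  rw [sub_nonneg, Real.exp_le_one_iff, neg_nonpos]
  exact mul_nonneg (le_of_lt l.2) hh

lemma integral_soon_le (l : Set.Ioi (0 : ℝ)) {h : ℝ} (hh : 0 ≤ h) :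
    ∫ p, soon h p ∂(ringLaw l) ≤ l * h := by
  have := integral_soon_mul l hh fun _ => 1
  simp only [mul_one, integral_const, probReal_univ, smul_eq_mul] at this
  rw [this]
  linarith [Real.add_one_le_exp (-((l : ℝ) * h))]

/-- The upper bound on the exponential follows from `exp (-x) * (1 + x) ≤ 1 ≤ (1 - x + x ^ 2) * (1 +
x)`; the last product is `1 + x ^ 3`. -/
lemma abs_one_sub_exp_sub_le {x : ℝ} (hx : 0 ≤ x) : |1 - Real.exp (-x) - x| ≤ x ^ 2 := by
  have h1 := Real.add_one_le_exp (-x)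
  have h2 : Real.exp (-x) * (1 + x) ≤ 1 := by
    have h3 := Real.add_one_le_exp x
    have h4 : Real.exp (-x) * Real.exp x = 1 := by rw [← Real.exp_add]; simp
    nlinarith [Real.exp_pos (-x)]
  have h5 : Real.exp (-x) ≤ 1 - x + x ^ 2 := by
    have : 1 ≤ (1 - x + x ^ 2) * (1 + x) := by nlinarith [pow_nonneg hx 3]
    by_contra hcon
    push Not at hcon
    nlinarith
  rw [abs_le]
  constructor <;> nlinarith

variable {K : Type} (lam : K → Set.Ioi (0 : ℝ))

/-- Two different rings are independent, whether they belong to one clock or to two, and a waiting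
time of rate `λ` is at most `h` with probability at most `λ * h`. -/
lemma integral_soon_mul_soon_le {k k' : K} {n n' : ℕ} (hne : (k, n) ≠ (k', n')) {h : ℝ}
    (hh : 0 ≤ h) :
    ∫ ω, soon h (ω k n) * soon h (ω k' n') ∂(clocksLaw lam) ≤ (lam k * h) * (lam k' * h) := by
  have hprod : MeasurePreserving (fun ω : K → Clock => (ω k n, ω k' n')) (clocksLaw lam)
      ((ringLaw (lam k)).prod (ringLaw (lam k'))) := by
    by_cases hk : k = k'
    · subst hk
      have h1 : MeasurePreserving (fun ω : Clock => (ω n, ω n')) (clockLaw (lam k))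
          ((ringLaw (lam k)).prod (ringLaw (lam k))) :=
        ⟨by fun_prop, Measure.infinitePi_map_eval_prod fun h => hne (by rw [h])⟩
      exact h1.comp (measurePreserving_clock lam k)
    · have h1 : MeasurePreserving (fun ω : K → Clock => (ω k, ω k')) (clocksLaw lam)
          ((clockLaw (lam k)).prod (clockLaw (lam k'))) :=
        ⟨by fun_prop, Measure.infinitePi_map_eval_prod hk⟩
      exact ((measurePreserving_eval_infinitePi (fun _ : ℕ => ringLaw (lam k)) n).prod
        (measurePreserving_eval_infinitePi (fun _ : ℕ => ringLaw (lam k')) n')).comp h1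
  rw [integral_comp_of_measurePreserving hprod (g := fun p => soon h p.1 * soon h p.2)
    (((measurable_soon h).comp measurable_fst).mul ((measurable_soon h).comp measurable_snd)),
    integral_prod_mul]
  exact mul_le_mul (integral_soon_le _ hh) (integral_soon_le _ hh)
    (integral_nonneg (soon_nonneg h)) (mul_nonneg (le_of_lt (lam k).2) hh)

end soon

namespace Dynamics

variable {A : Type} {M : Dynamics A}

variable (M) in
/-- The contribution of the jumps of the kind `k` to the generator. -/
noncomputable def drift (k : Kind A) (F : State → ℝ) (z : State) : ℝ :=
  M.bound k * ∫ u, (F (M.op k u z) - F z) ∂markLaw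

/-- The probability that more than one clock of `B` rings before `h` is estimated by the expectation
of this number. -/
noncomputable def doubleRings [DecidableEq (Kind A)] (B : Finset (Kind A)) (h : ℝ)
    (ω : Kind A → Clock) : ℝ :=
  ∑ k ∈ B, (soon h (ω k 0) * soon h (ω k 1) +
    ∑ k' ∈ B.erase k, soon h (ω k 0) * soon h (ω k' 0))

lemma doubleRings_nonneg [DecidableEq (Kind A)] (B : Finset (Kind A)) (h : ℝ)
    (ω : Kind A → Clock) : 0 ≤ doubleRings B h ω :=
  Finset.sum_nonneg fun _ _ => add_nonneg (mul_nonneg (soon_nonneg _ _) (soon_nonneg _ _))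
    (Finset.sum_nonneg fun _ _ => mul_nonneg (soon_nonneg _ _) (soon_nonneg _ _))

lemma finPath_of_forall_lt {ω : Kind A → Clock} (hω : ω ∈ M.goodSet) {B : Finset (Kind A)} {h : ℝ}
    (hB : ∀ k ∈ B, h < (ω k 0).1) (z : State) : M.finPath B h z ω = z := by
  have hg := isGood_of_mem hω
  have : ringTimes (ringsAll ω) B (Set.Iic h) = ∅ := by
    ext τ
    simp only [Finset.notMem_empty, iff_false, mem_ringTimes hg.1 subset_rfl]
    rintro ⟨hτ, k, hk, u, hu⟩
    have := first_le_of_mem_rings (hg.2.1 k) hu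
    exact absurd (hB k hk) (not_lt.2 (le_trans this hτ))
  rw [finPath_of_mem hω, this, evol_empty]

lemma finPath_of_unique {ω : Kind A → Clock} (hω : ω ∈ M.goodSet) {B : Finset (Kind A)} {h : ℝ}
    {k : Kind A} (hk : k ∈ B) (hkh : (ω k 0).1 ≤ h) (hk1 : h < (ω k 1).1)
    (hB : ∀ k' ∈ B, k' ≠ k → h < (ω k' 0).1) (z : State) :
    M.finPath B h z ω = M.op k (ω k 0).2 z := by
  have hg := isGood_of_mem hω
  have hring : ((ω k 0).1, (ω k 0).2) ∈ ringsAll ω k := ⟨0, by simp [arrival_zero]⟩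
  have : ringTimes (ringsAll ω) B (Set.Iic h) = insert (ω k 0).1 ∅ := by
    ext τ
    rw [mem_ringTimes hg.1 subset_rfl, Finset.mem_insert]
    simp only [Finset.notMem_empty, or_false]
    constructor
    · rintro ⟨hτ, k', hk', u, hu⟩
      have h1 := first_le_of_mem_rings (hg.2.1 k') hu
      by_cases hkk : k' = k
      swap
      · exact absurd (hB k' hk' hkk) (not_lt.2 (le_trans h1 hτ))
      subst hkk
      obtain ⟨n, hn⟩ := hu
      obtain ⟨rfl, -⟩ := Prod.ext_iff.1 hn
      have h2 : arrival (ω k') n < arrival (ω k') 1 := by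
        refine lt_of_le_of_lt hτ ?_
        have : arrival (ω k') 1 = (ω k' 0).1 + (ω k' 1).1 := by
          simp [arrival, Finset.sum_range_succ]
        rw [this]
        linarith [hg.2.1 k' 0]
      have h3 : n = 0 := by
        have := (strictMono_arrival (hg.2.1 k')).lt_iff_lt.1 h2
        omega
      subst h3
      exact arrival_zero _
    · rintro rfl
      exact ⟨hkh, k, hk, _, hring⟩
  rw [finPath_of_mem hω, this, evol_insert _ (by simp), evol_empty, opAt_eq hg.1 hring]

/-- With no ring, or a single ring, before `h` the difference vanishes. Otherwise `doubleRings` is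
at least one, and the crude bounds `2 * C` on the increment and on each of the `B.card` summands
suffice. -/
lemma abs_finPath_sub_le [DecidableEq (Kind A)] {ω : Kind A → Clock} (hω : ω ∈ M.goodSet)
    (B : Finset (Kind A)) (h : ℝ) {F : State → ℝ} {C : ℝ} (hC : ∀ z, |F z| ≤ C) (z : State) :
    |F (M.finPath B h z ω) - F z -
        ∑ k ∈ B, soon h (ω k 0) * (F (M.op k (ω k 0).2 z) - F z)| ≤
      2 * C * (1 + B.card) * doubleRings B h ω := by
  have hC0 : 0 ≤ C := (abs_nonneg _).trans (hC z)
  have hdiff : ∀ y, |F y - F z| ≤ 2 * C := fun y =>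
    (abs_sub _ _).trans (by linarith [hC y, hC z])
  have hR := doubleRings_nonneg B h ω
  by_cases h1 : ∀ k ∈ B, h < (ω k 0).1
  · rw [finPath_of_forall_lt hω h1, Finset.sum_eq_zero fun k hk => by
      rw [soon_of_lt (h1 k hk), zero_mul]]
    simp only [sub_self, abs_zero]
    positivity
  push Not at h1
  obtain ⟨k, hk, hkh⟩ := h1
  by_cases h2 : h < (ω k 1).1 ∧ ∀ k' ∈ B, k' ≠ k → h < (ω k' 0).1
  · rw [finPath_of_unique hω hk hkh h2.1 h2.2, Finset.sum_eq_single_of_mem k hk fun k' hk' hne => by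
      rw [soon_of_lt (h2.2 k' hk' hne), zero_mul], soon_of_le hkh, one_mul, sub_self, abs_zero]
    positivity
  · have hR1 : 1 ≤ doubleRings B h ω := by
      have e1 : ∀ k, 0 ≤ ∑ k' ∈ B.erase k, soon h (ω k 0) * soon h (ω k' 0) := fun k =>
        Finset.sum_nonneg fun _ _ => mul_nonneg (soon_nonneg _ _) (soon_nonneg _ _)
      have e2 : ∀ k, 0 ≤ soon h (ω k 0) * soon h (ω k 1) := fun k =>
        mul_nonneg (soon_nonneg _ _) (soon_nonneg _ _)
      refine le_trans ?_ (Finset.single_le_sum (f := fun k => soon h (ω k 0) * soon h (ω k 1) +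
        ∑ k' ∈ B.erase k, soon h (ω k 0) * soon h (ω k' 0))
        (fun k _ => add_nonneg (e2 k) (e1 k)) hk)
      by_cases h3 : h < (ω k 1).1
      · have h4 : ∃ k' ∈ B, k' ≠ k ∧ (ω k' 0).1 ≤ h := by
          by_contra hcon
          push Not at hcon
          exact h2 ⟨h3, hcon⟩
        obtain ⟨k', hk', hne, hk'h⟩ := h4
        have := Finset.single_le_sum (f := fun k' => soon h (ω k 0) * soon h (ω k' 0))
          (fun _ _ => mul_nonneg (soon_nonneg _ _) (soon_nonneg _ _))
          (Finset.mem_erase.2 ⟨hne, hk'⟩)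
        simp only [soon_of_le hkh, soon_of_le hk'h, one_mul] at this ⊢
        linarith [soon_nonneg h (ω k 1)]
      · have := e1 k
        rw [soon_of_le hkh, soon_of_le (not_lt.1 h3)]
        rw [soon_of_le hkh] at this
        linarith
    have hsum : |∑ k ∈ B, soon h (ω k 0) * (F (M.op k (ω k 0).2 z) - F z)| ≤ B.card * (2 * C) := by
      refine (Finset.abs_sum_le_sum_abs _ _).trans ?_
      rw [← nsmul_eq_mul]
      refine Finset.sum_le_card_nsmul _ _ _ fun k _ => ?_
      rw [abs_mul, abs_of_nonneg (soon_nonneg _ _)]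
      exact (mul_le_of_le_one_left (abs_nonneg _) (soon_le_one _ _)).trans (hdiff _)
    refine (abs_sub _ _).trans ?_
    have := hdiff (M.finPath B h z ω)
    have e3 : 0 ≤ 2 * C * (1 + (B.card : ℝ)) := by positivity
    nlinarith

variable [Fintype A]

lemma IsRegular.measurable_comp_op (hM : M.IsRegular) (k : Kind A) {F : State → ℝ}
    (hF : Measurable F) (z : State) : Measurable fun u => F (M.op k u z) - F z :=
  (hF.comp ((hM.measurable_op k).comp measurable_prodMk_right)).sub_const _

lemma IsRegular.measurable_drift (hM : M.IsRegular) (k : Kind A) {F : State → ℝ}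
    (hF : Measurable F) : Measurable (M.drift k F) := by
  refine Measurable.const_mul ?_ _
  have h1 : Measurable fun p : State × ℝ => F (M.op k p.2 p.1) - F p.1 :=
    (hF.comp ((hM.measurable_op k).comp measurable_swap)).sub (hF.comp measurable_fst)
  exact (h1.stronglyMeasurable.integral_prod_right').measurable

omit [Fintype A] in
lemma abs_drift_le (M : Dynamics A) (k : Kind A) {F : State → ℝ} {C : ℝ} (hC : ∀ z, |F z| ≤ C)
    (z : State) : |M.drift k F z| ≤ M.bound k * (2 * C) := by
  rw [drift, abs_mul, abs_of_pos (M.bound k).2]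
  refine mul_le_mul_of_nonneg_left (abs_integral_le_of_abs_le fun u => ?_) (le_of_lt (M.bound k).2)
  exact (abs_sub _ _).trans (by linarith [hC (M.op k u z), hC z])

lemma IsRegular.exists_small_time (hM : M.IsRegular) (B : Finset (Kind A)) {F : State → ℝ}
    (hF : Measurable F) {C : ℝ} (hC : ∀ z, |F z| ≤ C) :
    ∃ K, ∀ h, 0 ≤ h → ∀ z, |(∫ ω, F (M.finPath B h z ω) ∂M.law) - F z -
      h * ∑ k ∈ B, M.drift k F z| ≤ K * h ^ 2 := by
  classical
  set b : Kind A → ℝ := fun k => M.bound k with hb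
  have hb0 : ∀ k, 0 < b k := fun k => (M.bound k).2
  -- `K₁` bounds the expectation of `doubleRings` in units of `h ^ 2`; `K₂` collects the errors of
  -- replacing `1 - exp (-(b k * h))` by `b k * h`.
  set K₁ : ℝ := ∑ k ∈ B, (b k * b k + ∑ k' ∈ B.erase k, b k * b k') with hK₁
  set K₂ : ℝ := ∑ k ∈ B, b k ^ 2 * (2 * C) with hK₂
  refine ⟨2 * C * (1 + B.card) * K₁ + K₂, fun h hh z => ?_⟩
  have hC0 : 0 ≤ C := (abs_nonneg _).trans (hC z)
  have hdiff : ∀ y, |F y - F z| ≤ 2 * C := fun y =>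
    (abs_sub _ _).trans (by linarith [hC y, hC z])
  have hring : ∀ (k : Kind A) n, Measurable fun ω : Kind A → Clock => ω k n := fun k n =>
    (measurePreserving_ring M.bound k n).measurable
  have hs : ∀ (k : Kind A) n, Measurable fun ω : Kind A → Clock => soon h (ω k n) := fun k n =>
    (measurable_soon h).comp (hring k n)
  have hss : ∀ (k k' : Kind A) n n', Integrable
      (fun ω : Kind A → Clock => soon h (ω k n) * soon h (ω k' n')) M.law := fun k k' n n' => by
    refine integrable_of_abs_le (C := 1) ((hs k n).mul (hs k' n')) fun ω => ?_
    rw [abs_mul, abs_of_nonneg (soon_nonneg _ _), abs_of_nonneg (soon_nonneg _ _)]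
    exact mul_le_one₀ (soon_le_one _ _) (soon_nonneg _ _) (soon_le_one _ _)
  have hT : ∀ k, Integrable (fun ω : Kind A → Clock =>
      ∑ k' ∈ B.erase k, soon h (ω k 0) * soon h (ω k' 0)) M.law := fun k =>
    integrable_finsetSum _ fun k' _ => hss _ _ _ _
  have hT' : ∀ k, Integrable (fun ω : Kind A → Clock => soon h (ω k 0) * soon h (ω k 1) +
      ∑ k' ∈ B.erase k, soon h (ω k 0) * soon h (ω k' 0)) M.law := fun k => (hss _ _ _ _).add (hT k)
  have hRint : Integrable (doubleRings B h) M.law := integrable_finsetSum _ fun k _ => hT' k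
  have hR : ∫ ω, doubleRings B h ω ∂M.law ≤ K₁ * h ^ 2 := by
    simp only [doubleRings]
    rw [integral_finsetSum _ fun k _ => hT' k, hK₁, Finset.sum_mul]
    refine Finset.sum_le_sum fun k _ => ?_
    rw [integral_add (hss _ _ _ _) (hT k),
      integral_finsetSum _ fun k' _ => hss _ _ _ _, add_mul, Finset.sum_mul]
    refine add_le_add ?_ (Finset.sum_le_sum fun k' hk' => ?_)
    · refine (integral_soon_mul_soon_le M.bound (by simp) hh).trans (le_of_eq ?_)
      simp only [hb]; ring
    · refine (integral_soon_mul_soon_le M.bound (fun h => (Finset.mem_erase.1 hk').1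
        (Prod.ext_iff.1 h).1.symm) hh).trans (le_of_eq ?_)
      simp only [hb]; ring
  have hJm : ∀ k, Measurable fun p : ℝ × ℝ => soon h p * (F (M.op k p.2 z) - F z) := fun k =>
    (measurable_soon h).mul ((hM.measurable_comp_op k hF z).comp measurable_snd)
  have hJint : ∀ k, Integrable
      (fun ω : Kind A → Clock => soon h (ω k 0) * (F (M.op k (ω k 0).2 z) - F z)) M.law := by
    intro k
    refine integrable_of_abs_le (C := 2 * C) ((hJm k).comp (hring k 0)) fun ω => ?_
    rw [abs_mul, abs_of_nonneg (soon_nonneg _ _)]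
    exact (mul_le_of_le_one_left (abs_nonneg _) (soon_le_one _ _)).trans (hdiff _)
  have hJ : ∀ k, |(∫ ω, soon h (ω k 0) * (F (M.op k (ω k 0).2 z) - F z) ∂M.law) -
      h * M.drift k F z| ≤ b k ^ 2 * (2 * C) * h ^ 2 := by
    intro k
    rw [integral_comp_of_measurePreserving (measurePreserving_ring M.bound k 0) (hJm k),
      integral_soon_mul _ hh (fun u => F (M.op k u z) - F z), drift]
    set I := ∫ u, (F (M.op k u z) - F z) ∂markLaw
    have hI : |I| ≤ 2 * C := abs_integral_le_of_abs_le fun u => hdiff _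
    have e1 : (1 - Real.exp (-(M.bound k * h))) * I - h * (M.bound k * I) =
        (1 - Real.exp (-(b k * h)) - b k * h) * I := by simp only [hb]; ring
    rw [e1, abs_mul]
    have e2 := abs_one_sub_exp_sub_le (mul_nonneg (hb0 k).le hh)
    calc _ ≤ (b k * h) ^ 2 * (2 * C) := mul_le_mul e2 hI (abs_nonneg _) (sq_nonneg _)
      _ = _ := by ring
  have hFint : Integrable (fun ω => F (M.finPath B h z ω)) M.law :=
    integrable_of_abs_le (hF.comp ((hM.measurable_finPath B h).comp measurable_prodMk_left))
      fun _ => hC _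
  have hDint : Integrable (fun ω => F (M.finPath B h z ω) - F z) M.law :=
    hFint.sub (integrable_const _)
  have hSint := integrable_finsetSum B fun k _ => hJint k
  have hmain : |∫ ω, (F (M.finPath B h z ω) - F z -
      ∑ k ∈ B, soon h (ω k 0) * (F (M.op k (ω k 0).2 z) - F z)) ∂M.law| ≤
        2 * C * (1 + B.card) * (K₁ * h ^ 2) := by
    refine (abs_integral_le_integral_abs).trans ?_
    refine (integral_mono_ae (g := fun ω => 2 * C * (1 + B.card) * doubleRings B h ω)
      (hDint.sub hSint).abs (hRint.const_mul _) ?_).trans ?_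
    · filter_upwards [hM.ae_mem_goodSet] with ω hω
      exact abs_finPath_sub_le hω B h hC z
    · rw [integral_const_mul]
      exact mul_le_mul_of_nonneg_left hR (by positivity)
  rw [integral_sub hDint hSint, integral_sub hFint (integrable_const _), integral_const,
    probReal_univ, one_smul, integral_finsetSum _ fun k _ => hJint k] at hmain
  have hsum : |(∑ k ∈ B, ∫ ω, soon h (ω k 0) * (F (M.op k (ω k 0).2 z) - F z) ∂M.law) -
      h * ∑ k ∈ B, M.drift k F z| ≤ K₂ * h ^ 2 := by
    rw [Finset.mul_sum, ← Finset.sum_sub_distrib, hK₂, Finset.sum_mul]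
    exact (Finset.abs_sum_le_sum_abs _ _).trans (Finset.sum_le_sum fun k _ => hJ k)
  rw [abs_le] at hmain hsum ⊢
  constructor <;> nlinarith [hmain.1, hmain.2, hsum.1, hsum.2]

/-! #### The flows -/

lemma IsRegular.exists_splice (hM : M.IsRegular) {s : ℝ} (hs : 0 ≤ s) :
    MeasurePreserving (fun p : (Kind A → Clock) × (Kind A → Clock) => spliceAll s p.1 p.2)
        (M.law.prod M.law) M.law ∧
      ∀ᵐ p ∂(M.law.prod M.law), p.1 ∈ M.goodSet ∧ p.2 ∈ M.goodSet ∧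
        spliceAll s p.1 p.2 ∈ M.goodSet := by
  have h1 : MeasurePreserving (fun p : (Kind A → Clock) × (Kind A → Clock) => spliceAll s p.1 p.2)
      (M.law.prod M.law) M.law := ⟨measurable_spliceAll s, map_spliceAll M.bound hs⟩
  refine ⟨h1, ?_⟩
  filter_upwards [(measurePreserving_fst (μ := M.law) (ν := M.law)).quasiMeasurePreserving.ae
      hM.ae_mem_goodSet, (measurePreserving_snd (μ := M.law) (ν := M.law)).quasiMeasurePreserving.ae
      hM.ae_mem_goodSet, h1.quasiMeasurePreserving.ae hM.ae_mem_goodSet] with p h2 h3 h4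
  exact ⟨h2, h3, h4⟩

lemma IsRegular.isFlow_finPath (hM : M.IsRegular) (B : Finset (Kind A)) :
    IsFlow M.law (M.finPath B) where
  measurable := hM.measurable_finPath B
  zero := finPath_of_nonpos le_rfl B
  splice s hs := by
    obtain ⟨h1, h2⟩ := hM.exists_splice hs
    refine ⟨_, h1, h2.mono fun p hp => ⟨fun u hu z => ?_, fun t ht z => ?_⟩⟩
    · exact finPath_spliceAll_of_le hp.1 hp.2.1 hp.2.2 hu B z
    · exact finPath_spliceAll_add hp.1 hp.2.1 hp.2.2 ht B z

lemma IsRegular.isFlow_path (hM : M.IsRegular) : IsFlow M.law M.path where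
  measurable := hM.measurable_path
  zero := hM.path_of_nonpos le_rfl
  splice s hs := by
    obtain ⟨h1, h2⟩ := hM.exists_splice hs
    refine ⟨_, h1, h2.mono fun p hp => ⟨fun u hu z => ?_, fun t ht z => ?_⟩⟩
    · exact hM.path_spliceAll_of_le hp.1 hp.2.1 hp.2.2 hu z
    · exact hM.path_spliceAll_add hp.1 hp.2.1 hp.2.2 ht z

/-- The expansion needs only a bounded measurable function. It is therefore used twice: for `F`, and
for its image under the finite generator, which need not be local. -/
lemma IsRegular.forward_finPath (hM : M.IsRegular) (B : Finset (Kind A)) {F : State → ℝ}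
    (hF : Measurable F) {C : ℝ} (hC : ∀ z, |F z| ≤ C) {t : ℝ} (ht : 0 ≤ t) (z : State) :
    ContinuousOn (fun u => ∫ ω, ∑ k ∈ B, M.drift k F (M.finPath B u z ω) ∂M.law) (Set.Ici 0) ∧
      (∫ ω, F (M.finPath B t z ω) ∂M.law) - F z =
        ∫ u in (0 : ℝ)..t, ∫ ω, ∑ k ∈ B, M.drift k F (M.finPath B u z ω) ∂M.law := by
  have hC0 : 0 ≤ C := (abs_nonneg _).trans (hC z)
  obtain ⟨K, hK⟩ := hM.exists_small_time B hF hC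
  have hH : Measurable fun z => ∑ k ∈ B, M.drift k F z :=
    Finset.measurable_fun_sum _ fun k _ => hM.measurable_drift k hF
  have hC' : ∀ z, |∑ k ∈ B, M.drift k F z| ≤ ∑ k ∈ B, M.bound k * (2 * C) := fun z =>
    (Finset.abs_sum_le_sum_abs _ _).trans (Finset.sum_le_sum fun k _ => M.abs_drift_le k hC z)
  set C' := ∑ k ∈ B, (M.bound k : ℝ) * (2 * C) with hC'def
  have hC'0 : 0 ≤ C' := (abs_nonneg _).trans (hC' z)
  obtain ⟨K', hK'⟩ := hM.exists_small_time B hH hC'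
  set C'' := ∑ k ∈ B, (M.bound k : ℝ) * (2 * C') with hC''def
  have hC'' : ∀ z, |∑ k ∈ B, M.drift k (fun z => ∑ k ∈ B, M.drift k F z) z| ≤ C'' := fun z =>
    (Finset.abs_sum_le_sum_abs _ _).trans (Finset.sum_le_sum fun k _ => M.abs_drift_le k hC' z)
  have hC''0 : 0 ≤ C'' := (abs_nonneg _).trans (hC'' z)
  have hK'0 : 0 ≤ K' := by
    have := (abs_nonneg _).trans (hK' 1 zero_le_one z)
    linarith
  refine (hM.isFlow_finPath B).forward hF hH hC hC' hK (K' := C'' + K' + 2 * C')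
    (fun h hh z => ?_) ht z
  -- A linear bound is required for all `h`: for `h ≤ 1` it follows from the expansion, and for `h ≥
  -- 1` from boundedness, which accounts for the term `2 * C'`.
  rcases le_total h 1 with h1 | h1
  · have e1 := hK' h hh z
    have e2 : |h * ∑ k ∈ B, M.drift k (fun z => ∑ k ∈ B, M.drift k F z) z| ≤ h * C'' := by
      rw [abs_mul, abs_of_nonneg hh]
      exact mul_le_mul_of_nonneg_left (hC'' z) hh
    have e3 : K' * h ^ 2 ≤ K' * h := mul_le_mul_of_nonneg_left (by nlinarith) hK'0
    have e4 : 0 ≤ C' * h := by positivity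
    rw [abs_le] at e1 e2 ⊢
    constructor <;> nlinarith [e1.1, e1.2, e2.1, e2.2]
  · have e1 : |∫ ω, ∑ k ∈ B, M.drift k F (M.finPath B h z ω) ∂M.law| ≤ C' :=
      abs_integral_le_of_abs_le fun ω => hC' _
    refine (abs_sub _ _).trans ?_
    have e2 := hC' z
    have e3 : 0 ≤ (C'' + K') * h := by positivity
    nlinarith

end Dynamics

end TaggedExclusion

/-! ### The generator on local functions, and the limit of infinitely many clocks. -/

namespace TaggedExclusion

/-! ### Local functions -/

instance : DiscreteMeasurableSpace Site := ⟨fun _ => trivial⟩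

/-- A function on a measurable set which depends on finitely many coordinates is measurable. -/
lemma measurableSet_inter_preimage {β : Type*} {D : Set State} (hD : MeasurableSet D)
    {f : State → β} {s : Finset ℤ}
    (hf : ∀ z ∈ D, ∀ z' ∈ D, (∀ j ∈ s, AgreeAt j z z') → f z = f z') (B : Set β) :
    MeasurableSet (D ∩ f ⁻¹' B) := by
  -- Restriction to finitely many coordinates takes values in a countable discrete space, where
  -- every set is measurable.
  let r : State → s → Site × Site := fun z j => (z.1 j, z.2 j)
  have hr : Measurable r := measurable_pi_lambda _ fun j =>
    ((measurable_pi_apply (j : ℤ)).comp measurable_fst).prodMk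
      ((measurable_pi_apply (j : ℤ)).comp measurable_snd)
  have : D ∩ f ⁻¹' B = D ∩ r ⁻¹' (r '' (D ∩ f ⁻¹' B)) := by
    ext z
    constructor
    · exact fun h => ⟨h.1, z, h, rfl⟩
    · rintro ⟨hz, z', ⟨hz', hB⟩, hzz'⟩
      refine ⟨hz, ?_⟩
      rw [Set.mem_preimage, hf z hz z' hz' fun j hj => ?_]
      · exact hB
      · have := congrFun hzz' ⟨j, hj⟩
        exact ⟨(Prod.ext_iff.1 this).1.symm, (Prod.ext_iff.1 this).2.symm⟩
  rw [this]
  exact hD.inter (hr (Set.to_countable _).measurableSet)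

lemma BddLocalPair.measurable {F : State → ℝ} (hF : BddLocalPair F) : Measurable F := by
  obtain ⟨⟨s, hs⟩, -⟩ := hF
  intro B _
  have := measurableSet_inter_preimage MeasurableSet.univ (s := s) (f := F)
    (fun z _ z' _ h => hs z z' h) B
  rwa [Set.univ_inter] at this

lemma ConvTo.eventually_eq {F : State → ℝ} (hF : BddLocalPair F) {x : ℕ → State} {z : State}
    (h : ConvTo x z) : ∀ᶠ n in atTop, F (x n) = F z := by
  obtain ⟨⟨s, hs⟩, -⟩ := hF
  filter_upwards [h.eventually_forall s.finite_toSet] with n hn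
  exact hs _ _ fun j hj => hn j hj

lemma IsLocalSystem.convTo {A : Type} {G : Set State} {w : ℤ} {op : Kind A → ℝ → State → State}
    (hop : IsLocalSystem G w op) (k : Kind A) (u : ℝ) {x : ℕ → State} {z : State}
    (hx : ∀ n, x n ∈ G) (hz : z ∈ G) (h : ConvTo x z) :
    ConvTo (fun n => op k u (x n)) (op k u z) := by
  rcases k with ⟨i, a⟩ | y
  · intro j
    by_cases hj : i - w ≤ j ∧ j ≤ i + w
    · filter_upwards [h.eventually_forall (Set.finite_Icc (i - w) (i + w))] with n hn
      exact hop.inside i a u _ (hx n) z hz (fun l hl hl' => hn l ⟨hl, hl'⟩) j hj.1 hj.2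
    · filter_upwards [h j] with n hn
      exact ((hop.outside i a u _ (hx n) j (by omega)).trans hn).trans
        (hop.outside i a u z hz j (by omega)).symm
  · exact hop.tag y u x z hx hz h

namespace Dynamics

variable {A : Type} {M : Dynamics A}

lemma markLaw_real {r b : ℝ} (hr : 0 ≤ r) (hb : 0 < b) (hrb : r ≤ b) :
    markLaw.real {u | |u| * b < r} = r / b := by
  have h1 : markLaw {u | |u| * b < r} = volume (Set.Ico 0 (r / b)) := by
    rw [markLaw, Measure.restrict_apply (measurableSet_lt (by fun_prop) measurable_const)]
    congr 1
    ext u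
    simp only [Set.mem_inter_iff, Set.mem_ofPred_eq, Set.mem_Icc, Set.mem_Ico]
    constructor
    · rintro ⟨h1, h2, h3⟩
      rw [abs_of_nonneg h2] at h1
      exact ⟨h2, (lt_div_iff₀ hb).2 h1⟩
    · rintro ⟨h1, h2⟩
      refine ⟨by rw [abs_of_nonneg h1]; exact (lt_div_iff₀ hb).1 h2, h1, h2.le.trans ?_⟩
      exact (div_le_one hb).2 hrb
  rw [measureReal_def, h1, Real.volume_Ico, sub_zero, ENNReal.toReal_ofReal (by positivity)]

variable [Fintype A]

/-- Thinning: rings arrive at the rate `bound`, and a uniform mark accepts a fraction `rate / bound`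
of them. -/
lemma IsRegular.drift_eq (hM : M.IsRegular) (k : Kind A) (F : State → ℝ) (z : State) :
    M.drift k F z = M.rate k z * (F (M.move k z) - F z) := by
  have hb : (0 : ℝ) < M.bound k := (M.bound k).2
  have h1 : ∀ u, F (M.op k u z) - F z =
      {u | |u| * M.bound k < M.rate k z}.indicator 1 u * (F (M.move k z) - F z) := by
    intro u
    by_cases hu : |u| * M.bound k < M.rate k z
    · rw [op, if_pos hu, Set.indicator_of_mem (show u ∈ {u : ℝ | |u| * M.bound k < M.rate k z} from hu), Pi.one_apply, one_mul]
    · rw [op, if_neg hu, Set.indicator_of_notMem (show u ∉ {u : ℝ | |u| * M.bound k < M.rate k z} from hu), zero_mul, sub_self]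
  rw [drift]
  simp only [h1]
  rw [integral_mul_const, integral_indicator_one (measurableSet_lt (by fun_prop) measurable_const),
    markLaw_real (hM.rate_nonneg k z) hb (hM.rate_le k z), ← mul_assoc,
    mul_div_cancel₀ _ hb.ne']

variable (M) in
/-- The generator. -/
noncomputable def generator (F : State → ℝ) (z : State) : ℝ := ∑' k, M.drift k F z

/-- The contributions of the kinds to the generator on a local function are dominated by a summable
family. -/
lemma IsRegular.exists_dominated (hM : M.IsRegular) {F : State → ℝ} (hF : BddLocalPair F) :
    ∃ β : Kind A → ℝ, Summable β ∧ ∀ k z, |M.drift k F z| ≤ β k := by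
  classical
  have hFm := hF.measurable
  obtain ⟨⟨s, hs⟩, C, hC⟩ := hF
  let near : Finset ℤ := s.biUnion fun j => Finset.Icc (j - M.width) (j + M.width)
  have hfar : ∀ i a z, i ∉ near → M.drift (Sum.inl (i, a)) F z = 0 := by
    intro i a z hi
    have : ∀ u, F (M.op (Sum.inl (i, a)) u z) - F z = 0 := fun u => by
      rw [sub_eq_zero]
      refine hs _ _ fun j hj => hM.outside i a u z j ?_
      by_contra hcon
      push Not at hcon
      exact hi (Finset.mem_biUnion.2 ⟨j, hj, Finset.mem_Icc.2 ⟨by omega, by omega⟩⟩)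
    simp [drift, this]
  let β : Kind A → ℝ := Sum.elim
    (fun p => if p.1 ∈ near then M.bound (Sum.inl p) * (2 * C) else 0)
    (fun y => M.bound (Sum.inr y) * (2 * C))
  refine ⟨β, ?_, ?_⟩
  · refine Summable.sum (f := β) ?_ ?_
    · refine summable_of_hasFiniteSupport
        (((near ×ˢ (Finset.univ : Finset A)).finite_toSet).subset fun p hp => ?_)
      have hp' : p.1 ∈ near := by
        by_contra hcon
        exact hp (if_neg hcon)
      simp [hp']
    · exact hM.summable.mul_right _
  · rintro (⟨i, a⟩ | y) z
    · by_cases hi : i ∈ near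
      · change _ ≤ if i ∈ near then _ else _
        rw [if_pos hi]; exact abs_drift_le M _ hC z
      · change _ ≤ if i ∈ near then _ else _
        rw [if_neg hi, hfar i a z hi, abs_zero]
    · exact abs_drift_le M _ hC z

lemma tendsto_sum_kinds {β : Kind A → ℝ} (hβ : Summable β) {f : ℕ → Kind A → ℝ} {g : Kind A → ℝ}
    (hf : ∀ n k, |f n k| ≤ β k) (hfg : ∀ k, Tendsto (fun n => f n k) atTop (𝓝 (g k))) :
    Tendsto (fun n => ∑ k ∈ kinds A n, f n k) atTop (𝓝 (∑' k, g k)) := by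
  classical
  have hsum : ∀ n, ∑ k ∈ kinds A n, f n k = ∑' k, (kinds A n : Set (Kind A)).indicator (f n) k :=
    fun n => sum_eq_tsum_indicator _ _
  simp only [hsum]
  refine tendsto_tsum_of_dominated_convergence hβ (fun k => ?_) (Eventually.of_forall fun n k => ?_)
  · refine (hfg k).congr' ?_
    filter_upwards [eventually_mem_kinds k] with n hn
    rw [Set.indicator_of_mem (Finset.mem_coe.2 hn)]
  · rw [Real.norm_eq_abs, Set.indicator_apply]
    split_ifs
    · exact hf n k
    · rw [abs_zero]; exact (abs_nonneg _).trans (hf n k)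

lemma IsRegular.measurable_generator (hM : M.IsRegular) {F : State → ℝ} (hF : BddLocalPair F) :
    Measurable (M.generator F) := by
  obtain ⟨β, hβ, hle⟩ := hM.exists_dominated hF
  refine measurable_of_tendsto_metrizable
    (fun n => Finset.measurable_fun_sum (kinds A n) fun k _ => hM.measurable_drift k hF.measurable)
    (tendsto_pi_nhds.2 fun z => ?_)
  exact tendsto_sum_kinds hβ (fun _ k => hle k z) fun k => tendsto_const_nhds

lemma IsRegular.exists_generator_le (hM : M.IsRegular) {F : State → ℝ} (hF : BddLocalPair F) :
    ∃ C, ∀ z, |M.generator F z| ≤ C := by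
  obtain ⟨β, hβ, hle⟩ := hM.exists_dominated hF
  exact ⟨∑' k, β k, fun z => tsum_of_norm_bounded (f := fun k => M.drift k F z) hβ.hasSum fun k => hle k z⟩

lemma IsRegular.hasSum_generator (hM : M.IsRegular) {F : State → ℝ} (hF : BddLocalPair F)
    (z : State) :
    HasSum (fun k => M.rate k z * (F (M.move k z) - F z)) (M.generator F z) := by
  obtain ⟨β, hβ, hle⟩ := hM.exists_dominated hF
  simp only [← hM.drift_eq]
  exact (Summable.of_norm_bounded hβ fun k => hle k z).hasSum

/-- A drift need not be local, since the attempts of the tagged particle may depend on all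
coordinates. Its continuity on `dom` comes from that of the operations, by dominated convergence in
the mark. -/
lemma IsRegular.tendsto_drift (hM : M.IsRegular) (k : Kind A) {F : State → ℝ}
    (hF : BddLocalPair F) {x : ℕ → State} {z : State} (hx : ∀ n, x n ∈ M.dom) (hz : z ∈ M.dom)
    (h : ConvTo x z) : Tendsto (fun n => M.drift k F (x n)) atTop (𝓝 (M.drift k F z)) := by
  have hFm := hF.measurable
  obtain ⟨C, hC⟩ := hF.2
  refine Tendsto.const_mul _ (tendsto_integral_of_dominated_convergence (fun _ => 2 * C)
    (fun n => (hM.measurable_comp_op k hFm (x n)).aestronglyMeasurable) (integrable_const _)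
    (fun n => Eventually.of_forall fun u => ?_) (Eventually.of_forall fun u => ?_))
  · exact (abs_sub _ _).trans (by linarith [hC (M.op k u (x n)), hC (x n)])
  · refine tendsto_const_nhds.congr' ?_
    filter_upwards [h.eventually_eq hF, (hM.isLocal.convTo k u hx hz h).eventually_eq hF]
      with n h1 h2
    rw [h1, h2]

/-- The forward equation. -/
theorem IsRegular.forward_path (hM : M.IsRegular) {F : State → ℝ} (hF : BddLocalPair F) {z : State}
    (hz : z ∈ M.dom) {t : ℝ} (ht : 0 ≤ t) :
    (∫ ω, F (M.path t z ω) ∂M.law) - F z =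
      ∫ u in (0 : ℝ)..t, ∫ ω, M.generator F (M.path u z ω) ∂M.law := by
  have hFm := hF.measurable
  obtain ⟨C, hC⟩ := hF.2
  obtain ⟨β, hβ, hle⟩ := hM.exists_dominated hF
  have hconv : ∀ u, ∀ᵐ ω ∂M.law, ConvTo (fun n => M.finPath (kinds A n) u z ω) (M.path u z ω) :=
    fun u => hM.ae_mem_goodSet.mono fun ω hω => hM.convTo_path hω hz u
  have hmeas : ∀ n u, Measurable fun ω => M.finPath (kinds A n) u z ω := fun n u =>
    (hM.measurable_finPath _ u).comp measurable_prodMk_left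
  have hβ0 : ∀ k, 0 ≤ β k := fun k => (abs_nonneg _).trans (hle k z)
  have hsum : ∀ n y, |∑ k ∈ kinds A n, M.drift k F y| ≤ ∑' k, β k := fun n y =>
    (Finset.abs_sum_le_sum_abs _ _).trans ((Finset.sum_le_sum fun k _ => hle k y).trans
      (hβ.sum_le_tsum _ fun k _ => hβ0 k))
  have hsm : ∀ n, Measurable fun y => ∑ k ∈ kinds A n, M.drift k F y := fun n =>
    Finset.measurable_fun_sum _ fun k _ => hM.measurable_drift k hFm
  have h1 : Tendsto (fun n => (∫ ω, F (M.finPath (kinds A n) t z ω) ∂M.law) - F z) atTop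
      (𝓝 ((∫ ω, F (M.path t z ω) ∂M.law) - F z)) := by
    refine Tendsto.sub_const (tendsto_integral_of_dominated_convergence (fun _ => C)
      (fun n => (hFm.comp (hmeas n t)).aestronglyMeasurable) (integrable_const _)
      (fun n => Eventually.of_forall fun ω => hC _) ?_) _
    filter_upwards [hconv t] with ω hω
    refine tendsto_const_nhds.congr' ?_
    filter_upwards [hω.eventually_eq hF] with n hn
    exact hn.symm
  have h2 : ∀ u, Tendsto (fun n => ∫ ω, ∑ k ∈ kinds A n,
      M.drift k F (M.finPath (kinds A n) u z ω) ∂M.law) atTop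
      (𝓝 (∫ ω, M.generator F (M.path u z ω) ∂M.law)) := by
    intro u
    refine tendsto_integral_of_dominated_convergence (fun _ => ∑' k, β k)
      (fun n => ((hsm n).comp (hmeas n u)).aestronglyMeasurable) (integrable_const _)
      (fun n => Eventually.of_forall fun ω => hsum n _) ?_
    filter_upwards [hconv u] with ω hω
    exact tendsto_sum_kinds hβ (fun n k => hle k _) fun k =>
      hM.tendsto_drift k hF (fun n => hM.finPath_mem _ u hz ω) (hM.path_mem u hz ω) hω
  have h3 : Tendsto (fun n => ∫ u in (0 : ℝ)..t, ∫ ω, ∑ k ∈ kinds A n,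
      M.drift k F (M.finPath (kinds A n) u z ω) ∂M.law) atTop
      (𝓝 (∫ u in (0 : ℝ)..t, ∫ ω, M.generator F (M.path u z ω) ∂M.law)) := by
    refine intervalIntegral.tendsto_integral_filter_of_dominated_convergence (fun _ => ∑' k, β k)
      (Eventually.of_forall fun n => ?_) (Eventually.of_forall fun n =>
        Eventually.of_forall fun u _ => abs_integral_le_of_abs_le fun ω => hsum n _)
      intervalIntegrable_const (Eventually.of_forall fun u _ => h2 u)
    refine (((hM.forward_finPath (kinds A n) hFm hC ht z).1).mono ?_).aestronglyMeasurable
      measurableSet_uIoc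
    rw [Set.uIoc_of_le ht]
    exact fun x hx => hx.1.le
  refine tendsto_nhds_unique h1 (h3.congr fun n => ?_)
  exact ((hM.forward_finPath (kinds A n) hFm hC ht z).2).symm

end Dynamics

end TaggedExclusion

/-! ### Measurability in time, adaptedness, and assembly of the Markov process. -/

namespace TaggedExclusion

/-! ### Measurability along right-continuous paths -/

section rightContinuous

variable {S : Type} [MeasurableSpace S] {Z : ℝ → S → State} {T : ℝ}

lemma tendsto_floor_add_one_div (t : ℝ) :
    Tendsto (fun n : ℕ => ((⌊t * (n + 1)⌋ : ℝ) + 1) / ((n : ℝ) + 1)) atTop (𝓝[≥] t) := by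
  have h0 : ∀ n : ℕ, (0 : ℝ) < n + 1 := fun n => by positivity
  have hle : ∀ n : ℕ, t ≤ ((⌊t * (n + 1)⌋ : ℝ) + 1) / ((n : ℝ) + 1) := fun n => by
    rw [le_div_iff₀ (h0 n)]; exact (Int.lt_floor_add_one _).le
  refine tendsto_nhdsWithin_iff.2 ⟨?_, Eventually.of_forall hle⟩
  have hup : ∀ n : ℕ, ((⌊t * (n + 1)⌋ : ℝ) + 1) / ((n : ℝ) + 1) ≤ t + 1 / ((n : ℝ) + 1) :=
    fun n => by
      rw [div_le_iff₀ (h0 n), add_mul, div_mul_cancel₀ _ (h0 n).ne']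
      linarith [Int.floor_le (t * ((n : ℝ) + 1))]
  have hlim : Tendsto (fun n : ℕ => t + 1 / ((n : ℝ) + 1)) atTop (𝓝 t) := by
    simpa using (tendsto_one_div_add_atTop_nhds_zero_nat (𝕜 := ℝ)).const_add t
  exact tendsto_of_tendsto_of_tendsto_of_le_of_le tendsto_const_nhds hlim hle hup

/-- A right-continuous process is jointly measurable. -/
lemma measurable_min_of_right (hZ : ∀ t ≤ T, Measurable (Z t))
    (hr : ∀ t x j, ∀ᶠ s in 𝓝[≥] t, AgreeAt j (Z s x) (Z t x)) :
    Measurable fun p : ℝ × S => Z (min p.1 T) p.2 := by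
  -- The time is rounded up to a grid of mesh `1 / (n + 1)`, which approaches it from the right, and
  -- is cut off at `T`, so that only the process until `T` enters.
  let g : ℕ → ℝ × S → State := fun n p =>
    Z (min (((⌊p.1 * (n + 1)⌋ : ℝ) + 1) / ((n : ℝ) + 1)) T) p.2
  have hg : ∀ n, Measurable (g n) := by
    intro n
    refine measurable_of_cover (ι := ℤ) (fun m => {p | ⌊p.1 * (n + 1)⌋ = m}) (fun m => ?_)
      (fun p => ⟨_, rfl⟩)
      (fun m p => Z (min (((m : ℝ) + 1) / ((n : ℝ) + 1)) T) p.2) (fun m => ?_) ?_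
    · have : Measurable fun p : ℝ × S => ⌊p.1 * (n + 1)⌋ :=
        Int.measurable_floor.comp (measurable_fst.mul_const _)
      exact this (measurableSet_singleton m)
    · exact (hZ _ (min_le_right _ _)).comp measurable_snd
    · rintro m p hp
      change ⌊p.1 * (n + 1)⌋ = m at hp
      simp only [g, hp]
  have hconv : ∀ p : ℝ × S, ∀ j, ∀ᶠ n in atTop, AgreeAt j (g n p) (Z (min p.1 T) p.2) := by
    intro p j
    have h1 := tendsto_floor_add_one_div p.1
    have h2 : Tendsto (fun s => min s T) (𝓝[≥] p.1) (𝓝[≥] (min p.1 T)) := by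
      refine tendsto_nhdsWithin_iff.2 ⟨?_, ?_⟩
      · exact ((continuous_id.min continuous_const).tendsto p.1).mono_left nhdsWithin_le_nhds
      · filter_upwards [self_mem_nhdsWithin] with s hs
        exact min_le_min_right T hs
    exact (h2.comp h1).eventually (hr _ p.2 j)
  refine Measurable.prodMk (measurable_pi_lambda _ fun j => ?_)
    (measurable_pi_lambda _ fun j => ?_)
  · exact measurable_of_eventually_eq (fun n => (measurable_pi_apply j).comp (hg n).fst)
      fun p => (hconv p j).mono fun n hn => hn.1
  · exact measurable_of_eventually_eq (fun n => (measurable_pi_apply j).comp (hg n).snd)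
      fun p => (hconv p j).mono fun n hn => hn.2

lemma measurable_uncurry_of_right (hZ : ∀ t, Measurable (Z t))
    (hr : ∀ t x j, ∀ᶠ s in 𝓝[≥] t, AgreeAt j (Z s x) (Z t x)) :
    Measurable fun p : ℝ × S => Z p.1 p.2 := by
  refine measurable_of_eventually_eq
    (fun n : ℕ => measurable_min_of_right (T := n) (fun t _ => hZ t) hr) fun p => ?_
  obtain ⟨N, hN⟩ := exists_nat_ge p.1
  filter_upwards [eventually_ge_atTop N] with n hn
  rw [min_eq_left (hN.trans (Nat.cast_le.2 hn))]

/-- Only times up to `T` need be measurable. Applied with the σ-algebra of the filtration at `T`,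
this yields adaptedness of the compensator. -/
lemma measurable_integral_of_right (hT : 0 ≤ T) (hZ : ∀ t ≤ T, Measurable (Z t))
    (hr : ∀ t x j, ∀ᶠ s in 𝓝[≥] t, AgreeAt j (Z s x) (Z t x)) {H : State → ℝ}
    (hH : Measurable H) : Measurable fun x => ∫ u in (0 : ℝ)..T, H (Z u x) := by
  have h1 : Measurable fun p : S × ℝ => H (Z (min p.2 T) p.1) :=
    hH.comp ((measurable_min_of_right hZ hr).comp measurable_swap)
  have h2 : ∀ x, ∫ u in (0 : ℝ)..T, H (Z u x) = ∫ u in Set.Ioc 0 T, H (Z (min u T) x) := by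
    intro x
    rw [intervalIntegral.integral_of_le hT]
    refine setIntegral_congr_fun measurableSet_Ioc fun u hu => ?_
    simp only [min_eq_left hu.2]
  simp only [h2]
  exact (h1.stronglyMeasurable.integral_prod_right').measurable

end rightContinuous

/-! ### The process -/

namespace Dynamics

variable {A : Type} [Fintype A] {M : Dynamics A}

variable (M) in
/-- The transition kernels. -/
noncomputable def kernel (hM : M.IsRegular) (t : ℝ≥0) : Kernel State State where
  toFun := fun z => M.law.map fun ω => M.path t z ω
  measurable' := by
    refine Measure.measurable_of_measurable_coe _ fun B hB => ?_
    have hm : ∀ z, Measurable (M.path (t : ℝ) z) := fun z =>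
      (hM.measurable_path t).comp measurable_prodMk_left
    simp only [Measure.map_apply (hm _) hB]
    exact measurable_measure_prodMk_left (hM.measurable_path t hB)

instance (hM : M.IsRegular) (t : ℝ≥0) : IsMarkovKernel (M.kernel hM t) :=
  ⟨fun _ => Measure.isProbabilityMeasure_map
    ((hM.measurable_path t).comp measurable_prodMk_left).aemeasurable⟩

lemma IsRegular.isCadlag_path (hM : M.IsRegular) (z : State) (ω : Kind A → Clock) :
    IsCadlag (fun t : ℝ≥0 => (M.path t z ω).1) ∧ IsCadlag fun t : ℝ≥0 => (M.path t z ω).2 := by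
  have hge : ∀ t : ℝ≥0, Tendsto (fun s : ℝ≥0 => (s : ℝ)) (𝓝[≥] t) (𝓝[≥] (t : ℝ)) := fun t =>
    (NNReal.continuous_coe.tendsto t).inf (tendsto_principal_principal.2 fun s hs =>
      NNReal.coe_le_coe.2 hs)
  have hlt : ∀ t : ℝ≥0, Tendsto (fun s : ℝ≥0 => (s : ℝ)) (𝓝[<] t) (𝓝[<] (t : ℝ)) := fun t =>
    (NNReal.continuous_coe.tendsto t).inf (tendsto_principal_principal.2 fun s hs =>
      NNReal.coe_lt_coe.2 hs)
  constructor <;> intro j t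
  · obtain ⟨y, hy⟩ := hM.path_left t z ω j
    exact ⟨((hge t).eventually (hM.path_right t z ω j)).mono fun s hs => hs.1, y.1 j,
      ((hlt t).eventually hy).mono fun s hs => hs.1⟩
  · obtain ⟨y, hy⟩ := hM.path_left t z ω j
    exact ⟨((hge t).eventually (hM.path_right t z ω j)).mono fun s hs => hs.2, y.2 j,
      ((hlt t).eventually hy).mono fun s hs => hs.2⟩

theorem IsRegular.isProcess (hM : M.IsRegular) (π : Measure State) [IsProbabilityMeasure π]
    (hπ : ∀ᵐ z ∂π, z ∈ M.dom) :
    IsProcess (π.prod M.law) hM.isFlow_path.filtration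
      (fun (t : ℝ≥0) x => M.path t x.1 x.2) (M.kernel hM) M.generator π where
  adapted t := hM.isFlow_path.measurable_filtration t
  cadlag x := hM.isCadlag_path x.1 x.2
  initial := by
    have : (fun x : State × (Kind A → Clock) => M.path ((0 : ℝ≥0) : ℝ) x.1 x.2) = Prod.fst := by
      funext x
      exact hM.path_of_nonpos (by simp) _ _
    rw [this]
    exact measurePreserving_fst.map_eq
  markov s t B hB := hM.isFlow_path.condExp_preimage π s t hB
  martingale F hF := by
    obtain ⟨C, hC⟩ := hF.2
    obtain ⟨C', hC'⟩ := hM.exists_generator_le hF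
    have hH := hM.measurable_generator hF
    have hr : ∀ t (x : State × (Kind A → Clock)) j,
        ∀ᶠ s in 𝓝[≥] t, AgreeAt j (M.path s x.1 x.2) (M.path t x.1 x.2) := fun t x j =>
      hM.path_right t x.1 x.2 j
    have hmart := hM.isFlow_path.martingale π hπ (fun t _ z hz ω => hM.path_mem t hz ω)
      hF.measurable hC hH hC'
      (hH.comp (measurable_uncurry_of_right (fun t => hM.measurable_path t) hr))
      (fun t => by
        refine @measurable_integral_of_right _ (hM.isFlow_path.filtration t)
          (fun t x => M.path t x.1 x.2) t t.coe_nonneg (fun s hs => ?_) hr _ hH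
        rcases le_total 0 s with h | h
        · exact (hM.isFlow_path.measurable_filtration ⟨s, h⟩).mono
            (hM.isFlow_path.filtration.mono (show (⟨s, h⟩ : ℝ≥0) ≤ t from hs)) le_rfl
        · have e : (fun x : State × (Kind A → Clock) => M.path s x.1 x.2) =
              fun x => M.path ((0 : ℝ≥0) : ℝ) x.1 x.2 := by
            funext x
            rw [hM.path_of_nonpos h, hM.path_of_nonpos (by simp)]
          rw [e]
          exact (hM.isFlow_path.measurable_filtration 0).mono
            (hM.isFlow_path.filtration.mono zero_le) le_rfl)
      (fun z hz t ht => hM.forward_path hF hz ht)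
    convert hmart using 3 with t x
    congr 1
    refine intervalIntegral.integral_congr fun u hu => ?_
    rw [Set.uIcc_of_le t.coe_nonneg] at hu
    simp only [Real.coe_toNNReal u hu.1]

/-- A dynamics which preserves the order of the two configurations provides a monotone coupling. -/
theorem IsRegular.monotoneCoupling (hM : M.IsRegular)
    (hdom : M.dom = {z | AdmissiblePair z ∧ z.2 ≤ z.1})
    (hadm : ∀ k z, AdmissiblePair z → 0 < M.rate k z → AdmissiblePair (M.move k z))
    {G G' : (Conf → ℝ) → Conf → ℝ} (hmarg : HasMarginals M.generator G G') :
    MonotoneCoupling G G' := by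
  refine ⟨M.generator, M.kernel hM, ?_, hmarg, fun t => inferInstance, ?_⟩
  · obtain ⟨hden⟩ := nonempty_denumerable (Kind A)
    let e : ℕ ≃ Kind A := (Denumerable.eqv (Kind A)).symm
    refine ⟨fun n => M.rate (e n), fun n => M.move (e n), fun n => hM.measurable_rate _,
      fun n => hM.measurable_move _, fun n z => hM.rate_nonneg _ z, fun n z => hadm _ z,
      fun F hF => ⟨fun z _ => ?_, ?_⟩⟩
    · exact (Equiv.hasSum_iff e (f := fun k => M.rate k z * (F (M.move k z) - F z))).2
        (hM.hasSum_generator hF z)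
    · obtain ⟨C, hC⟩ := hM.exists_generator_le hF
      exact ⟨C, fun z _ => hC z⟩
  · intro π hπ hdomπ
    have hπ' : ∀ᵐ z ∂π, z ∈ M.dom := by rw [hdom]; exact hdomπ
    refine ⟨State × (Kind A → Clock), inferInstance, π.prod M.law, _, _, inferInstance,
      hM.isProcess π hπ', ?_⟩
    filter_upwards [(measurePreserving_fst (μ := π) (ν := M.law)).quasiMeasurePreserving.ae hπ']
      with x hx t
    have := hM.path_mem t hx x.2
    rw [hdom] at this
    exact this

end Dynamics

end TaggedExclusion

/-! ### Locality of the jumps and the coupling of jumps to the right. -/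

namespace TaggedExclusion

/-! ### Locality of the jumps -/

section congr

variable {X X' : Conf} (hX : Admissible X) (hX' : Admissible X') {i n : ℤ}
  (h : ∀ j, i - n ≤ j → j ≤ i + n → X j = X' j)
include hX hX' h

lemma lastLE_congr {x u : ℤ} (hx : X i = site x) (hu : x ≤ u) (hn : u - x < n) :
    lastLE X u = lastLE X' u := by
  obtain ⟨h1, h2, h3, h4⟩ := lastLE_spec hX hx hu
  symm
  refine lastLE_eq hX' ?_ ?_
  · rw [← h _ (by omega) (by omega)]; exact h1
  · rw [← h _ (by omega) (by omega)]; exact h2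

/-- A particle at the target would carry a label between `i` and `i + z`, so vacancy can be read off
inside the window. -/
lemma JumpAllowed.of_agree {z : ℤ} (hz : 0 < z) (hn : z ≤ n) (ha : JumpAllowed X i z) :
    JumpAllowed X' i z := by
  obtain ⟨x, hx, h1, h2, -⟩ := ha.exists_site hX
  have hx' : X' i = site x := by rw [← h i (by omega) (by omega), hx]
  refine jumpAllowed_of_site hx' (fun k hk => ?_) h2
  have h3 := hX'.le_of_le_site hx' hk.le (by omega)
  have h4 : i ≤ k := by
    by_contra! hlt
    have := hX'.lt_of_lt_of_site hk hlt
    rw [hk, hx', site_lt_site] at this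
    omega
  exact h1 k (by rw [h k (by omega) (by omega), hk])

lemma jumpAllowed_congr {z : ℤ} (hz : 0 < z) (hn : z ≤ n) :
    JumpAllowed X i z ↔ JumpAllowed X' i z :=
  ⟨JumpAllowed.of_agree hX hX' h hz hn,
    JumpAllowed.of_agree hX' hX (fun j hj hj' => (h j hj hj').symm) hz hn⟩

lemma jumpRight_congr {z : ℤ} (hz : 0 < z) (hn : z < n) (ha : JumpAllowed X i z) {j : ℤ}
    (hj : i - n ≤ j) (hj' : j ≤ i + n) : jumpRight X i z j = jumpRight X' i z j := by
  obtain ⟨x, hx, h1, h2, -⟩ := ha.exists_site hX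
  have hx' : X' i = site x := by rw [← h i (by omega) (by omega), hx]
  have hI : lastIndex X i z = lastIndex X' i z := by
    rw [lastIndex_eq hx, lastIndex_eq hx']
    exact lastLE_congr hX hX' h hx (by omega) (by omega)
  have hle : lastIndex X i z ≤ i + z := by
    rw [lastIndex_eq hx]
    have := (lastLE_spec hX hx (show x ≤ x + z - 1 by omega)).2.2.2
    omega
  simp only [jumpRight, ← hI, hx, hx']
  split_ifs
  · exact h j hj hj'
  · exact h _ (by omega) (by omega)
  · rfl

lemma jump_congr {z : ℤ} (hz : 0 ≤ z) (hn : z < n) (ha : z ≠ 0 → JumpAllowed X i z) {j : ℤ}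
    (hj : i - n ≤ j) (hj' : j ≤ i + n) : jump X i z j = jump X' i z j := by
  rcases hz.eq_or_lt with rfl | hz
  · simp only [jump, lt_irrefl, if_false]; exact h j hj hj'
  · rw [jump, if_pos hz, jump, if_pos hz]
    exact jumpRight_congr hX hX' h hz hn (ha hz.ne') hj hj'

end congr

lemma jump_zero (X : Conf) (i : ℤ) : jump X i 0 = X := by simp [jump]

lemma jump_of_pos (X : Conf) (i : ℤ) {z : ℤ} (hz : 0 < z) : jump X i z = jumpRight X i z :=
  if_pos hz

lemma jump_outside {X : Conf} (hX : Admissible X) {i z j : ℤ} (hz : 0 ≤ z)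
    (ha : z ≠ 0 → JumpAllowed X i z) (hj : j < i ∨ i + z < j) : jump X i z j = X j := by
  rcases hz.eq_or_lt with rfl | hz
  · rw [jump_zero]
  · rw [jump_of_pos X i hz]
    obtain ⟨x, hx, h1, -, -⟩ := (ha hz.ne').exists_site hX
    obtain ⟨I, -, hI, -, -, -, hl, hr, -, -⟩ := exists_jumpRight hX hz hx h1
    rcases hj with hj | hj
    · exact hl j hj
    · exact hr j (by omega)

lemma admissible_jump {X : Conf} (hX : Admissible X) {i z : ℤ} (hz : 0 ≤ z)
    (ha : z ≠ 0 → JumpAllowed X i z) : Admissible (jump X i z) := by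
  rcases hz.eq_or_lt with rfl | hz
  · rwa [jump_zero]
  · rw [jump_of_pos X i hz]; exact admissible_jumpRight hX hz (ha hz.ne')

lemma le_jump {X : Conf} (hX : Admissible X) {i z : ℤ} (hz : 0 ≤ z)
    (ha : z ≠ 0 → JumpAllowed X i z) : X ≤ jump X i z := by
  rcases hz.eq_or_lt with rfl | hz
  · rw [jump_zero]
  · rw [jump_of_pos X i hz]; exact le_jumpRight hX hz (ha hz.ne')

open Classical in
lemma follow_eq {X Y : Conf} {i x z : ℤ} (hx : X i = site x) :
    follow X Y i z =
      if (followSet X Y i z).Nonempty then sSup (followSet X Y i z) + 1 - x else 0 := by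
  by_cases h : (followSet X Y i z).Nonempty
  · have hc : (followSet X Y i z).Nonempty ∧ ∃ x, X i = site x := ⟨h, x, hx⟩
    have hch : hc.2.choose = x := site_inj.1 (hc.2.choose_spec.symm.trans hx)
    rw [follow, dif_pos hc, hch, if_pos h]
  · rw [follow_eq_zero h, if_neg h]

/-- Only counts at sites up to `Y_i + z` enter, and these lie within `z` of both `X_i` and `Y_i`
because `Y_i ≤ X_i`. The strict bound `z < n` leaves room for the label after the last one counted.
-/
lemma follow_congr {X X' Y Y' : Conf} (hX : Admissible X) (hX' : Admissible X')
    (hY : Admissible Y) (hY' : Admissible Y') (hle : Y ≤ X) {i n z : ℤ}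
    (h : ∀ j, i - n ≤ j → j ≤ i + n → X j = X' j) (h' : ∀ j, i - n ≤ j → j ≤ i + n → Y j = Y' j)
    (hz : 0 < z) (hn : z < n) : follow X Y i z = follow X' Y' i z := by
  have hXi := h i (by omega) (by omega)
  have hYi := h' i (by omega) (by omega)
  have hS : (∃ x, X i = site x) → followSet X Y i z = followSet X' Y' i z := by
    rintro ⟨x, hx⟩
    rcases site_cases (Y i) with hy | hy | ⟨y, hy⟩
    · simp [followSet, ← hXi, ← hYi, hy]
    · simp [followSet, ← hXi, ← hYi, hy]
    · have hyx : y ≤ x := by have := hle i; rwa [hx, hy, site_le_site] at this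
      ext u
      simp only [followSet, ← hXi, ← hYi, hx, hy, site_add_site, site_inj, Set.mem_ofPred_eq,
        site_le_site, exists_eq_left', excess]
      refine and_congr_right fun hu => and_congr_right fun hu' => ?_
      rw [lastLE_congr hX hX' h hx hu (by omega),
        lastLE_congr hX hX' h hx (u := y + z) (by omega) (by omega),
        lastLE_congr hY hY' h' hy (hyx.trans hu) (by omega),
        lastLE_congr hY hY' h' hy (u := y + z) (by omega) (by omega)]
  by_cases hx : ∃ x, X i = site x
  · obtain ⟨x, hx'⟩ := id hx
    rw [follow_eq hx', follow_eq (hXi.symm.trans hx'), hS hx]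
  · rw [follow, follow, dif_neg fun hc => hx hc.2, dif_neg fun hc => hx (hXi ▸ hc.2)]

/-! ### The coupled jumps to the right -/

/-- The ordered pairs of admissible configurations. -/
def orderedPairs : Set State := {s | AdmissiblePair s ∧ s.2 ≤ s.1}

open Classical in
/-- The rate of an allowed jump. -/
noncomputable def jumpRate (p : ℤ → ℤ → ℝ) (X : Conf) (i z : ℤ) : ℝ :=
  if JumpAllowed X i z then rateFrom p (X i) z else 0

open Classical in
/-- The rate at which the `i`-th particle of the upper configuration follows the lower one in a jump
by `z`. -/
noncomputable def followRate (p : ℤ → ℤ → ℝ) (R : ℤ) (s : State) (i z : ℤ) : ℝ :=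
  ∑ z' ∈ Finset.Icc 1 R, if follow s.1 s.2 i z' = z then jumpRate p s.2 i z' else 0

open Classical in
/-- The rate of a jump of the lower configuration together with the following jump of the upper one
(`b = true`), or of the upper configuration alone (`b = false`). -/
noncomputable def rightRate (p : ℤ → ℤ → ℝ) (R : ℤ) (b : Bool) (i z : ℤ) (s : State) : ℝ :=
  if AdmissiblePair s then
    if b then jumpRate p s.2 i z
    else jumpRate p s.1 i z - if s.2 ≤ s.1 then followRate p R s i z else 0
  else 0

open Classical in
/-- The coupled jumps. -/
noncomputable def rightMove (p : ℤ → ℤ → ℝ) (R : ℤ) (b : Bool) (i z : ℤ) (s : State) : State :=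
  if 0 < rightRate p R b i z s then
    if b then (if s.2 ≤ s.1 then jump s.1 i (follow s.1 s.2 i z) else s.1, jump s.2 i z)
    else (jump s.1 i z, s.2)
  else s

/-- A jump of a pair of configurations which acts near the label `i`. -/
structure IsLocalJump (w : ℤ) (B : ℝ) (i : ℤ) (r : State → ℝ) (m : State → State) : Prop where
  nonneg : ∀ s, 0 ≤ r s
  le : ∀ s, r s ≤ B
  zero : ∀ s, ¬ AdmissiblePair s → r s = 0
  admissible : ∀ s, AdmissiblePair s → 0 < r s → AdmissiblePair (m s)
  ordered : ∀ s ∈ orderedPairs, 0 < r s → (m s).2 ≤ (m s).1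
  idle : ∀ s, ¬ 0 < r s → m s = s
  outside : ∀ s j, (j < i - w ∨ i + w < j) → AgreeAt j (m s) s
  -- The order of the two configurations is not a local property and influences the coupled jumps,
  -- so locality holds only among ordered pairs and among unordered ones.
  inside : ∀ s s', AdmissiblePair s → AdmissiblePair s' → (s.2 ≤ s.1 ↔ s'.2 ≤ s'.1) →
    (∀ j, i - w ≤ j → j ≤ i + w → AgreeAt j s s') →
    r s = r s' ∧ ∀ j, i - w ≤ j → j ≤ i + w → AgreeAt j (m s) (m s')

lemma rateFrom_of_eq {p : ℤ → ℤ → ℝ} {s : Site} {x z : ℤ} (h : s = site x) :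
    rateFrom p s z = p x (x + z) := by rw [h]; rfl

lemma rateFrom_nonneg {p : ℤ → ℤ → ℝ} (hp : ∀ x y, 0 ≤ p x y) (s : Site) (z : ℤ) :
    0 ≤ rateFrom p s z := by
  rcases site_cases s with rfl | rfl | ⟨x, rfl⟩
  · exact le_rfl
  · exact le_rfl
  · exact hp _ _

lemma jumpRate_nonneg {p : ℤ → ℤ → ℝ} (hp : ∀ x y, 0 ≤ p x y) (X : Conf) (i z : ℤ) :
    0 ≤ jumpRate p X i z := by
  rw [jumpRate]
  split_ifs
  · exact rateFrom_nonneg hp _ _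
  · exact le_rfl

lemma jumpRate_le {p : ℤ → ℤ → ℝ} {B : ℝ} (hB0 : 0 ≤ B) (hB : ∀ x y, p x y ≤ B) (X : Conf)
    (i z : ℤ) : jumpRate p X i z ≤ B := by
  rw [jumpRate]
  split_ifs
  · rcases site_cases (X i) with h | h | ⟨x, h⟩
    · rw [h]; exact hB0
    · rw [h]; exact hB0
    · rw [h]; exact hB _ _
  · exact hB0

lemma jumpRate_of_not {p : ℤ → ℤ → ℝ} {X : Conf} {i z : ℤ} (h : ¬ JumpAllowed X i z) :
    jumpRate p X i z = 0 := if_neg h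

lemma jumpAllowed_of_jumpRate_ne {p : ℤ → ℤ → ℝ} {X : Conf} {i z : ℤ} (h : jumpRate p X i z ≠ 0) :
    JumpAllowed X i z := by
  by_contra hcon
  exact h (jumpRate_of_not hcon)

lemma jumpRate_congr (p : ℤ → ℤ → ℝ) {X X' : Conf} (hX : Admissible X) (hX' : Admissible X')
    {i n z : ℤ} (h : ∀ j, i - n ≤ j → j ≤ i + n → X j = X' j) (hz : 0 < z) (hn : z ≤ n) :
    jumpRate p X i z = jumpRate p X' i z := by
  classical
  simp only [jumpRate, jumpAllowed_congr hX hX' h hz hn, h i (by omega) (by omega)]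

section ordered

variable {p : ℤ → ℤ → ℝ} {R : ℤ} {s : State} (hs : s ∈ orderedPairs) {i z : ℤ}
include hs

lemma follow_spec_of_allowed (hz : 0 < z) (ha : JumpAllowed s.2 i z) :
    0 ≤ follow s.1 s.2 i z ∧ follow s.1 s.2 i z ≤ z ∧
      (follow s.1 s.2 i z ≠ 0 → JumpAllowed s.1 i (follow s.1 s.2 i z)) ∧
      jump s.2 i z ≤ jump s.1 i (follow s.1 s.2 i z) := by
  obtain ⟨h0, h1, h2⟩ := follow_properties hs.1.1 hs.1.2 hs.2 hz ha
  refine ⟨h0, ?_, fun h => (h1 h).1, h2⟩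
  by_cases h3 : follow s.1 s.2 i z = 0
  · omega
  · obtain ⟨h4, h5⟩ := h1 h3
    obtain ⟨x, hx, -⟩ := h4.exists_site hs.1.1
    obtain ⟨y, hy, -⟩ := ha.exists_site hs.1.2
    have h6 := hs.2 i
    rw [hx, hy, site_le_site] at h6
    rw [hx, hy, site_add_site, site_add_site, site_le_site] at h5
    omega

/-- The upper configuration jumps at least at the rate of the lower configuration. -/
lemma jumpRate_le_of_follow (hp : AttractiveRight p) {z' : ℤ} (hz : 0 < z) (hz' : 0 < z')
    (hf : follow s.1 s.2 i z' = z) (ha : JumpAllowed s.2 i z') :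
    jumpRate p s.2 i z' ≤ jumpRate p s.1 i z := by
  obtain ⟨-, h1, -⟩ := follow_properties hs.1.1 hs.1.2 hs.2 hz' ha
  rw [hf] at h1
  obtain ⟨h2, h3⟩ := h1 hz.ne'
  obtain ⟨x, hx, -, hxz, hx0⟩ := h2.exists_site hs.1.1
  obtain ⟨y, hy, -, hyz, hy0⟩ := ha.exists_site hs.1.2
  have h6 := hs.2 i
  rw [hx, hy, site_le_site] at h6
  rw [hx, hy, site_add_site, site_add_site, site_le_site] at h3
  rw [jumpRate, if_pos ha, jumpRate, if_pos h2, rateFrom_of_eq hx, rateFrom_of_eq hy]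
  -- Since `y ≤ x < x + z ≤ y + z'`, the start is moved right and then the target left; neither
  -- decreases the rate.
  exact (hp.mono_left y x (y + z') hy0 hx0 hyz h6 (by omega)).trans
    (hp.anti_right x (x + z) (y + z') hx0 hxz hyz (by omega) h3)

/-- By injectivity at most one allowed jump of the lower configuration is followed by the jump `z`,
so the sum has at most one nonzero term and `jumpRate_le_of_follow` bounds it. -/
lemma followRate_le (hp : AttractiveRight p) (hz : 0 < z) :
    followRate p R s i z ≤ jumpRate p s.1 i z := by
  classical
  by_cases h : ∃ z' ∈ Finset.Icc 1 R, follow s.1 s.2 i z' = z ∧ JumpAllowed s.2 i z'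
  · obtain ⟨z', hz', hf, ha⟩ := h
    rw [followRate, Finset.sum_eq_single_of_mem z' hz', if_pos hf]
    · exact jumpRate_le_of_follow hs hp hz (by have := (Finset.mem_Icc.1 hz').1; omega) hf ha
    · intro z'' hz'' hne
      split_ifs with hf'
      · refine jumpRate_of_not fun ha' => ?_
        rcases lt_or_gt_of_ne hne with hlt | hlt
        · have := follow_injective hs.1.1 hs.1.2 hs.2 ha' hlt (hf'.trans hf.symm)
          omega
        · have := follow_injective hs.1.1 hs.1.2 hs.2 ha hlt (hf.trans hf'.symm)
          omega
      · rfl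
  · push Not at h
    rw [followRate, Finset.sum_eq_zero]
    · exact jumpRate_nonneg hp.nonneg _ _ _
    · intro z' hz'
      split_ifs with hf
      · exact jumpRate_of_not (h z' hz' hf)
      · rfl

end ordered

lemma followRate_nonneg {p : ℤ → ℤ → ℝ} (hp : ∀ x y, 0 ≤ p x y) (R : ℤ) (s : State) (i z : ℤ) :
    0 ≤ followRate p R s i z := by
  refine Finset.sum_nonneg fun z' _ => ?_
  split_ifs
  · exact jumpRate_nonneg hp _ _ _
  · exact le_rfl

lemma followRate_congr (p : ℤ → ℤ → ℝ) {R : ℤ} {s s' : State} (hs : s ∈ orderedPairs)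
    (hs' : AdmissiblePair s') {i n z : ℤ} (h : ∀ j, i - n ≤ j → j ≤ i + n → AgreeAt j s s')
    (hn : R < n) : followRate p R s i z = followRate p R s' i z := by
  refine Finset.sum_congr rfl fun z' hz' => ?_
  rw [Finset.mem_Icc] at hz'
  rw [follow_congr hs.1.1 hs'.1 hs.1.2 hs'.2 hs.2 (fun j hj hj' => (h j hj hj').1)
    (fun j hj hj' => (h j hj hj').2) (by omega) (by omega),
    jumpRate_congr p hs.1.2 hs'.2 (fun j hj hj' => (h j hj hj').2) (by omega) (by omega)]

/-- The width is `R + 1`, not `R`, because the excess at the target is determined with the label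
after the last particle counted. Order is preserved in a joint jump by the choice of `follow`, and
in a jump of the upper configuration alone because that jump raises it. -/
lemma isLocalJump_right {p : ℤ → ℤ → ℝ} (hp : AttractiveRight p) {B : ℝ} (hB0 : 0 ≤ B)
    (hB : ∀ x y, p x y ≤ B) {R : ℤ} (b : Bool) (i : ℤ) {z : ℤ} (hz : 0 < z) (hzR : z ≤ R) :
    IsLocalJump (R + 1) B i (rightRate p R b i z) (rightMove p R b i z) := by
  classical
  have hadm : ∀ s, 0 < rightRate p R b i z s → AdmissiblePair s := fun s h => by
    by_contra hcon
    rw [rightRate, if_neg hcon] at h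
    exact lt_irrefl _ h
  have htrue : ∀ s, 0 < rightRate p R true i z s → JumpAllowed s.2 i z := fun s h => by
    refine jumpAllowed_of_jumpRate_ne (p := p) fun h0 => ?_
    simp only [rightRate, h0, if_true, ite_self, lt_irrefl] at h
  have hfalse : ∀ s, 0 < rightRate p R false i z s → JumpAllowed s.1 i z := fun s h => by
    refine jumpAllowed_of_jumpRate_ne (p := p) fun h0 => ?_
    have h1 := followRate_nonneg hp.nonneg R s i z
    simp only [rightRate, h0, Bool.false_eq_true, if_false] at h
    split_ifs at h <;> linarith
  refine ⟨fun s => ?_, fun s => ?_, fun s hs => if_neg hs, fun s hs h => ?_, fun s hs h => ?_,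
    fun s h => if_neg h, fun s j hj => ?_, fun s s' hs hs' hord hag => ?_⟩
  · rw [rightRate]
    split_ifs with h1 h2 h3
    · exact jumpRate_nonneg hp.nonneg _ _ _
    · exact sub_nonneg.2 (followRate_le ⟨h1, h3⟩ hp hz)
    · rw [sub_zero]; exact jumpRate_nonneg hp.nonneg _ _ _
    · exact le_rfl
  · have h1 := followRate_nonneg hp.nonneg R s i z
    have h2 := jumpRate_le hB0 hB s.1 i z
    rw [rightRate]
    split_ifs
    · exact jumpRate_le hB0 hB s.2 i z
    · linarith
    · linarith
    · exact hB0
  · rw [rightMove, if_pos h]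
    cases b
    · exact ⟨admissible_jump hs.1 hz.le fun _ => hfalse s h, hs.2⟩
    · refine ⟨?_, admissible_jump hs.2 hz.le fun _ => htrue s h⟩
      simp only [if_true]
      split_ifs with h1
      · obtain ⟨h2, -, h3, -⟩ := follow_spec_of_allowed (s := s) ⟨hs, h1⟩ hz (htrue s h)
        exact admissible_jump hs.1 h2 h3
      · exact hs.1
  · rw [rightMove, if_pos h]
    cases b
    · exact hs.2.trans (le_jump hs.1.1 hz.le fun _ => hfalse s h)
    · simp only [if_true, if_pos hs.2]
      exact (follow_spec_of_allowed hs hz (htrue s h)).2.2.2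
  · rw [rightMove]
    split_ifs with h hb h1
    · subst hb
      obtain ⟨h2, h3, h4, -⟩ := follow_spec_of_allowed (s := s) ⟨hadm s h, h1⟩ hz (htrue s h)
      exact ⟨jump_outside (hadm s h).1 h2 h4 (by omega),
        jump_outside (hadm s h).2 hz.le (fun _ => htrue s h) (by omega)⟩
    · subst hb
      exact ⟨rfl, jump_outside (hadm s h).2 hz.le (fun _ => htrue s h) (by omega)⟩
    · rw [Bool.not_eq_true] at hb
      subst hb
      exact ⟨jump_outside (hadm s h).1 hz.le (fun _ => hfalse s h) (by omega), rfl⟩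
    · exact AgreeAt.refl _ _
  · have hag1 : ∀ j, i - (R + 1) ≤ j → j ≤ i + (R + 1) → s.1 j = s'.1 j := fun j h1 h2 =>
      (hag j h1 h2).1
    have hag2 : ∀ j, i - (R + 1) ≤ j → j ≤ i + (R + 1) → s.2 j = s'.2 j := fun j h1 h2 =>
      (hag j h1 h2).2
    have hrate : rightRate p R b i z s = rightRate p R b i z s' := by
      rw [rightRate, if_pos hs, rightRate, if_pos hs', jumpRate_congr p hs.1 hs'.1 hag1 hz (by omega),
        jumpRate_congr p hs.2 hs'.2 hag2 hz (by omega)]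
      by_cases h1 : s.2 ≤ s.1
      · rw [if_pos h1, if_pos (hord.1 h1), followRate_congr p ⟨hs, h1⟩ hs' hag (by omega)]
      · rw [if_neg h1, if_neg fun h => h1 (hord.2 h)]
    refine ⟨hrate, fun j hj hj' => ?_⟩
    rw [rightMove, rightMove, ← hrate]
    by_cases h : 0 < rightRate p R b i z s
    swap
    · rw [if_neg h, if_neg h]; exact hag j hj hj'
    rw [if_pos h, if_pos h]
    cases b
    · exact ⟨jump_congr hs.1 hs'.1 hag1 hz.le (by omega) (fun _ => hfalse s h) hj hj', hag2 j hj hj'⟩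
    · refine ⟨?_, jump_congr hs.2 hs'.2 hag2 hz.le (by omega) (fun _ => htrue s h) hj hj'⟩
      simp only [if_true]
      by_cases h1 : s.2 ≤ s.1
      · rw [if_pos h1, if_pos (hord.1 h1),
          ← follow_congr hs.1 hs'.1 hs.2 hs'.2 h1 hag1 hag2 hz (by omega)]
        obtain ⟨h2, h3, h4, -⟩ := follow_spec_of_allowed (s := s) ⟨hs, h1⟩ hz (htrue s h)
        exact jump_congr hs.1 hs'.1 hag1 h2 (by omega) h4 hj hj'
      · rw [if_neg h1, if_neg fun h => h1 (hord.2 h)]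
        exact hag1 j hj hj'

/-- The upper configuration performs its own dynamics. -/
lemma sum_rightRate_fst {p : ℤ → ℤ → ℝ} (hp : AttractiveRight p) {R : ℤ} {s : State}
    (hs : AdmissiblePair s) (i : ℤ) (H : Conf → ℝ) :
    ∑ b : Bool, ∑ z ∈ Finset.Icc 1 R,
        rightRate p R b i z s * (H (rightMove p R b i z s).1 - H s.1) =
      ∑ z ∈ Finset.Icc 1 R, jumpRate p s.1 i z * (H (jump s.1 i z) - H s.1) := by
  classical
  obtain ⟨B, hB⟩ := hp.bounded
  have hB0 : 0 ≤ B := (hp.nonneg 0 0).trans (hB 0 0)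
  have hmove : ∀ b, ∀ z ∈ Finset.Icc 1 R,
      rightRate p R b i z s * (H (rightMove p R b i z s).1 - H s.1) =
        rightRate p R b i z s * (H (if b then (if s.2 ≤ s.1 then
          jump s.1 i (follow s.1 s.2 i z) else s.1) else jump s.1 i z) - H s.1) := by
    intro b z hz
    rw [Finset.mem_Icc] at hz
    rw [rightMove]
    by_cases h : 0 < rightRate p R b i z s
    · rw [if_pos h]; cases b <;> rfl
    · have h0 : rightRate p R b i z s = 0 := le_antisymm (not_lt.1 h)
        ((isLocalJump_right hp hB0 hB b i (by omega) hz.2).nonneg s)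
      rw [h0, zero_mul, zero_mul]
  rw [Fintype.sum_bool, Finset.sum_congr rfl (hmove true), Finset.sum_congr rfl (hmove false)]
  simp only [rightRate, if_pos hs, if_true, Bool.false_eq_true, if_false]
  by_cases hle : s.2 ≤ s.1
  swap
  · simp [hle]
  simp only [if_pos hle, sub_mul, Finset.sum_sub_distrib]
  -- The joint jumps are regrouped by the displacement of the upper particle, and cancel the rate
  -- subtracted from its solitary jumps. Displacement zero does not occur in the right-hand sum, but
  -- contributes nothing on the left either.
  have key : ∑ z ∈ Finset.Icc 1 R, jumpRate p s.2 i z *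
        (H (jump s.1 i (follow s.1 s.2 i z)) - H s.1) =
      ∑ z ∈ Finset.Icc 1 R, followRate p R s i z * (H (jump s.1 i z) - H s.1) := by
    simp only [followRate, Finset.sum_mul]
    rw [Finset.sum_comm]
    refine Finset.sum_congr rfl fun z hz => ?_
    rw [Finset.mem_Icc] at hz
    by_cases ha : JumpAllowed s.2 i z
    swap
    · simp [jumpRate_of_not ha]
    obtain ⟨h2, h3, -, -⟩ := follow_spec_of_allowed (s := s) ⟨hs, hle⟩ (by omega) ha
    rcases h2.eq_or_lt with h0 | h0
    · rw [← h0, jump_zero, sub_self, mul_zero]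
      symm
      refine Finset.sum_eq_zero fun z' hz' => ?_
      rw [Finset.mem_Icc] at hz'
      rw [if_neg (by omega), zero_mul]
    · rw [Finset.sum_eq_single_of_mem (follow s.1 s.2 i z) (Finset.mem_Icc.2 ⟨by omega, by omega⟩),
        if_pos rfl]
      intro z' _ hne
      rw [if_neg (Ne.symm hne), zero_mul]
  rw [key]
  simp only [mul_sub, Finset.sum_sub_distrib]
  ring

/-- The lower configuration performs its own dynamics. -/
lemma sum_rightRate_snd {p : ℤ → ℤ → ℝ} {R : ℤ} {s : State} (hs : AdmissiblePair s) (i : ℤ)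
    (hnn : ∀ x y, 0 ≤ p x y) (H : Conf → ℝ) :
    ∑ b : Bool, ∑ z ∈ Finset.Icc 1 R,
        rightRate p R b i z s * (H (rightMove p R b i z s).2 - H s.2) =
      ∑ z ∈ Finset.Icc 1 R, jumpRate p s.2 i z * (H (jump s.2 i z) - H s.2) := by
  classical
  have hfalse : ∀ z, (rightMove p R false i z s).2 = s.2 := fun z => by
    rw [rightMove]; split_ifs <;> simp_all
  have htrue : ∀ z, rightRate p R true i z s * (H (rightMove p R true i z s).2 - H s.2) =
      jumpRate p s.2 i z * (H (jump s.2 i z) - H s.2) := by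
    intro z
    have hr : rightRate p R true i z s = jumpRate p s.2 i z := by simp [rightRate, hs]
    rw [rightMove, hr]
    by_cases h : 0 < jumpRate p s.2 i z
    · rw [if_pos h]; rfl
    · rw [le_antisymm (not_lt.1 h) (jumpRate_nonneg hnn _ _ _), zero_mul, zero_mul]
  rw [Fintype.sum_bool]
  simp [htrue, hfalse]

end TaggedExclusion

/-! ### Reflection, and the jumps of the tagged particle. -/

namespace TaggedExclusion

/-! ### Reflection -/

lemma reflect_apply (X : Conf) (j : ℤ) : reflect X j = negSite (X (-j)) := rfl

@[simp] lemma reflect_reflect (X : Conf) : reflect (reflect X) = X := by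
  funext j; simp [reflect]

lemma negSite_add_site (s : Site) (z : ℤ) : negSite s + site z = negSite (s + site (-z)) := by
  rcases site_cases s with rfl | rfl | ⟨x, rfl⟩
  · simp
  · simp
  · rw [site_add_site, negSite_site, negSite_site, site_add_site, neg_add, neg_neg]

lemma Admissible.reflect {X : Conf} (hX : Admissible X) : Admissible (reflect X) := by
  refine ⟨fun i => ?_, fun i h => ?_⟩
  · have := hX.1 (-(i + 1))
    rw [show -(i + 1) + 1 = -i by ring] at this
    rw [reflect_apply, reflect_apply]
    rcases this with h | ⟨h1, h2⟩ | ⟨h1, h2⟩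
    · exact Or.inl (negSite_lt_negSite.2 h)
    · exact Or.inr (Or.inr ⟨by rw [h2, negSite_bot], by rw [h1, negSite_bot]⟩)
    · exact Or.inr (Or.inl ⟨by rw [h2, negSite_top], by rw [h1, negSite_top]⟩)
  · exact hX.2 (-i) (negSite_inj.1 h)

lemma measurable_reflect : Measurable reflect :=
  measurable_pi_lambda _ fun j => (Measurable.of_discrete (f := negSite)).comp
    (measurable_pi_apply (-j))

lemma mem_range_reflect {X : Conf} {t : Site} : negSite t ∈ Set.range (reflect X) ↔ t ∈ Set.range X := by
  constructor
  · rintro ⟨k, hk⟩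
    exact ⟨-k, negSite_inj.1 hk⟩
  · rintro ⟨k, rfl⟩
    exact ⟨-k, by rw [reflect_apply, neg_neg]⟩

lemma jumpAllowed_reflect (X : Conf) (i z : ℤ) :
    JumpAllowed (reflect X) (-i) z ↔ JumpAllowed X i (-z) := by
  have h : reflect X (-i) + site z = negSite (X i + site (-z)) := by
    rw [reflect_apply, neg_neg, negSite_add_site]
  have h0 : negSite (X i + site (-z)) = site 0 ↔ X i + site (-z) = site 0 :=
    negSite_inj (t := site 0)
  rw [JumpAllowed, JumpAllowed, h, mem_range_reflect, ne_eq, ne_eq, h0]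

lemma reflect_jump (X : Conf) (i : ℤ) {z : ℤ} (hz : 0 < z) :
    reflect (jump (reflect X) (-i) z) = jump X i (-z) := by
  rw [jump_of_pos _ _ hz, jump, if_neg (by omega), if_pos (by omega), neg_neg]

/-- The rates of the jumps to the left, reflected. -/
def reflectRates (p : ℤ → ℤ → ℝ) (x y : ℤ) : ℝ := p (-y) (-x)

/-- Reflection exchanges start and target, hence the two monotonicity conditions. -/
lemma AttractiveRight.reflectRates {p : ℤ → ℤ → ℝ} (hp : AttractiveRight p) :
    AttractiveRight (reflectRates p) where
  nonneg _ _ := hp.nonneg _ _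
  eq_zero _ _ h := hp.eq_zero _ _ (by omega)
  finite_range := by
    obtain ⟨R, hR, h⟩ := hp.finite_range
    exact ⟨R, hR, fun x y hxy => h _ _ (by omega)⟩
  mono_left x x' y hx hx' hy h h' :=
    hp.anti_right (-y) (-x') (-x) (by omega) (by omega) (by omega) (by omega) (by omega)
  anti_right x y y' hx hy hy' h h' :=
    hp.mono_left (-y') (-y) (-x) (by omega) (by omega) (by omega) (by omega) (by omega)
  bounded := by
    obtain ⟨B, hB⟩ := hp.bounded
    exact ⟨B, fun x y => hB _ _⟩

lemma jumpRate_reflect (p : ℤ → ℤ → ℝ) (X : Conf) (i z : ℤ) :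
    jumpRate (reflectRates p) (reflect X) (-i) z = jumpRate (fun x y => p y x) X i (-z) := by
  classical
  simp only [jumpRate, jumpAllowed_reflect, reflect_apply, neg_neg]
  congr 1
  rcases site_cases (X i) with h | h | ⟨x, h⟩
  · rw [h]; rfl
  · rw [h]; rfl
  · rw [h, negSite_site, rateFrom_of_eq rfl, rateFrom_of_eq rfl, reflectRates, neg_neg, neg_add,
      neg_neg]

lemma jump_outside_abs {X : Conf} (hX : Admissible X) {i z j : ℤ} (ha : JumpAllowed X i z)
    (hj : j < i - |z| ∨ i + |z| < j) : jump X i z j = X j := by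
  rcases le_or_gt 0 z with hz | hz
  · rw [abs_of_nonneg hz] at hj
    exact jump_outside hX hz (fun _ => ha) (by omega)
  · rw [abs_of_neg hz] at hj
    have h1 := reflect_jump X i (z := -z) (by omega)
    rw [neg_neg] at h1
    rw [← h1, reflect_apply, jump_outside hX.reflect (by omega)
      (fun _ => (jumpAllowed_reflect X i (-z)).2 (by rwa [neg_neg])) (by omega), reflect_apply,
      neg_neg, negSite_negSite]

/-- The reflection of pairs, which exchanges the two configurations. -/
def flip (s : State) : State := (reflect s.2, reflect s.1)

@[simp] lemma flip_flip (s : State) : flip (flip s) = s := by simp [flip]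

lemma measurable_flip : Measurable flip :=
  (measurable_reflect.comp measurable_snd).prodMk (measurable_reflect.comp measurable_fst)

lemma AdmissiblePair.flip {s : State} (h : AdmissiblePair s) : AdmissiblePair (flip s) :=
  ⟨h.2.reflect, h.1.reflect⟩

lemma admissiblePair_flip {s : State} : AdmissiblePair (flip s) ↔ AdmissiblePair s :=
  ⟨fun h => flip_flip s ▸ h.flip, fun h => h.flip⟩

lemma reflect_le_reflect {X Y : Conf} : reflect X ≤ reflect Y ↔ Y ≤ X := by
  constructor
  · intro h j
    have := h (-j)
    rwa [reflect_apply, reflect_apply, neg_neg, negSite_le_negSite] at this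
  · exact fun h j => negSite_le_negSite.2 (h (-j))

lemma flip_le {s : State} : (flip s).2 ≤ (flip s).1 ↔ s.2 ≤ s.1 := reflect_le_reflect

lemma flip_mem_orderedPairs {s : State} (h : s ∈ orderedPairs) : flip s ∈ orderedPairs :=
  ⟨h.1.flip, flip_le.2 h.2⟩

lemma AgreeAt.flip {j : ℤ} {s s' : State} (h : AgreeAt j s s') :
    AgreeAt (-j) (flip s) (flip s') := by
  constructor
  · change reflect s.2 (-j) = reflect s'.2 (-j)
    rw [reflect_apply, reflect_apply, neg_neg, h.2]
  · change reflect s.1 (-j) = reflect s'.1 (-j)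
    rw [reflect_apply, reflect_apply, neg_neg, h.1]

lemma AgreeAt.of_flip {j : ℤ} {s s' : State} (h : AgreeAt (-j) s (TaggedExclusion.flip s')) :
    AgreeAt j (TaggedExclusion.flip s) s' := by
  have := h.flip
  rwa [neg_neg, flip_flip] at this

lemma ConvTo.flip {x : ℕ → State} {z : State} (h : ConvTo x z) :
    ConvTo (fun n => TaggedExclusion.flip (x n)) (TaggedExclusion.flip z) := fun j =>
  (h (-j)).mono fun n hn => by simpa using hn.flip

/-- Reflection reverses the order and the exchange of the configurations restores it. Thus jumps to
the left are coupled like jumps to the right, with the upper configuration in the leading role. -/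
lemma IsLocalJump.flip {w : ℤ} {B : ℝ} {i : ℤ} {r : State → ℝ} {m : State → State}
    (h : IsLocalJump w B (-i) r m) :
    IsLocalJump w B i (fun s => r (TaggedExclusion.flip s))
      (fun s => TaggedExclusion.flip (m (TaggedExclusion.flip s))) where
  nonneg _ := h.nonneg _
  le _ := h.le _
  zero _ hs := h.zero _ fun h' => hs (admissiblePair_flip.1 h')
  admissible s hs hr := (h.admissible _ hs.flip hr).flip
  ordered s hs hr := flip_le.2 (h.ordered _ (flip_mem_orderedPairs hs) hr)
  idle s hs := by rw [h.idle _ hs, flip_flip]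
  outside s j hj := (h.outside (TaggedExclusion.flip s) (-j) (by omega)).of_flip
  inside s s' hs hs' hord hag := by
    obtain ⟨h1, h2⟩ := h.inside (TaggedExclusion.flip s) (TaggedExclusion.flip s') hs.flip hs'.flip
      (by rw [flip_le, flip_le, hord]) fun j hj hj' => by
        simpa using (hag (-j) (by omega) (by omega)).flip
    refine ⟨h1, fun j hj hj' => ?_⟩
    simpa using (h2 (-j) (by omega) (by omega)).flip

/-! ### Measurability of the jumps -/

lemma measurableSet_admissible : MeasurableSet {X : Conf | Admissible X} := by
  have h1 : ∀ i : ℤ, MeasurableSet {X : Conf | (X i < X (i + 1) ∨ (X i = ⊥ ∧ X (i + 1) = ⊥) ∨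
      (X i = ⊤ ∧ X (i + 1) = ⊤)) ∧ X i ≠ site 0} := fun i => by
    have hm : Measurable fun X : Conf => (X i, X (i + 1)) :=
      (measurable_pi_apply i).prodMk (measurable_pi_apply (i + 1))
    have hs := (Set.to_countable {p : Site × Site | (p.1 < p.2 ∨ (p.1 = ⊥ ∧ p.2 = ⊥) ∨
        (p.1 = ⊤ ∧ p.2 = ⊤)) ∧ p.1 ≠ site 0}).measurableSet
    exact hm hs
  have : {X : Conf | Admissible X} = ⋂ i : ℤ, {X : Conf | (X i < X (i + 1) ∨
      (X i = ⊥ ∧ X (i + 1) = ⊥) ∨ (X i = ⊤ ∧ X (i + 1) = ⊤)) ∧ X i ≠ site 0} := by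
    ext X
    simp only [Set.mem_ofPred_eq, Set.mem_iInter, Admissible]
    exact forall_and.symm
  rw [this]
  exact MeasurableSet.iInter h1

lemma measurableSet_admissiblePair : MeasurableSet {s : State | AdmissiblePair s} :=
  (measurable_fst measurableSet_admissible).inter (measurable_snd measurableSet_admissible)

lemma measurableSet_orderedPairs : MeasurableSet orderedPairs := by
  refine measurableSet_admissiblePair.inter ?_
  have h1 : ∀ j : ℤ, MeasurableSet {s : State | s.2 j ≤ s.1 j} := fun j => by
    have hm : Measurable fun s : State => (s.1 j, s.2 j) :=
      ((measurable_pi_apply j).comp measurable_fst).prodMk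
        ((measurable_pi_apply j).comp measurable_snd)
    have hs := (Set.to_countable {p : Site × Site | p.2 ≤ p.1}).measurableSet
    exact hm hs
  have : {s : State | s.2 ≤ s.1} = ⋂ j : ℤ, {s : State | s.2 j ≤ s.1 j} := by
    ext s
    simp only [Set.mem_ofPred_eq, Set.mem_iInter]
    exact Iff.rfl
  change MeasurableSet {s : State | s.2 ≤ s.1}
  rw [this]
  exact MeasurableSet.iInter h1

/-- A function which is local on the ordered and on the other admissible pairs is measurable. -/
lemma measurable_of_pieces {β : Type*} [MeasurableSpace β] {f g : State → β} (hg : Measurable g)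
    (hfg : ∀ s, ¬ AdmissiblePair s → f s = g s) (t : Finset ℤ)
    (hf : ∀ s s', AdmissiblePair s → AdmissiblePair s' → (s.2 ≤ s.1 ↔ s'.2 ≤ s'.1) →
      (∀ j ∈ t, AgreeAt j s s') → f s = f s') : Measurable f := by
  intro B hB
  set D : Set State := {s | AdmissiblePair s} with hD
  have e : f ⁻¹' B = (orderedPairs ∩ f ⁻¹' B ∪ (D \ orderedPairs) ∩ f ⁻¹' B) ∪ (Dᶜ ∩ g ⁻¹' B) := by
    ext s
    by_cases h : AdmissiblePair s
    · by_cases h' : s ∈ orderedPairs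
      · simp [h', hD, h]
      · simp [h', hD, h]
    · have h' : s ∉ orderedPairs := fun h' => h h'.1
      simp [h', hD, h, hfg s h]
  rw [e]
  refine (MeasurableSet.union ?_ ?_).union (measurableSet_admissiblePair.compl.inter (hg hB))
  · exact measurableSet_inter_preimage measurableSet_orderedPairs (s := t)
      (fun s hs s' hs' h => hf s s' hs.1 hs'.1 (iff_of_true hs.2 hs'.2) h) B
  · exact measurableSet_inter_preimage
      (measurableSet_admissiblePair.diff measurableSet_orderedPairs) (s := t)
      (fun s hs s' hs' h => hf s s' hs.1 hs'.1
        (iff_of_false (fun h1 => hs.2 ⟨hs.1, h1⟩) fun h1 => hs'.2 ⟨hs'.1, h1⟩) h) B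

lemma IsLocalJump.measurable_rate {w : ℤ} {B : ℝ} {i : ℤ} {r : State → ℝ} {m : State → State}
    (h : IsLocalJump w B i r m) : Measurable r :=
  measurable_of_pieces measurable_const (fun s hs => h.zero s hs) (Finset.Icc (i - w) (i + w))
    fun s s' hs hs' hord hag => (h.inside s s' hs hs' hord
      fun j hj hj' => hag j (Finset.mem_Icc.2 ⟨hj, hj'⟩)).1

lemma IsLocalJump.measurable_move {w : ℤ} {B : ℝ} {i : ℤ} {r : State → ℝ} {m : State → State}
    (h : IsLocalJump w B i r m) : Measurable m := by
  have hfst : ∀ j : ℤ, Measurable fun s : State => s.1 j := fun j =>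
    (measurable_pi_apply j).comp measurable_fst
  have hsnd : ∀ j : ℤ, Measurable fun s : State => s.2 j := fun j =>
    (measurable_pi_apply j).comp measurable_snd
  have hidle : ∀ s, ¬ AdmissiblePair s → m s = s := fun s hs =>
    h.idle s (by rw [h.zero s hs]; exact lt_irrefl _)
  have key : ∀ j, Measurable fun s => ((m s).1 j, (m s).2 j) := by
    intro j
    by_cases hj : i - w ≤ j ∧ j ≤ i + w
    · refine measurable_of_pieces (g := fun s => (s.1 j, s.2 j)) ((hfst j).prodMk (hsnd j))
        (fun s hs => by simp only [hidle s hs]) (Finset.Icc (i - w) (i + w))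
        fun s s' hs hs' hord hag => ?_
      have := (h.inside s s' hs hs' hord
        fun j hj hj' => hag j (Finset.mem_Icc.2 ⟨hj, hj'⟩)).2 j hj.1 hj.2
      exact Prod.ext this.1 this.2
    · have e : (fun s => ((m s).1 j, (m s).2 j)) = fun s => (s.1 j, s.2 j) := by
        funext s
        have := h.outside s j (by omega)
        exact Prod.ext this.1 this.2
      rw [e]
      exact (hfst j).prodMk (hsnd j)
  exact (measurable_pi_lambda _ fun j => (key j).fst).prodMk
    (measurable_pi_lambda _ fun j => (key j).snd)

/-! ### The jumps of the tagged particle -/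

/-- A jump of a pair of configurations due to the tagged particle. -/
structure IsTagJump (B : ℝ) (r : State → ℝ) (m : State → State) : Prop where
  nonneg : ∀ s, 0 ≤ r s
  le : ∀ s, r s ≤ B
  measurable_rate : Measurable r
  measurable_move : Measurable m
  admissible : ∀ s, AdmissiblePair s → 0 < r s → AdmissiblePair (m s)
  ordered : ∀ s ∈ orderedPairs, 0 < r s → (m s).2 ≤ (m s).1
  -- Here `θ` stands for the threshold given by the mark and the rate of the clock.
  convTo : ∀ (θ : ℝ) (x : ℕ → State) (s : State), (∀ n, x n ∈ orderedPairs) → s ∈ orderedPairs →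
    ConvTo x s → ConvTo (fun n => if θ < r (x n) then m (x n) else x n) (if θ < r s then m s else s)

lemma IsTagJump.flip {B : ℝ} {r : State → ℝ} {m : State → State} (h : IsTagJump B r m) :
    IsTagJump B (fun s => r (TaggedExclusion.flip s))
      (fun s => TaggedExclusion.flip (m (TaggedExclusion.flip s))) where
  nonneg _ := h.nonneg _
  le _ := h.le _
  measurable_rate := h.measurable_rate.comp measurable_flip
  measurable_move := measurable_flip.comp (h.measurable_move.comp measurable_flip)
  admissible s hs hr := (h.admissible _ hs.flip hr).flip
  ordered s hs hr := flip_le.2 (h.ordered _ (flip_mem_orderedPairs hs) hr)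
  convTo θ x s hx hs hc := by
    have e : ∀ s, (if θ < r (TaggedExclusion.flip s) then
        TaggedExclusion.flip (m (TaggedExclusion.flip s)) else s) =
        TaggedExclusion.flip (if θ < r (TaggedExclusion.flip s) then m (TaggedExclusion.flip s)
          else TaggedExclusion.flip s) := fun s => by
      split_ifs
      · rfl
      · rw [flip_flip]
    simp only [e]
    exact (h.convTo θ _ _ (fun n => flip_mem_orderedPairs (hx n)) (flip_mem_orderedPairs hs)
      hc.flip).flip

/-- The configuration seen from the tagged particle after a jump by `y`, with a shift of labels after
jumps to the right. -/
def advance (y : ℤ) (X : Conf) : Conf :=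
  if 0 < y then shiftLabel y (shiftSite y X) else shiftSite y X

lemma advance_apply (y : ℤ) (X : Conf) (j : ℤ) : advance y X j = X (j + max y 0) + site (-y) := by
  rw [advance]
  split_ifs with h
  · rw [max_eq_left h.le]; rfl
  · rw [max_eq_right (not_lt.1 h), add_zero]; rfl

lemma measurable_advance (y : ℤ) : Measurable (advance y) := by
  refine measurable_pi_lambda _ fun j => ?_
  simp only [advance_apply]
  exact (Measurable.of_discrete (f := fun s : Site => s + site (-y))).comp (measurable_pi_apply _)

lemma admissible_advance {X : Conf} (hX : Admissible X) {y : ℤ} (hy : TagAllowed X y) :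
    Admissible (advance y X) := by
  refine ⟨fun i => ?_, fun i h => ?_⟩
  · rw [advance_apply, advance_apply, add_right_comm, add_site_lt_add_site]
    rcases hX.1 (i + max y 0) with h | ⟨h1, h2⟩ | ⟨h1, h2⟩
    · exact Or.inl h
    · rw [h1, h2]; simp
    · rw [h1, h2]; simp
  · rw [advance_apply, add_site_eq_site] at h
    exact hy ⟨_, by rw [h]; simp⟩

/-- For `y ≤ 0` all positions increase by `-y`. For `y > 0` the particle `j + y` is at least `y`
sites to the right of a finite particle `j`, which compensates the translation. -/
lemma le_advance {X : Conf} (hX : Admissible X) (y : ℤ) : X ≤ advance y X := by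
  intro j
  rw [advance_apply]
  rcases le_total y 0 with hy | hy
  · rw [max_eq_right hy, add_zero]
    rcases site_cases (X j) with h | h | ⟨x, h⟩ <;> rw [h] <;> simp [hy]
  · rw [max_eq_left hy]
    rcases site_cases (X j) with h | h | ⟨x, h⟩
    · rw [h]; exact bot_le
    · have := hX.monotone (show j ≤ j + y by omega)
      rw [h, top_le_iff] at this
      rw [this]; simp
    · have := hX.add_nat_le h y.toNat
      rw [Int.toNat_of_nonneg hy, ← add_site_le_add_site (-y)] at this
      rw [h]
      simpa using this

/-- Unless all particles are at infinity on the same side, finitely many coordinates determine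
whether a site is occupied. -/
lemma Admissible.cases_site {X : Conf} (hX : Admissible X) (y : ℤ) :
    (∀ k, X k = ⊥) ∨ (∀ k, X k = ⊤) ∨ (∃ k, X k = site y) ∨
      ∃ k, X k < site y ∧ site y < X (k + 1) := by
  by_cases h1 : ∃ i, X i ≤ site y
  swap
  · right; left
    push Not at h1
    intro k
    rcases site_cases (X k) with h | h | ⟨x, h⟩
    · have := h1 k; rw [h] at this; simp at this
    · exact h
    · exfalso
      have h2 := h1 k
      rw [h, site_lt_site] at h2
      -- Going `x - y` labels to the left lowers a finite position by at least `x - y`, hence to `y`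
      -- or below.
      have h3 := h1 (k - (x - y))
      rcases site_cases (X (k - (x - y))) with h' | h' | ⟨x', h'⟩
      · rw [h'] at h3; simp at h3
      · have := hX.monotone (show k - (x - y) ≤ k by omega)
        rw [h', h] at this
        simp at this
      · have := hX.add_nat_le h' (x - y).toNat
        rw [Int.toNat_of_nonneg (by omega), sub_add_cancel, h, site_le_site] at this
        rw [h', site_lt_site] at h3
        omega
  by_cases h2 : ∃ i, site y < X i
  swap
  · left
    push Not at h2
    intro k
    rcases site_cases (X k) with h | h | ⟨x, h⟩
    · exact h
    · have := h2 k; rw [h] at this; simp at this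
    · exfalso
      have h3 := h2 k
      rw [h, site_le_site] at h3
      have h4 := (hX.add_nat_le h (y - x + 1).toNat).trans (h2 _)
      rw [Int.toNat_of_nonneg (by omega), site_le_site] at h4
      omega
  right; right
  obtain ⟨i₁, hi₁⟩ := h1
  obtain ⟨i₂, hi₂⟩ := h2
  have hbd : BddAbove {k : ℤ | X k ≤ site y} := ⟨i₂, fun k hk => by
    by_contra! hlt
    exact absurd ((hi₂.trans_le (hX.monotone hlt.le)).trans_le hk) (lt_irrefl _)⟩
  have hmem := Int.csSup_mem ⟨i₁, hi₁⟩ hbd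
  set k := sSup {k : ℤ | X k ≤ site y}
  have hk : site y < X (k + 1) := by
    by_contra! hle
    have := le_csSup hbd (show k + 1 ∈ {k : ℤ | X k ≤ site y} from hle)
    omega
  rcases (show X k ≤ site y from hmem).eq_or_lt with h | h
  · exact Or.inl ⟨k, h⟩
  · exact Or.inr ⟨k, h, hk⟩

lemma Admissible.tagAllowed_of_between {X : Conf} (hX : Admissible X) {y k : ℤ}
    (h1 : X k < site y) (h2 : site y < X (k + 1)) : TagAllowed X y := by
  rintro ⟨l, hl⟩
  rcases le_or_gt l k with h | h
  · exact absurd ((hX.monotone h).trans_lt h1) (by rw [hl]; exact lt_irrefl _)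
  · exact absurd (h2.trans_le (hX.monotone (show k + 1 ≤ l by omega))) (by rw [hl]; exact lt_irrefl _)

open Classical in
/-- The rate `c` of jumps of the tagged particle by `y`, if the site is empty in the upper
configuration. -/
noncomputable def tagRate (c : ℝ) (y : ℤ) (s : State) : ℝ :=
  if AdmissiblePair s ∧ TagAllowed s.1 y then c else 0

/-- A jump of the tagged particle acts on the upper configuration. -/
def tagMove (y : ℤ) (s : State) : State := (advance y s.1, s.2)

lemma measurableSet_tagAllowed (y : ℤ) : MeasurableSet {X : Conf | TagAllowed X y} := by
  have : {X : Conf | TagAllowed X y} = ⋂ k : ℤ, {X : Conf | X k ≠ site y} := by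
    ext X; simp [TagAllowed]
  rw [this]
  exact MeasurableSet.iInter fun k => by
    have hm : Measurable fun X : Conf => X k := measurable_pi_apply k
    have hs := (Set.to_countable {s : Site | s ≠ site y}).measurableSet
    exact hm hs

lemma ConvTo.advance {x : ℕ → State} {s : State} (h : ConvTo x s) (y : ℤ) :
    ConvTo (fun n => tagMove y (x n)) (tagMove y s) := fun j => by
  filter_upwards [h j, h (j + max y 0)] with n h1 h2
  refine ⟨?_, h1.2⟩
  change TaggedExclusion.advance y (x n).1 j = TaggedExclusion.advance y s.1 j
  rw [advance_apply, advance_apply, h2.1]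

/-- Vacancy of `y` is not continuous: particles at `y` with labels tending to infinity disappear in
the limit. By `cases_site` this is possible only if the limit has all its particles at one infinity.
There the jump acts trivially, so the rate is irrelevant. -/
lemma isTagJump_tagMove {c B : ℝ} (hc : 0 ≤ c) (hcB : c ≤ B) (y : ℤ) :
    IsTagJump B (tagRate c y) (tagMove y) where
  nonneg s := by rw [tagRate]; split_ifs <;> [exact hc; exact le_rfl]
  le s := by rw [tagRate]; split_ifs <;> [exact hcB; exact hc.trans hcB]
  measurable_rate := by
    classical
    exact Measurable.ite (measurableSet_admissiblePair.inter
      (measurable_fst (measurableSet_tagAllowed y))) measurable_const measurable_const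
  measurable_move := ((measurable_advance y).comp measurable_fst).prodMk measurable_snd
  admissible s hs hr := by
    rw [tagRate] at hr
    split_ifs at hr with h
    · exact ⟨admissible_advance hs.1 h.2, hs.2⟩
    · exact absurd hr (lt_irrefl _)
  ordered s hs _ := hs.2.trans (le_advance hs.1.1 y)
  convTo θ x s hx hs hconv := by
    -- if all particles are at infinity on the same side, the jump has no effect in the limit
    have hinf : tagMove y s = s → ConvTo
        (fun n => if θ < tagRate c y (x n) then tagMove y (x n) else x n)
        (if θ < tagRate c y s then tagMove y s else s) := by
      intro he
      rw [he, ite_self]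
      intro j
      filter_upwards [hconv j, hconv.advance y j] with n h1 h2
      rw [he] at h2
      split_ifs <;> assumption
    -- otherwise the rates converge
    have hfin : (∀ᶠ n in atTop, (TagAllowed (x n).1 y ↔ TagAllowed s.1 y)) → ConvTo
        (fun n => if θ < tagRate c y (x n) then tagMove y (x n) else x n)
        (if θ < tagRate c y s then tagMove y s else s) := by
      intro he j
      filter_upwards [hconv j, hconv.advance y j, he] with n h1 h2 h3
      have : tagRate c y (x n) = tagRate c y s := by
        by_cases h4 : TagAllowed s.1 y
        · rw [tagRate, tagRate, if_pos ⟨(hx n).1, h3.2 h4⟩, if_pos ⟨hs.1, h4⟩]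
        · rw [tagRate, tagRate, if_neg fun h => h4 (h3.1 h.2), if_neg fun h => h4 h.2]
      rw [this]
      split_ifs <;> assumption
    rcases hs.1.1.cases_site y with h | h | ⟨k, hk⟩ | ⟨k, hk, hk'⟩
    · refine hinf (Prod.ext (funext fun j => ?_) rfl)
      change advance y s.1 j = s.1 j
      rw [advance_apply, h, h, bot_add_site]
    · refine hinf (Prod.ext (funext fun j => ?_) rfl)
      change advance y s.1 j = s.1 j
      rw [advance_apply, h, h, top_add_site]
    · refine hfin ?_
      filter_upwards [hconv k] with n hn
      exact iff_of_false (fun h' => h' ⟨k, hn.1.trans hk⟩) fun h' => h' ⟨k, hk⟩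
    · refine hfin ?_
      filter_upwards [hconv k, hconv (k + 1)] with n hn hn'
      refine iff_of_true ((hx n).1.1.tagAllowed_of_between (k := k) ?_ ?_)
        (hs.1.1.tagAllowed_of_between hk hk')
      · rw [hn.1]; exact hk
      · rw [hn'.1]; exact hk'

lemma tagAllowed_reflect (X : Conf) (y : ℤ) : TagAllowed (reflect X) (-y) ↔ TagAllowed X y := by
  rw [TagAllowed, TagAllowed, ← negSite_site, mem_range_reflect]

lemma reflect_advance (X : Conf) (y : ℤ) :
    reflect (advance (-y) (reflect X)) =
      if y < 0 then shiftLabel y (shiftSite y X) else shiftSite y X := by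
  funext j
  rw [reflect_apply, advance_apply, reflect_apply, negSite_add_site, negSite_negSite, neg_neg]
  split_ifs with h
  · rw [max_eq_left (by omega)]
    simp only [shiftLabel, shiftSite]
    congr 2; ring
  · rw [max_eq_right (by omega)]
    simp only [shiftSite]
    congr 2; ring

end TaggedExclusion

/-! ### The joint dynamics and its marginals. -/

namespace TaggedExclusion

/-! ### The coupling of two labelled processes -/

/-- The kinds of coupled jumps of the particles with a given label: the direction, which of the two
configurations initiates the jump, and the length of the jump. -/
abbrev JumpKind (R : ℤ) : Type := Bool × Bool × Finset.Icc (1 : ℤ) R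

/-- The rates of the coupled jumps at the label `i`. -/
noncomputable def exchangeRate (R : ℤ) (pr pl : ℤ → ℤ → ℝ) (i : ℤ) (a : JumpKind R) (s : State) : ℝ :=
  if a.1 then rightRate pr R a.2.1 i a.2.2 s
  else rightRate (reflectRates pl) R a.2.1 (-i) a.2.2 (flip s)

/-- The coupled jumps at the label `i`. -/
noncomputable def exchangeMove (R : ℤ) (pr pl : ℤ → ℤ → ℝ) (i : ℤ) (a : JumpKind R) (s : State) :
    State :=
  if a.1 then rightMove pr R a.2.1 i a.2.2 s
  else flip (rightMove (reflectRates pl) R a.2.1 (-i) a.2.2 (flip s))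

lemma isLocalJump_exchange {R : ℤ} {pr pl : ℤ → ℤ → ℝ} (hpr : AttractiveRight pr)
    (hpl : AttractiveRight pl) {B : ℝ} (hB0 : 0 ≤ B) (hBr : ∀ x y, pr x y ≤ B)
    (hBl : ∀ x y, pl x y ≤ B) (i : ℤ) (a : JumpKind R) :
    IsLocalJump (R + 1) B i (exchangeRate R pr pl i a) (exchangeMove R pr pl i a) := by
  obtain ⟨c, b, z, hz⟩ := a
  have hz' := Finset.mem_Icc.1 hz
  cases c
  · exact (isLocalJump_right hpl.reflectRates hB0 (fun x y => hBl _ _) b (-i)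
      (zero_lt_one.trans_le hz'.1) hz'.2).flip
  · exact isLocalJump_right hpr hB0 hBr b i (zero_lt_one.trans_le hz'.1) hz'.2

/-- The joint dynamics, with the jumps `mt y` of the tagged particle at the rates `rt y`. -/
noncomputable def coupling (R : ℤ) (pr pl : ℤ → ℤ → ℝ) (B : Set.Ioi (0 : ℝ))
    (lam : ℤ → Set.Ioi (0 : ℝ)) (rt : ℤ → State → ℝ) (mt : ℤ → State → State) :
    Dynamics (JumpKind R) where
  rate := Sum.elim (fun ia => exchangeRate R pr pl ia.1 ia.2) rt
  move := Sum.elim (fun ia => exchangeMove R pr pl ia.1 ia.2) mt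
  bound := Sum.elim (fun _ => B) lam
  dom := orderedPairs
  width := R + 1

/-- Each defining condition involves at most two neighbouring labels, so it is inherited from a
single late term. -/
lemma mem_orderedPairs_of_convTo {x : ℕ → State} {s : State} (hx : ∀ n, x n ∈ orderedPairs)
    (h : ConvTo x s) : s ∈ orderedPairs := by
  refine ⟨⟨⟨fun i => ?_, fun i => ?_⟩, ⟨fun i => ?_, fun i => ?_⟩⟩, fun i => ?_⟩
  all_goals
    obtain ⟨n, h1, h2⟩ := ((h i).and (h (i + 1))).exists
  · rw [← h1.1, ← h2.1]; exact (hx n).1.1.1 i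
  · rw [← h1.1]; exact (hx n).1.1.2 i
  · rw [← h1.2, ← h2.2]; exact (hx n).1.2.1 i
  · rw [← h1.2]; exact (hx n).1.2.2 i
  · rw [← h1.1, ← h1.2]; exact (hx n).2 i

section coupling

variable {R : ℤ} {pr pl : ℤ → ℤ → ℝ} {B : Set.Ioi (0 : ℝ)} {lam : ℤ → Set.Ioi (0 : ℝ)}
  {rt : ℤ → State → ℝ} {mt : ℤ → State → State}
  (hR : 0 < R) (hpr : AttractiveRight pr) (hpl : AttractiveRight pl)
  (hBr : ∀ x y, pr x y ≤ B) (hBl : ∀ x y, pl x y ≤ B)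
  (hlam : Summable fun y => (lam y : ℝ)) (ht : ∀ y, IsTagJump (lam y) (rt y) (mt y))

include hpr hpl hBr hBl ht in
lemma coupling_admissible (k : Kind (JumpKind R)) (s : State) (hs : AdmissiblePair s)
    (h : 0 < (coupling R pr pl B lam rt mt).rate k s) :
    AdmissiblePair ((coupling R pr pl B lam rt mt).move k s) := by
  rcases k with ⟨i, a⟩ | y
  · exact (isLocalJump_exchange hpr hpl B.2.le hBr hBl i a).admissible s hs h
  · exact (ht y).admissible s hs h

include hR hpr hpl hBr hBl hlam ht in
lemma isRegular_coupling : (coupling R pr pl B lam rt mt).IsRegular := by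
  have hex := isLocalJump_exchange (R := R) hpr hpl B.2.le hBr hBl
  -- The absolute value of the mark in `op` serves here: acceptance implies a positive rate for
  -- every real mark, not only for marks in the support of `markLaw`.
  have hpos : ∀ k u s, |u| * ((coupling R pr pl B lam rt mt).bound k : ℝ) <
      (coupling R pr pl B lam rt mt).rate k s → 0 < (coupling R pr pl B lam rt mt).rate k s :=
    fun k u s h => (mul_nonneg (abs_nonneg u)
      ((coupling R pr pl B lam rt mt).bound k).2.le).trans_lt h
  have hout : ∀ i a u s j, (j < i - (R + 1) ∨ i + (R + 1) < j) →
      AgreeAt j ((coupling R pr pl B lam rt mt).op (Sum.inl (i, a)) u s) s := by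
    intro i a u s j hj
    rw [Dynamics.op]
    split_ifs
    · exact (hex i a).outside s j hj
    · exact AgreeAt.refl _ _
  refine ⟨?_, ?_, measurableSet_orderedPairs, ⟨?_, fun x z hx h => mem_orderedPairs_of_convTo hx h,
    fun i a u z _ j hj => hout i a u z j hj, ?_, ?_⟩, ?_, hout, ⟨B, fun _ => rfl⟩, hlam, ?_, ?_⟩
  · rintro (⟨i, a⟩ | y)
    · exact (hex i a).measurable_rate
    · exact (ht y).measurable_rate
  · rintro (⟨i, a⟩ | y)
    · exact (hex i a).measurable_move
    · exact (ht y).measurable_move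
  · intro k u s hs
    rw [Dynamics.op]
    split_ifs with h
    · have h' := hpos k u s h
      refine ⟨coupling_admissible hpr hpl hBr hBl ht k s hs.1 h', ?_⟩
      rcases k with ⟨i, a⟩ | y
      · exact (hex i a).ordered s hs h'
      · exact (ht y).ordered s hs h'
    · exact hs
  · intro i a u s hs s' hs' hag j hj hj'
    obtain ⟨h1, h2⟩ := (hex i a).inside s s' hs.1 hs'.1 (iff_of_true hs.2 hs'.2) hag
    have h1' : (coupling R pr pl B lam rt mt).rate (Sum.inl (i, a)) s =
      (coupling R pr pl B lam rt mt).rate (Sum.inl (i, a)) s' := h1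
    rw [Dynamics.op, Dynamics.op, h1']
    split_ifs
    · exact h2 j hj hj'
    · exact hag j hj hj'
  · intro y u x s hx hs h
    exact (ht y).convTo (|u| * lam y) x s hx hs h
  · change 0 < R + 1
    omega
  · rintro (⟨i, a⟩ | y) s
    · exact (hex i a).nonneg s
    · exact (ht y).nonneg s
  · rintro (⟨i, a⟩ | y) s
    · exact (hex i a).le s
    · exact (ht y).le s

end coupling

/-! ### The marginals of the coupling -/

lemma not_jumpAllowed_zero (X : Conf) (i : ℤ) : ¬ JumpAllowed X i 0 := fun h => by
  refine h.1 ⟨i, ?_⟩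
  rcases site_cases (X i) with h' | h' | ⟨x, h'⟩ <;> rw [h'] <;> simp

lemma rateFrom_eq_zero {p : ℤ → ℤ → ℝ} {z : ℤ} (h : ∀ x, p x (x + z) = 0) (s : Site) :
    rateFrom p s z = 0 := by
  rcases site_cases s with rfl | rfl | ⟨x, rfl⟩
  · rfl
  · rfl
  · exact h x

lemma rateFrom_congr {p p' : ℤ → ℤ → ℝ} {z : ℤ} (h : ∀ x, p x (x + z) = p' x (x + z)) (s : Site) :
    rateFrom p s z = rateFrom p' s z := by
  rcases site_cases s with rfl | rfl | ⟨x, rfl⟩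
  · rfl
  · rfl
  · exact h x

lemma jumpRate_congr_rates {p p' : ℤ → ℤ → ℝ} {z : ℤ} (h : ∀ x, p x (x + z) = p' x (x + z))
    (X : Conf) (i : ℤ) : jumpRate p X i z = jumpRate p' X i z := by
  rw [jumpRate, jumpRate, rateFrom_congr h]

/-- For local functions and finite range rates, the generator of the jumps of the red particles is
given by a finite sum. -/
lemma exchangePart_eq_sum {p : ℤ → ℤ → ℝ} {R : ℤ} (hp : ∀ x y, R < |y - x| → p x y = 0) {X : Conf}
    (hX : Admissible X) {H : Conf → ℝ} {N : Finset ℤ}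
    (hN : ∀ i, i ∉ N → ∀ Y : Conf, (∀ j, (j < i - R ∨ i + R < j) → Y j = X j) → H Y = H X) :
    exchangePart p H X = ∑ i ∈ N,
      (∑ z ∈ Finset.Icc 1 R, jumpRate p X i z * (H (jump X i z) - H X) +
        ∑ z ∈ Finset.Icc 1 R, jumpRate p X i (-z) * (H (jump X i (-z)) - H X)) := by
  classical
  have hterm : ∀ iz : ℤ × ℤ, rateFrom p (X iz.1) iz.2 *
      (if JumpAllowed X iz.1 iz.2 then H (jump X iz.1 iz.2) - H X else 0) =
      jumpRate p X iz.1 iz.2 * (H (jump X iz.1 iz.2) - H X) := fun iz => by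
    rw [jumpRate]; split_ifs <;> simp
  have hdisj : Disjoint (Finset.Icc 1 R) ((Finset.Icc 1 R).image Neg.neg) := by
    rw [Finset.disjoint_left]
    intro z hz hz'
    obtain ⟨w, hw, rfl⟩ := Finset.mem_image.1 hz'
    rw [Finset.mem_Icc] at hz hw
    omega
  rw [exchangePart, tsum_congr hterm,
    tsum_eq_sum (s := N ×ˢ (Finset.Icc 1 R ∪ (Finset.Icc 1 R).image Neg.neg)), Finset.sum_product]
  · refine Finset.sum_congr rfl fun i _ => ?_
    rw [Finset.sum_union hdisj, Finset.sum_image fun _ _ _ _ h => neg_injective h]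
  · rintro ⟨i, z⟩ hiz
    by_cases ha : JumpAllowed X i z
    swap
    · rw [jumpRate_of_not ha, zero_mul]
    by_cases hz : R < |z|
    · rw [jumpRate, rateFrom_eq_zero (fun x => hp _ _ (by rwa [add_sub_cancel_left])), ite_self,
        zero_mul]
    have hi : i ∉ N := fun hi => by
      refine hiz (Finset.mem_product.2 ⟨hi, ?_⟩)
      have h0 : z ≠ 0 := fun h0 => not_jumpAllowed_zero X i (h0 ▸ ha)
      rw [not_lt, abs_le] at hz
      rcases lt_or_gt_of_ne h0 with h | h
      · exact Finset.mem_union_right _ (Finset.mem_image.2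
          ⟨-z, Finset.mem_Icc.2 (by omega), neg_neg z⟩)
      · exact Finset.mem_union_left _ (Finset.mem_Icc.2 (by omega))
    rw [hN i hi _ fun j hj => jump_outside_abs hX ha (by omega), sub_self, mul_zero]

lemma sum_jumpRate_combined {pr pl : ℤ → ℤ → ℝ} (hpr : AttractiveRight pr)
    (hpl : AttractiveRight pl) (R : ℤ) (X : Conf) (i : ℤ) (H : Conf → ℝ) :
    ∑ z ∈ Finset.Icc 1 R, jumpRate (combined pr pl) X i z * (H (jump X i z) - H X) +
        ∑ z ∈ Finset.Icc 1 R, jumpRate (combined pr pl) X i (-z) * (H (jump X i (-z)) - H X) =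
      ∑ z ∈ Finset.Icc 1 R, jumpRate pr X i z * (H (jump X i z) - H X) +
        ∑ z ∈ Finset.Icc 1 R, jumpRate (fun x y => pl y x) X i (-z) *
          (H (jump X i (-z)) - H X) := by
  congr 1 <;> refine Finset.sum_congr rfl fun z hz => ?_ <;> rw [Finset.mem_Icc] at hz
  · rw [jumpRate_congr_rates (p' := pr) fun x => by
      rw [combined, hpl.eq_zero _ _ (by omega), add_zero]]
  · rw [jumpRate_congr_rates (p' := fun x y => pl y x) fun x => by
      rw [combined, hpr.eq_zero _ _ (by omega), zero_add]]

/-- The jumps at the label `i` act on the upper configuration as in its own dynamics. -/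
lemma sum_exchange_fst {R : ℤ} {pr pl : ℤ → ℤ → ℝ} (hpr : AttractiveRight pr)
    (hpl : AttractiveRight pl) {s : State} (hs : AdmissiblePair s) (i : ℤ) (H : Conf → ℝ) :
    ∑ a : JumpKind R, exchangeRate R pr pl i a s * (H (exchangeMove R pr pl i a s).1 - H s.1) =
      ∑ z ∈ Finset.Icc 1 R,
          jumpRate (combined pr pl) s.1 i z * (H (jump s.1 i z) - H s.1) +
        ∑ z ∈ Finset.Icc 1 R,
          jumpRate (combined pr pl) s.1 i (-z) * (H (jump s.1 i (-z)) - H s.1) := by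
  rw [sum_jumpRate_combined hpr hpl, ← sum_rightRate_fst hpr hs i H, Fintype.sum_prod_type,
    Fintype.sum_bool, Fintype.sum_prod_type, Fintype.sum_prod_type]
  congr 1
  · exact Finset.sum_congr rfl fun b _ => Finset.sum_coe_sort (Finset.Icc 1 R)
      fun z => rightRate pr R b i z s * (H (rightMove pr R b i z s).1 - H s.1)
  -- For jumps to the left the upper configuration is, after reflection, the lower one of the
  -- flipped pair.
  · have h := sum_rightRate_snd (R := R) hs.flip (-i) hpl.reflectRates.nonneg fun X => H (reflect X)
    simp only [flip, reflect_reflect, jumpRate_reflect] at h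
    refine Eq.trans ?_ (h.trans (Finset.sum_congr rfl fun z hz => ?_))
    · exact Finset.sum_congr rfl fun b _ => Finset.sum_coe_sort (Finset.Icc 1 R)
        fun z => rightRate (reflectRates pl) R b (-i) z (flip s) *
          (H (reflect (rightMove (reflectRates pl) R b (-i) z (flip s)).2) - H s.1)
    · rw [reflect_jump _ _ (by have := (Finset.mem_Icc.1 hz).1; omega)]

/-- The jumps at the label `i` act on the lower configuration as in its own dynamics. -/
lemma sum_exchange_snd {R : ℤ} {pr pl : ℤ → ℤ → ℝ} (hpr : AttractiveRight pr)
    (hpl : AttractiveRight pl) {s : State} (hs : AdmissiblePair s) (i : ℤ) (H : Conf → ℝ) :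
    ∑ a : JumpKind R, exchangeRate R pr pl i a s * (H (exchangeMove R pr pl i a s).2 - H s.2) =
      ∑ z ∈ Finset.Icc 1 R,
          jumpRate (combined pr pl) s.2 i z * (H (jump s.2 i z) - H s.2) +
        ∑ z ∈ Finset.Icc 1 R,
          jumpRate (combined pr pl) s.2 i (-z) * (H (jump s.2 i (-z)) - H s.2) := by
  rw [sum_jumpRate_combined hpr hpl, ← sum_rightRate_snd hs i hpr.nonneg H, Fintype.sum_prod_type,
    Fintype.sum_bool, Fintype.sum_prod_type, Fintype.sum_prod_type]
  congr 1
  · exact Finset.sum_congr rfl fun b _ => Finset.sum_coe_sort (Finset.Icc 1 R)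
      fun z => rightRate pr R b i z s * (H (rightMove pr R b i z s).2 - H s.2)
  · have h := sum_rightRate_fst (R := R) hpl.reflectRates hs.flip (-i) fun X => H (reflect X)
    simp only [flip, reflect_reflect, jumpRate_reflect] at h
    refine Eq.trans ?_ (h.trans (Finset.sum_congr rfl fun z hz => ?_))
    · exact Finset.sum_congr rfl fun b _ => Finset.sum_coe_sort (Finset.Icc 1 R)
        fun z => rightRate (reflectRates pl) R b (-i) z (flip s) *
          (H (reflect (rightMove (reflectRates pl) R b (-i) z (flip s)).1) - H s.2)
    · rw [reflect_jump _ _ (by have := (Finset.mem_Icc.1 hz).1; omega)]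

lemma BddLocal.fst {H : Conf → ℝ} (h : BddLocal H) : BddLocalPair fun w => H w.1 := by
  obtain ⟨⟨t, ht⟩, C, hC⟩ := h
  exact ⟨⟨t, fun z z' hz => ht _ _ fun j hj => (hz j hj).1⟩, C, fun z => hC _⟩

lemma BddLocal.snd {H : Conf → ℝ} (h : BddLocal H) : BddLocalPair fun w => H w.2 := by
  obtain ⟨⟨t, ht⟩, C, hC⟩ := h
  exact ⟨⟨t, fun z z' hz => ht _ _ fun j hj => (hz j hj).2⟩, C, fun z => hC _⟩

/-- Jumps far from the coordinates of a local function do not matter. -/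
lemma BddLocal.exists_finset {H : Conf → ℝ} (h : BddLocal H) (w : ℤ) :
    ∃ N : Finset ℤ, ∀ i, i ∉ N → ∀ X Y : Conf,
      (∀ j, (j < i - w ∨ i + w < j) → Y j = X j) → H Y = H X := by
  classical
  obtain ⟨⟨t, ht⟩, -⟩ := h
  refine ⟨t.biUnion fun j => Finset.Icc (j - w) (j + w), fun i hi X Y hXY => ht _ _ fun j hj => ?_⟩
  refine hXY j ?_
  by_contra hcon
  exact hi (Finset.mem_biUnion.2 ⟨j, hj, Finset.mem_Icc.2 (by omega)⟩)

section marginals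

variable {R : ℤ} {pr pl : ℤ → ℤ → ℝ} {B : Set.Ioi (0 : ℝ)} {lam : ℤ → Set.Ioi (0 : ℝ)}
  {rt : ℤ → State → ℝ} {mt : ℤ → State → State}
  (hR : 0 < R) (hpr : AttractiveRight pr) (hpl : AttractiveRight pl)
  (hBr : ∀ x y, pr x y ≤ B) (hBl : ∀ x y, pl x y ≤ B)
  (hlam : Summable fun y => (lam y : ℝ)) (ht : ∀ y, IsTagJump (lam y) (rt y) (mt y))

include hR hpr hpl hBr hBl hlam ht in
/-- The generator of the coupling is the sum of the contributions of the labels near the coordinates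
of the function and of the tagged particle. -/
lemma generator_coupling {F : State → ℝ} (hF : BddLocalPair F) {s : State} {N : Finset ℤ}
    (hN : ∀ i, i ∉ N → ∀ s', (∀ j, (j < i - (R + 1) ∨ i + (R + 1) < j) → AgreeAt j s' s) →
      F s' = F s) :
    (coupling R pr pl B lam rt mt).generator F s =
      ∑ i ∈ N, ∑ a, exchangeRate R pr pl i a s * (F (exchangeMove R pr pl i a s) - F s) +
        ∑' y, rt y s * (F (mt y s) - F s) := by
  have hsum := (isRegular_coupling hR hpr hpl hBr hBl hlam ht).hasSum_generator hF s
  have hinl : HasSum (fun ia : ℤ × JumpKind R =>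
      exchangeRate R pr pl ia.1 ia.2 s * (F (exchangeMove R pr pl ia.1 ia.2 s) - F s))
      (∑ i ∈ N, ∑ a, exchangeRate R pr pl i a s * (F (exchangeMove R pr pl i a s) - F s)) := by
    rw [← Finset.sum_product']
    refine hasSum_sum_of_ne_finset_zero fun ia hia => ?_
    have hi : ia.1 ∉ N := fun h => hia (Finset.mem_product.2 ⟨h, Finset.mem_univ _⟩)
    rw [hN _ hi _ fun j hj =>
      (isLocalJump_exchange hpr hpl B.2.le hBr hBl ia.1 ia.2).outside s j hj, sub_self, mul_zero]
  have hinr : HasSum (fun y => rt y s * (F (mt y s) - F s)) (∑' y, rt y s * (F (mt y s) - F s)) :=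
    (hsum.summable.comp_injective Sum.inr_injective).hasSum
  exact hsum.unique (hinl.sum hinr)

include hR hpr hpl hBr hBl hlam ht in
lemma hasMarginals_coupling (hRr : ∀ x y, R < |y - x| → combined pr pl x y = 0)
    {q q' : ℤ → ℝ} {m m' : ℤ → Conf → Conf}
    (hfst : ∀ s, AdmissiblePair s → ∀ H : Conf → ℝ,
      tagPart q m H s.1 = ∑' y, rt y s * (H (mt y s).1 - H s.1))
    (hsnd : ∀ s, AdmissiblePair s → ∀ H : Conf → ℝ,
      tagPart q' m' H s.2 = ∑' y, rt y s * (H (mt y s).2 - H s.2)) :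
    HasMarginals (coupling R pr pl B lam rt mt).generator
      (fun H X => exchangePart (combined pr pl) H X + tagPart q m H X)
      (fun H X => exchangePart (combined pr pl) H X + tagPart q' m' H X) := by
  intro H hH s hs
  obtain ⟨N, hN⟩ := hH.exists_finset (R + 1)
  have hN' : ∀ X : Conf, ∀ i, i ∉ N → ∀ Y : Conf, (∀ j, (j < i - R ∨ i + R < j) → Y j = X j) →
      H Y = H X := fun X i hi Y hXY => hN i hi X Y fun j hj => hXY j (by omega)
  constructor
  · rw [generator_coupling hR hpr hpl hBr hBl hlam ht hH.fst (N := N)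
      fun i hi s' h => hN i hi _ _ fun j hj => (h j hj).1]
    beta_reduce
    rw [hfst s hs, exchangePart_eq_sum hRr hs.1 (hN' s.1)]
    simp only [sum_exchange_fst hpr hpl hs]
  · rw [generator_coupling hR hpr hpl hBr hBl hlam ht hH.snd (N := N)
      fun i hi s' h => hN i hi _ _ fun j hj => (h j hj).2]
    beta_reduce
    rw [hsnd s hs, exchangePart_eq_sum hRr hs.2 (hN' s.2)]
    simp only [sum_exchange_snd hpr hpl hs]

end marginals

end TaggedExclusion

/-! ### The two comparisons, and the reduction of range two to the general class. -/

namespace TaggedExclusion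

/-! ### The comparisons -/

lemma monotoneCoupling_combined {pr pl : ℤ → ℤ → ℝ} (hpr : AttractiveRight pr)
    (hpl : AttractiveRight pl) {c q q' : ℤ → ℝ} {m m' : ℤ → Conf → Conf}
    {rt : ℤ → State → ℝ} {mt : ℤ → State → State} (hc0 : ∀ y, 0 ≤ c y) (hc : Summable c)
    (ht : ∀ y B, c y ≤ B → IsTagJump B (rt y) (mt y))
    (hfst : ∀ s, AdmissiblePair s → ∀ H : Conf → ℝ,
      tagPart q m H s.1 = ∑' y, rt y s * (H (mt y s).1 - H s.1))
    (hsnd : ∀ s, AdmissiblePair s → ∀ H : Conf → ℝ,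
      tagPart q' m' H s.2 = ∑' y, rt y s * (H (mt y s).2 - H s.2)) :
    MonotoneCoupling (fun H X => exchangePart (combined pr pl) H X + tagPart q m H X)
      (fun H X => exchangePart (combined pr pl) H X + tagPart q' m' H X) := by
  obtain ⟨Rr, hRr, hRr'⟩ := hpr.finite_range
  obtain ⟨Rl, hRl, hRl'⟩ := hpl.finite_range
  obtain ⟨Br, hBr⟩ := hpr.bounded
  obtain ⟨Bl, hBl⟩ := hpl.bounded
  -- Clocks need strictly positive rates whereas `c` may vanish; adding a summable positive family
  -- preserves summability, and thinning removes the surplus.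
  obtain ⟨ε, hε, T, hT, -⟩ := posSumOfEncodable (one_pos (α := ℝ)) ℤ
  have hBr0 : 0 ≤ Br := (hpr.nonneg 0 0).trans (hBr 0 0)
  have hBl0 : 0 ≤ Bl := (hpl.nonneg 0 0).trans (hBl 0 0)
  let B : Set.Ioi (0 : ℝ) := ⟨Br + Bl + 1, by rw [Set.mem_Ioi]; linarith⟩
  let lam : ℤ → Set.Ioi (0 : ℝ) := fun y => ⟨c y + ε y, add_pos_of_nonneg_of_pos (hc0 y) (hε y)⟩
  have hR : 0 < max Rr Rl := lt_max_of_lt_left hRr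
  have hBr' : ∀ x y, pr x y ≤ B := fun x y => (hBr x y).trans (by simp only [B]; linarith)
  have hBl' : ∀ x y, pl x y ≤ B := fun x y => (hBl x y).trans (by simp only [B]; linarith)
  have hlam : Summable fun y => (lam y : ℝ) := hc.add hT.summable
  have ht' : ∀ y, IsTagJump (lam y) (rt y) (mt y) := fun y =>
    ht y _ (le_add_of_nonneg_right (hε y).le)
  refine (isRegular_coupling hR hpr hpl hBr' hBl' hlam ht').monotoneCoupling rfl
    (fun k s => coupling_admissible hpr hpl hBr' hBl' ht' k s)
    (hasMarginals_coupling hR hpr hpl hBr' hBl' hlam ht' (fun x y hxy => ?_) hfst hsnd)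
  rw [max_lt_iff, lt_abs, lt_abs] at hxy
  rw [combined]
  rcases le_total x y with h | h
  · rw [hRr' x y (by omega), hpl.eq_zero _ _ h, add_zero]
  · rw [hpr.eq_zero _ _ h, hRl' y x (by omega), add_zero]

/-- At an attempt of the tagged particle only the upper configuration moves, which raises it; the
lower process has no such jumps. -/
theorem genR_gen_combined {pr pl : ℤ → ℤ → ℝ} (hpr : AttractiveRight pr)
    (hpl : AttractiveRight pl) {q : ℤ → ℝ} (hq0 : ∀ y, 0 ≤ q y) (hq : Summable q) :
    MonotoneCoupling (genR (combined pr pl) q) (gen (combined pr pl) 0) := by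
  classical
  refine monotoneCoupling_combined hpr hpl (q := q) (q' := 0) hq0 hq
    (rt := fun y => tagRate (q y) y) (mt := tagMove)
    (fun y B hB => isTagJump_tagMove (hq0 y) hB y) (fun s hs H => ?_) fun s hs H => ?_
  · refine tsum_congr fun y => ?_
    by_cases h : TagAllowed s.1 y
    · rw [if_pos h, tagRate, if_pos ⟨hs, h⟩]; rfl
    · rw [if_neg h, tagRate, if_neg fun h' => h h'.2, mul_zero, zero_mul]
  · simp [tagPart, tagMove]

/-- Mirror image of the other comparison: the lower configuration is advanced by `-y` after
reflection, so the shift of labels occurs for `y < 0`. -/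
theorem gen_genL_combined {pr pl : ℤ → ℤ → ℝ} (hpr : AttractiveRight pr)
    (hpl : AttractiveRight pl) {q : ℤ → ℝ} (hq0 : ∀ y, 0 ≤ q y) (hq : Summable q) :
    MonotoneCoupling (gen (combined pr pl) 0) (genL (combined pr pl) q) := by
  classical
  refine monotoneCoupling_combined hpr hpl (q := 0) (q' := q) hq0 hq
    (rt := fun y s => tagRate (q y) (-y) (flip s)) (mt := fun y s => flip (tagMove (-y) (flip s)))
    (fun y B hB => (isTagJump_tagMove (hq0 y) hB (-y)).flip) (fun s hs H => ?_) fun s hs H => ?_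
  · simp [tagPart, tagMove, flip]
  · refine tsum_congr fun y => ?_
    have e : (flip (tagMove (-y) (flip s))).2 =
        if y < 0 then shiftLabel y (shiftSite y s.2) else shiftSite y s.2 := reflect_advance s.2 y
    rw [e]
    have e' : TagAllowed (flip s).1 (-y) ↔ TagAllowed s.2 y := tagAllowed_reflect s.2 y
    by_cases h : TagAllowed s.2 y
    · rw [if_pos h, tagRate, if_pos ⟨hs.flip, e'.2 h⟩]
    · rw [if_neg h, tagRate, if_neg fun h' => h (e'.1 h'.2), mul_zero, zero_mul]

/-- The translation invariant rates of the jumps to the right. -/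
def rightHomRates (p : ℤ → ℝ) (x y : ℤ) : ℝ :=
  if x = 0 ∨ y = 0 then 0 else if x < y then p (y - x) else 0

lemma rightHomRates_of_lt (p : ℤ → ℝ) {x y : ℤ} (hx : x ≠ 0) (hy : y ≠ 0) (h : x < y) :
    rightHomRates p x y = p (y - x) := by
  rw [rightHomRates, if_neg (not_or.2 ⟨hx, hy⟩), if_pos h]

lemma rightHomRates_of_le (p : ℤ → ℝ) {x y : ℤ} (h : y ≤ x) : rightHomRates p x y = 0 := by
  rw [rightHomRates, if_neg (not_lt.2 h), ite_self]

lemma attractiveRight_rightHomRates {p : ℤ → ℝ} (h0 : ∀ k, 0 ≤ p k) (h12 : p 2 ≤ p 1)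
    (h2 : ∀ k, 2 < k → p k = 0) : AttractiveRight (rightHomRates p) := by
  have hanti : ∀ a b, 0 < a → a ≤ b → p b ≤ p a := fun a b ha hab => by
    rcases lt_or_ge 2 b with hb | hb
    · rw [h2 b hb]; exact h0 a
    · rcases hab.eq_or_lt with rfl | hlt
      · exact le_rfl
      · obtain rfl : a = 1 := by omega
        obtain rfl : b = 2 := by omega
        exact h12
  refine ⟨fun x y => ?_, fun x y h => ?_, ⟨2, two_pos, fun x y h => ?_⟩,
    fun x x' y hx hx' hy h h' => ?_, fun x y y' hx hy hy' h h' => ?_, ⟨p 1, fun x y => ?_⟩⟩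
  · rw [rightHomRates]; split_ifs <;> [exact le_rfl; exact h0 _; exact le_rfl]
  · exact rightHomRates_of_le p h
  · rw [rightHomRates, h2 _ h, ite_self, ite_self]
  · rw [rightHomRates_of_lt p hx hy (h.trans_lt h'), rightHomRates_of_lt p hx' hy h']
    exact hanti _ _ (by omega) (by omega)
  · rw [rightHomRates_of_lt p hx hy h, rightHomRates_of_lt p hx hy' (h.trans_le h')]
    exact hanti _ _ (by omega) (by omega)
  · rw [rightHomRates]
    split_ifs with h h'
    · exact h0 1
    · exact hanti _ _ one_pos (by omega)
    · exact h0 1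

/-- The two families of rates may differ only for jumps of length zero, which are never allowed. -/
lemma exchangePart_homRates (p : ℤ → ℝ) :
    exchangePart (homRates p) =
      exchangePart (combined (rightHomRates p) (rightHomRates fun k => p (-k))) := by
  funext H X
  refine tsum_congr fun iz => ?_
  by_cases h : JumpAllowed X iz.1 iz.2
  swap
  · rw [if_neg h, mul_zero, mul_zero]
  have hz : iz.2 ≠ 0 := fun h0 => not_jumpAllowed_zero X iz.1 (h0 ▸ h)
  congr 1
  refine rateFrom_congr (fun x => ?_) _
  rw [homRates, combined]
  by_cases h0 : x = 0 ∨ x + iz.2 = 0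
  · rw [if_pos h0, rightHomRates, if_pos h0, rightHomRates, if_pos h0.symm, add_zero]
  · rw [if_neg h0]
    rw [not_or] at h0
    rcases lt_or_gt_of_ne hz with hlt | hlt
    · rw [rightHomRates_of_le _ (by omega), rightHomRates_of_lt _ h0.2 h0.1 (by omega), zero_add,
        neg_sub]
    · rw [rightHomRates_of_lt _ h0.1 h0.2 (by omega), rightHomRates_of_le _ (by omega), add_zero]

end TaggedExclusion

theorem mainTheorem6 :
    (∀ (p q : ℤ → ℝ), TaggedExclusion.AttractiveRangeTwo p → (∀ y, 0 ≤ q y) → Summable q →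
      TaggedExclusion.MonotoneCoupling
          (TaggedExclusion.genR (TaggedExclusion.homRates p) q)
          (TaggedExclusion.gen (TaggedExclusion.homRates p) 0) ∧
        TaggedExclusion.MonotoneCoupling
          (TaggedExclusion.gen (TaggedExclusion.homRates p) 0)
          (TaggedExclusion.genL (TaggedExclusion.homRates p) q)) ∧
    (∀ (pr pl : ℤ → ℤ → ℝ) (q : ℤ → ℝ), TaggedExclusion.AttractiveRight pr →
      TaggedExclusion.AttractiveRight pl → (∀ y, 0 ≤ q y) → Summable q →
      TaggedExclusion.MonotoneCoupling
          (TaggedExclusion.genR (TaggedExclusion.combined pr pl) q)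
          (TaggedExclusion.gen (TaggedExclusion.combined pr pl) 0) ∧
        TaggedExclusion.MonotoneCoupling
          (TaggedExclusion.gen (TaggedExclusion.combined pr pl) 0)
          (TaggedExclusion.genL (TaggedExclusion.combined pr pl) q)) ∧
    (∀ (X Y : TaggedExclusion.Conf) (i z : ℤ), TaggedExclusion.Admissible X →
      TaggedExclusion.Admissible Y → Y ≤ X → 0 < z → TaggedExclusion.JumpAllowed Y i z →
      ∃ z' : ℤ, 0 ≤ z' ∧ (z' = 0 ∨ TaggedExclusion.JumpAllowed X i z') ∧
        X i + TaggedExclusion.site z' ≤ max (Y i + TaggedExclusion.site z) (X i) ∧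
        TaggedExclusion.jump Y i z ≤ TaggedExclusion.jump X i z') := by
  refine ⟨fun p q hp hq0 hq => ?_, fun pr pl q hpr hpl hq0 hq =>
    ⟨TaggedExclusion.genR_gen_combined hpr hpl hq0 hq,
      TaggedExclusion.gen_genL_combined hpr hpl hq0 hq⟩,
    fun X Y i z hX hY hle hz h => TaggedExclusion.exists_following_jump hX hY hle hz h⟩
  have hpr := TaggedExclusion.attractiveRight_rightHomRates hp.nonneg hp.right
    fun k hk => hp.range_two k (hk.trans_le (le_abs_self k))
  have hpl := TaggedExclusion.attractiveRight_rightHomRates (p := fun k => p (-k))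
    (fun k => hp.nonneg _) hp.left
    fun k hk => hp.range_two _ (by rw [abs_neg]; exact hk.trans_le (le_abs_self k))
  have h1 := TaggedExclusion.genR_gen_combined hpr hpl hq0 hq
  have h2 := TaggedExclusion.gen_genL_combined hpr hpl hq0 hq
  have e := TaggedExclusion.exchangePart_homRates p
  constructor
  · unfold TaggedExclusion.genR TaggedExclusion.gen at h1 ⊢
    rwa [e]
  · unfold TaggedExclusion.genL TaggedExclusion.gen at h2 ⊢
    rwa [e]
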